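/- Let $\mathcal C$ be a small category and $F:\mathcal C\to\mathbf{Top}$ a diagram of compactly generated spaces. Let $\operatorname{hocolim}_{\mathcal C}F$ be its (Bousfield–Kan) homotopy colimit, i.e. the quotient of $\coprod_{n}\coprod_{\sigma\in N(\mathcal C)_n}\Delta^n\times F(\sigma(0))$ by the usual face and degeneracy identifications; it contains $\coprod_c F(c)$ as the part over the $0$-simplices of the nerve. Mapping spaces carry the compact-open topology, and a subscript denotes a path component. Let $p:Y\to Z$ be a fibration, where it is enough that $p$ has the homotopy lifting property with respect to $F(c)\times[0,1]^n$ for all $c\in\mathcal C$ and $n\ge 0$ (so $p$ may be a Hurewicz fibration, or a Serre fibration if all $F(c)$ are CW complexes). Let $f:\operatorname{hocolim}_{\mathcal C}F\to Z$ be a map, put $f_c:=f|_{F(c)}$, and let $g_c:F(c)\to Y$ $(c\in\mathcal C)$ be maps such that $p\circ g_c=f_c$ for every $c$, and such that $g_{c'}\circ F(\alpha)$ is homotopic to $g_c$ for every morphism $\alpha:c\to c'$. Let $\mathrm{Fib}(c)$ be the fibre over $f_c$ of $$p_c:\operatorname{map}(F(c),Y)_{g_c}\to\operatorname{map}(F(c),Z)_{f_c},\qquad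 h\mapsto p\circ h .$$ Assume that for every $c\in\mathcal C$ - the component $\operatorname{map}(F(c),Z)_{f_c}$ is simply connected, and - $\mathrm{Fib}(c)$ is a simple space, i.e. its fundamental group acts trivially on all its homotopy groups. Under these assumptions, for $i>0$ the groups $\pi_i(\mathrm{Fib}(c))$ form a contravariant functor from $\mathcal C$ to abelian groups: a morphism $\alpha:c\to c'$ acts by restriction along $F(\alpha)$, from $\mathrm{Fib}(c')$ to the fibre of $\operatorname{map}(F(c),Y)_{g_c}\to\operatorname{map}(F(c),Z)_{f_c}$ over $f_{c'}\circ F(\alpha)$, followed by transport to the fibre $\mathrm{Fib}(c)$ over $f_c$ along any path from $f_{c'}\circ F(\alpha)$ to $f_c$. Let $H^{j}(\mathcal C;\pi_i(\mathrm{Fib}))$ be the cohomology of $\mathcal C$ with coefficients in this functor, i.e. the cohomology of the cochain complex $C^j=\prod_{\sigma\in N(\mathcal C)_j}\pi_i(\mathrm{Fib}(\sigma(0)))$ with $$(\delta u)(\sigma)=\mathrm{Fib}(\sigma(0)\to\sigma(1))_*\,u(d_0\sigma)+\sum_{k=1}^{j+1}(-1)^k u(d_k\sigma).$$ If $H^{i+1}(\mathcal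 C;\pi_i(\mathrm{Fib}))=0$ for all $i>0$, then there is a map $\bar g:\operatorname{hocolim}_{\mathcal C}F\to Y$ with $p\circ\bar g=f$ and $\bar g|_{F(c)}=g_c$ for every $c\in\mathcal C$. -/

import Mathlib

open CategoryTheory

universe u v w y z

noncomputable section

/-! ### Homotopy colimits -/

/-- The disjoint union of the spaces `Δ ^ n × F (σ 0)` over all `n`-simplices
`σ = (σ 0 ⟶ σ 1 ⟶ ... ⟶ σ n)` of the nerve of `C`, for all `n`. -/
abbrev PreHocolim {C : Type w} [Category.{v} C] (F : C ⥤ TopCat.{u}) : Type (max u v w) :=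
  Σ s : (Σ n : ℕ, (Fin (n + 1) ⥤ C)), stdSimplex ℝ (Fin (s.1 + 1)) × F.obj (s.2.obj 0)

/-- The face and degeneracy identifications: for a monotone map `θ : [m] → [n]`,
an `n`-simplex `σ` of the nerve, `t ∈ Δ ^ m` and `a ∈ F (σ 0)`, the point `(θ_* t, a)` over `σ` is
identified with the point `(t, F (σ 0 ⟶ σ (θ 0)) a)` over `θ^* σ`. -/
inductive HocolimRel {C : Type w} [Category.{v} C] (F : C ⥤ TopCat.{u}) :
    PreHocolim F → PreHocolim F → Prop
  | glue {m n : ℕ} (θ : Fin (m + 1) →o Fin (n + 1)) (σ : Fin (n + 1) ⥤ C)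
      (t : stdSimplex ℝ (Fin (m + 1))) (a : F.obj (σ.obj 0)) :
      HocolimRel F ⟨⟨n, σ⟩, stdSimplex.map θ t, a⟩
        ⟨⟨m, θ.monotone.functor ⋙ σ⟩, t, (F.map (σ.map (homOfLE (Fin.zero_le (θ 0))))).hom a⟩

/-- The (Bousfield-Kan) homotopy colimit of a diagram of topological spaces, with the quotient
topology. -/
def Hocolim {C : Type w} [Category.{v} C] (F : C ⥤ TopCat.{u}) : Type (max u v w) :=
  Quot (HocolimRel F)

instance {C : Type w} [Category.{v} C] (F : C ⥤ TopCat.{u}) : TopologicalSpace (Hocolim F) :=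
  inferInstanceAs (TopologicalSpace (Quot (HocolimRel F)))

/-- The canonical inclusion of `F c` in the homotopy colimit, as the points over the
`0`-simplex `c` of the nerve. -/
def Hocolim.incl {C : Type w} [Category.{v} C] (F : C ⥤ TopCat.{u}) (c : C) :
    C(F.obj c, Hocolim F) where
  toFun a := Quot.mk _ ⟨⟨0, (Functor.const (Fin 1)).obj c⟩, stdSimplex.vertex 0, a⟩
  continuous_toFun :=
    continuous_quot_mk.comp (continuous_sigmaMk.comp (Continuous.prodMk_right _))

/-! ### Fibrations and simple spaces -/

/-- `p : Y → Z` has the homotopy lifting property with respect to the space `X`. -/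
def HasHomotopyLifting {Y : Type y} {Z : Type z} [TopologicalSpace Y] [TopologicalSpace Z]
    (p : C(Y, Z)) (X : Type u) [TopologicalSpace X] : Prop :=
  ∀ (H : C(X × unitInterval, Z)) (h : C(X, Y)), (∀ a, p (h a) = H (a, 0)) →
    ∃ K : C(X × unitInterval, Y), (∀ a, K (a, 0) = h a) ∧ ∀ q, p (K q) = H q

/-- `b` is obtained from the spheroid `a : (I ^ n, ∂ I ^ n) → (X, x₁)` by transport along the path
`γ` from `x₁` to `x₂`: there is a homotopy from `a` to `b` that restricts to `γ` on the boundary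
of the cube. -/
def IsTransportAlong {X : Type u} [TopologicalSpace X] {n : ℕ} {x₁ x₂ : X} (γ : Path x₁ x₂)
    (a : GenLoop (Fin n) X x₁) (b : GenLoop (Fin n) X x₂) : Prop :=
  ∃ H : C(unitInterval × (Fin n → unitInterval), X),
    (∀ s, H (0, s) = a s) ∧ (∀ s, H (1, s) = b s) ∧
    ∀ t, ∀ s ∈ Cube.boundary (Fin n), H (t, s) = γ t

/-- A space is simple if for every base point the fundamental group acts trivially on all homotopy
groups `π_{n+1}`: transport along a loop does not change the class of a spheroid. -/
def IsSimpleSpace (X : Type u) [TopologicalSpace X] : Prop :=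
  ∀ (n : ℕ) (x : X) (γ : Path x x) (a b : GenLoop (Fin (n + 1)) X x),
    IsTransportAlong γ a b → GenLoop.Homotopic a b

/-! ### The cochain complex of a category with coefficients in a contravariant system -/

section Cohomology

variable {C : Type w} [Category.{v} C] (A : C → Type u) [∀ c, Group (A c)]
  (φ : ∀ {c c' : C}, (c ⟶ c') → A c' → A c)

/-- `j`-cochains: the product of the groups `A (σ 0)` over the `j`-simplices `σ` of the nerve. -/
abbrev NerveCochain (j : ℕ) : Type (max u v w) := ∀ σ : Fin (j + 1) ⥤ C, A (σ.obj 0)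

variable {A}

/-- The `k`-th face `d_k σ` of a simplex of the nerve. -/
abbrev nerveFace {j : ℕ} (σ : Fin (j + 2) ⥤ C) (k : Fin (j + 2)) : Fin (j + 1) ⥤ C :=
  (Fin.strictMono_succAbove k).monotone.functor ⋙ σ

/-- The coboundary, written multiplicatively:
`(δ u) σ = ∏_{k = 0}^{j+1} (A (σ 0 ⟶ (d_k σ) 0) (u (d_k σ))) ^ ((-1) ^ k)`. For `k > 0` the
vertices `σ 0` and `(d_k σ) 0` are equal and the map is the one induced by the identity; for
`k = 0` it is the one induced by `σ 0 ⟶ σ 1`. The factors are multiplied in the order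
`k = 0, 1, ..., j + 1`, which is immaterial when the groups are abelian. -/
def nerveCoboundary {j : ℕ} (u : NerveCochain A j) : NerveCochain A (j + 1) := fun σ =>
  (List.ofFn fun k : Fin (j + 2) =>
    (φ (σ.map (homOfLE (Fin.zero_le (k.succAbove 0)))) (u (nerveFace σ k))) ^
      ((-1 : ℤ) ^ (k : ℕ))).prod

/-- Vanishing of the cohomology `H ^ (j + 1) (C; A)`: every cocycle is a coboundary. -/
def NerveCohomologyVanishes (j : ℕ) : Prop :=
  ∀ u : NerveCochain A (j + 1), (∀ σ, nerveCoboundary φ u σ = 1) →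
    ∃ t : NerveCochain A j, nerveCoboundary φ t = u

end Cohomology

/-! ### Lifting problems and their fibres -/

/-- The solid square: a map `f` from the homotopy colimit to `Z`, and a strict lift `g` along
`p : Y → Z` of its restriction to the disjoint union of the `F c`. -/
structure HocolimLiftingProblem {C : Type w} [Category.{v} C] (F : C ⥤ TopCat.{u})
    (Y : Type y) (Z : Type z) [TopologicalSpace Y] [TopologicalSpace Z] where
  /-- the map along which one lifts -/
  p : C(Y, Z)
  /-- the map to be lifted -/
  f : C(Hocolim F, Z)
  /-- the partial lift -/
  g : ∀ c, C(F.obj c, Y)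
  /-- the square commutes -/
  comm : ∀ c, p.comp (g c) = f.comp (Hocolim.incl F c)

namespace HocolimLiftingProblem

variable {C : Type w} [Category.{v} C] {F : C ⥤ TopCat.{u}}
  {Y : Type y} {Z : Type z} [TopologicalSpace Y] [TopologicalSpace Z]
  (P : HocolimLiftingProblem F Y Z)

/-- The restriction `f_c` of `f` to `F c`. -/
abbrev res (c : C) : C(F.obj c, Z) := P.f.comp (Hocolim.incl F c)

/-- The component `map(F c, Z)_{f_c}` of the mapping space. -/
abbrev baseComponent (c : C) : Set C(F.obj c, Z) := pathComponent (P.res c)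

/-- The component `map(F c, Y)_{g_c}` of the mapping space. -/
abbrev totalComponent (c : C) : Set C(F.obj c, Y) := pathComponent (P.g c)

/-- `Fib c`: the fibre over `f_c` of composition with `p`,
`map(F c, Y)_{g_c} → map(F c, Z)_{f_c}`. -/
def fib (c : C) : Set C(F.obj c, Y) := {h | h ∈ P.totalComponent c ∧ P.p.comp h = P.res c}

/-- `g_c` as base point of `Fib c`. -/
def basePt (c : C) : P.fib c := ⟨P.g c, mem_pathComponent_self _, P.comm c⟩

/-- The homotopy group `π_{n+1}(Fib c)`. -/
abbrev fibGroup (n : ℕ) (c : C) := HomotopyGroup (Fin (n + 1)) (P.fib c) (P.basePt c)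

/-- For `α : c ⟶ c'`, the spheroid `b` in `Fib c` represents the image under `Fib α` of the
spheroid `a` in `Fib c'`: the spheroid `F(α)^* a`, which lies in the fibre over `f_{c'} ∘ F(α)`, is
carried to `b`, which lies in the fibre over `f_c`, by a homotopy `H` through spheroids in the
fibres of `map(F c, Y) → map(F c, Z)` over the points `ω t` of a path in `map(F c, Z)`. The path
`γ t` is the track of the base point. -/
def IsFibTransport {n : ℕ} {c c' : C} (α : c ⟶ c')
    (a : GenLoop (Fin n) (P.fib c') (P.basePt c'))
    (b : GenLoop (Fin n) (P.fib c) (P.basePt c)) : Prop :=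
  ∃ (ω : C(unitInterval, C(F.obj c, Z))) (γ : C(unitInterval, C(F.obj c, Y)))
    (H : C(unitInterval × (Fin n → unitInterval), C(F.obj c, Y))),
    (∀ s, H (0, s) = (a s).1.comp (F.map α).hom) ∧
    (∀ s, H (1, s) = (b s).1) ∧
    (∀ t s, P.p.comp (H (t, s)) = ω t) ∧
    ∀ t, ∀ s ∈ Cube.boundary (Fin n), H (t, s) = γ t

open Classical in
/-- The map `π_{n+1}(Fib c') → π_{n+1}(Fib c)` induced by `α : c ⟶ c'`. The image of a class is
the unique class related to it by `IsFibTransport`; existence follows from the homotopy lifting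
property, uniqueness from simple connectivity of the base and simplicity of the fibre. -/
def fibMap (n : ℕ) {c c' : C} (α : c ⟶ c') (x : P.fibGroup n c') : P.fibGroup n c :=
  Classical.epsilon fun x' : P.fibGroup n c =>
    ∃ (a : GenLoop (Fin (n + 1)) (P.fib c') (P.basePt c'))
      (b : GenLoop (Fin (n + 1)) (P.fib c) (P.basePt c)),
      x = Quotient.mk (GenLoop.Homotopic.setoid _ _) a ∧
      x' = Quotient.mk (GenLoop.Homotopic.setoid _ _) b ∧ P.IsFibTransport α a b

end HocolimLiftingProblem

end

/-!
By the exponential law, a lift of `f` to `Y` amounts to a compatible family of lifts of the maps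
`Δ ^ m → map(F(τ 0), Z)_f`, one for each simplex `τ` of the nerve, to `map(F(τ 0), Y)_g`. The lifts
of the vertices are given. The projection `map(F c, Y)_g → map(F c, Z)_f` is a Serre fibration with
simple fibre and simply connected base, and the family is constructed by obstruction theory over
the skeleta of the nerve (`LiftSystem.exists_lift`). Over an edge there is no obstruction: the total
space is path connected, and any two paths in the base with the same end points are homotopic.

The obstructions are defined by means of cubes. Two `(n + 1)`-cubes in the total space that lie over
the same cube in the base and agree on the boundary have a difference class
(`IsSimpleFibration.diff`) in `π_{n+1}` of the fibre: move the first cube to a constant one and let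
the second one follow. The class is well-defined since the base is simply connected and the fibre
is simple (`genLoop_homotopic_of_joinedIn`), it is additive, and it is trivial if
and only if the cubes are homotopic relative to the boundary over the base. For two cubes that agree
in codimension two, the alternating product of the difference classes of the faces is trivial
(`IsSimpleFibration.faceDiff_cubeFaces`). Hence a lift of the boundary of an `(n + 2)`-cube has an
obstruction class (`IsSimpleFibration.obst`), obtained by comparison with the boundary of any lift
of the whole cube. Its vanishing means that the lift extends
(`IsSimpleFibration.exists_filling_of_obst_eq_one`), a change of the boundary multiplies it by the
alternating product of the differences (`IsSimpleFibration.obst_change`), and the alternating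
product of the obstruction classes of the faces of an `(n + 3)`-cube is trivial
(`IsSimpleFibration.faceProd_obst`).

Simplices are reached through a map `cubeToSimplex` from the cube to the simplex that collapses the
faces `s j = 0`: all faces of the simplex are images of faces of the cube, with the appropriate
signs, and the remaining faces of the cube are mapped to simplices of smaller dimension. A lift over
the `(n + 1)`-skeleton thus has an obstruction cochain of degree `n + 2` with values in
`π_{n+1}(Fib)`, which is a cocycle and therefore, by assumption, the coboundary of a cochain `t`.
Degenerate simplices have to be lifted as prescribed by the simplices of smaller dimension, so that
only normalized cochains can be realized as differences of lifts; but the obstruction cochain is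
normalized, and then `t` can be chosen to be normalized, too (`NerveCoeff.exists_normalized`). After
a change of the lifts of the `(n + 1)`-simplices by `t⁻¹` the obstruction vanishes, and the lift
extends to the `(n + 2)`-skeleton without a change on the `n`-skeleton
(`LiftSystem.PartialLift.exists_next`). In the limit one obtains lifts of all simplices.

The coefficient system enters only through its effect on difference classes
(`HocolimLiftingProblem.isInduced_fibMap`).
-/

noncomputable section

open scoped unitInterval Topology

/-! ### Lifting along retracts of cubes -/

section Lifting

variable {E : Type*} {B : Type*} [TopologicalSpace E] [TopologicalSpace B]

/-- A Serre fibration has the right lifting property with respect to the inclusion of a retract of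
a cube: `e₀` plays the role of the partial lift, precomposed with the retraction `r`. The homotopy
from `r w` to `w` moves every coordinate at unit speed and stops as soon as it agrees with `w`, so
that it is finished at the time `‖w - r w‖`, which is zero on the retract. -/
theorem exists_lift_of_retraction {q : C(E, B)} (hq : ∀ n, HasHomotopyLifting q (Fin n → I))
    {m : ℕ} (r : C(Fin m → I, Fin m → I)) (b : C(Fin m → I, B)) (e₀ : C(Fin m → I, E))
    (h : ∀ w, q (e₀ w) = b (r w)) :
    ∃ e : C(Fin m → I, E), (∀ w, q (e w) = b w) ∧ ∀ w, r w = w → e w = e₀ w := by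
  let mv : (Fin m → I) × I → (Fin m → I) := fun p j =>
    Set.projIcc 0 1 zero_le_one
      (max ((r p.1 j : ℝ) - p.2) (min ((r p.1 j : ℝ) + p.2) (p.1 j)))
  have hmv : Continuous mv := by
    refine continuous_pi fun j => continuous_projIcc.comp ?_
    fun_prop
  have mv_zero : ∀ w, mv (w, 0) = r w := by
    intro w; funext j; ext
    have h0 := (r w j).2.1
    have h1 := (r w j).2.2
    have : max ((r w j : ℝ) - (0 : I)) (min ((r w j : ℝ) + (0 : I)) (w j)) = r w j := by
      rw [Set.Icc.coe_zero, sub_zero, add_zero]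
      exact max_eq_left (min_le_left _ _)
    simp only [mv, Set.coe_projIcc, this]
    rw [min_eq_right h1, max_eq_right h0]
  have mv_end : ∀ w (t : I), (∀ j, |(w j : ℝ) - r w j| ≤ t) → mv (w, t) = w := by
    intro w t ht; funext j; ext
    have h := abs_le.1 (ht j)
    have : max ((r w j : ℝ) - t) (min ((r w j : ℝ) + t) (w j)) = w j := by
      rw [min_eq_right (by linarith), max_eq_right (by linarith)]
    simp only [mv, Set.coe_projIcc, this]
    rw [min_eq_right (w j).2.2, max_eq_right (w j).2.1]
  obtain ⟨K, hK0, hK⟩ := hq m (b.comp ⟨mv, hmv⟩) e₀ (fun w => by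
    simp [mv_zero, h])
  have hd : ∀ w, dist w (r w) ∈ I := fun w => ⟨dist_nonneg, by
    refine (dist_pi_le_iff zero_le_one).2 fun j => ?_
    rw [Subtype.dist_eq, Real.dist_eq, abs_le]
    have := (w j).2.1; have := (w j).2.2; have := (r w j).2.1; have := (r w j).2.2
    constructor <;> linarith⟩
  refine ⟨K.comp ⟨fun w => (w, ⟨dist w (r w), hd w⟩), by fun_prop⟩, fun w => ?_, fun w hw => ?_⟩
  · simp only [ContinuousMap.comp_apply, ContinuousMap.coe_mk, hK]
    congr 1
    refine mv_end _ _ fun j => ?_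
    have := dist_le_pi_dist w (r w) j
    rwa [Subtype.dist_eq, Real.dist_eq] at this
  · have : (⟨dist w (r w), hd w⟩ : I) = 0 := Subtype.ext (by simp [hw])
    simp [this, hK0]

/-- The endpoint of the unit interval that corresponds to a truth value. -/
def bit (δ : Bool) : I := if δ then 1 else 0

@[simp] theorem bit_true : bit true = 1 := rfl
@[simp] theorem bit_false : bit false = 0 := rfl

theorem bit_injective : Function.Injective bit := by
  intro a b; cases a <;> cases b <;> simp [bit]

theorem mem_boundary_iff {m : ℕ} {w : Fin m → I} :
    w ∈ Cube.boundary (Fin m) ↔ ∃ j δ, w j = bit δ := by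
  simp [Cube.boundary, Bool.exists_bool]

/-- The union of all faces of a cube but one is a retract of the cube. The retraction is the
radial projection from a point outside the cube, opposite to the missing face. -/
theorem exists_retraction {m : ℕ} (i : Fin m) (ε : Bool) :
    ∃ r : C(Fin m → I, Fin m → I),
      (∀ w, ∃ j δ, (j, δ) ≠ (i, ε) ∧ r w j = bit δ) ∧
      ∀ w j δ, (j, δ) ≠ (i, ε) → w j = bit δ → r w = w := by
  -- `ctr` is the centre of projection; the cube is scaled by `rad` so that the faces in question
  -- lie on the unit sphere around `ctr`.
  let ctr : Fin m → ℝ := fun j => if j = i then (if ε then 2 else -1) else 1 / 2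
  let rad : Fin m → ℝ := fun j => if j = i then 2 else 1 / 2
  have hrad : ∀ j, 0 < rad j := fun j => by simp only [rad]; split_ifs <;> norm_num
  let sc : (Fin m → I) → (Fin m → ℝ) := fun w j => ((w j : ℝ) - ctr j) / rad j
  let M : (Fin m → I) → ℝ := fun w => ‖sc w‖
  have hM : Continuous M := by
    refine continuous_norm.comp (continuous_pi fun j => ?_)
    fun_prop
  have habs : ∀ w : Fin m → I, 1 ≤ |(w i : ℝ) - ctr i| := fun w => by
    have := (w i).2.1; have := (w i).2.2
    cases ε
    · simp only [ctr, if_true, Bool.false_eq_true, if_false]; rw [le_abs]; left; linarith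
    · simp only [ctr, if_true]; rw [le_abs]; right; linarith
  have hsc : ∀ w j, |sc w j| ≤ M w := fun w j => norm_le_pi_norm (sc w) j
  have hsc' : ∀ w j, |sc w j| = |(w j : ℝ) - ctr j| / rad j := fun w j => by
    simp only [sc]; rw [abs_div, abs_of_pos (hrad j)]
  have hradi : rad i = 2 := by simp [rad]
  have hMpos : ∀ w, 0 < M w := fun w => by
    have h1 := hsc w i
    rw [hsc', hradi] at h1
    have := habs w
    linarith
  have hMle : ∀ w, M w ≤ |(w i : ℝ) - ctr i| := fun w => by
    refine (pi_norm_le_iff_of_nonneg (abs_nonneg _)).2 fun j => ?_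
    rw [Real.norm_eq_abs, hsc', div_le_iff₀ (hrad j)]
    by_cases hj : j = i
    · subst hj; rw [hradi]; linarith [habs w]
    · have : |(w j : ℝ) - ctr j| ≤ 1 / 2 := by
        have := (w j).2.1; have := (w j).2.2
        simp only [ctr, if_neg hj]; rw [abs_le]; constructor <;> linarith
      simp only [rad, if_neg hj]; linarith [habs w]
  let rr : (Fin m → I) → (Fin m → ℝ) := fun w j => ctr j + ((w j : ℝ) - ctr j) / M w
  have hrr : ∀ j, Continuous fun w => rr w j := fun j => by
    refine continuous_const.add (Continuous.div (by fun_prop) hM fun w => (hMpos w).ne')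
  have hrrM : ∀ w j, |rr w j - ctr j| = rad j * (|sc w j| / M w) := fun w j => by
    simp only [rr, add_sub_cancel_left]
    rw [abs_div, abs_of_pos (hMpos w), hsc']
    have := hrad j; field_simp
  have hle : ∀ w j, |rr w j - ctr j| ≤ rad j := fun w j => by
    rw [hrrM]
    have : |sc w j| / M w ≤ 1 := (div_le_one (hMpos w)).2 (hsc w j)
    nlinarith [hrad j]
  have hmem : ∀ w j, rr w j ∈ I := fun w j => by
    have h1 := hle w j
    by_cases hj : j = i
    · subst hj
      have h2 : 1 ≤ |(w j : ℝ) - ctr j| / M w := (one_le_div (hMpos w)).2 (hMle w)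
      have h3 : rr w j = ctr j + ((w j : ℝ) - ctr j) / M w := rfl
      have := (w j).2.1; have := (w j).2.2
      rw [hradi, abs_le] at h1
      cases ε
      · have hc : ctr j = -1 := by simp [ctr]
        rw [abs_of_nonneg (by rw [hc]; linarith)] at h2
        rw [hc] at h1 h2 h3
        constructor <;> linarith
      · have hc : ctr j = 2 := by simp [ctr]
        rw [abs_of_nonpos (by rw [hc]; linarith), neg_div] at h2
        rw [hc] at h1 h2 h3
        constructor <;> linarith
    · simp only [rad, ctr, if_neg hj, abs_le] at h1
      constructor <;> linarith
  refine ⟨⟨fun w j => ⟨rr w j, hmem w j⟩, continuous_pi fun j => (hrr j).subtype_mk _⟩,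
    fun w => ?_, fun w j δ hjδ hw => ?_⟩
  · obtain ⟨j, hj⟩ : ∃ j, |sc w j| = M w := by
      have hne : Nonempty (Fin m) := ⟨i⟩
      obtain ⟨j, -, hj⟩ := Finset.exists_max_image Finset.univ (fun j => |sc w j|)
        ⟨i, Finset.mem_univ _⟩
      refine ⟨j, le_antisymm (hsc w j) ?_⟩
      exact (pi_norm_le_iff_of_nonneg (abs_nonneg _)).2 fun k => hj k (Finset.mem_univ _)
    have h1 := hrrM w j
    rw [hj, div_self (hMpos w).ne', mul_one] at h1
    have h2 := hmem w j
    by_cases hji : j = i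
    · subst hji
      refine ⟨j, !ε, by simp, Subtype.ext ?_⟩
      change rr w j = _
      rw [hradi] at h1
      have h2a := h2.1; have h2b := h2.2
      cases ε
      · have hc : ctr j = -1 := by simp [ctr]
        rw [hc] at h1
        rw [abs_of_nonneg (by linarith)] at h1
        simp; linarith
      · have hc : ctr j = 2 := by simp [ctr]
        rw [hc] at h1
        rw [abs_of_nonpos (by linarith)] at h1
        simp; linarith
    · have hr : rad j = 1 / 2 := by simp [rad, hji]
      have hc : ctr j = 1 / 2 := by simp [ctr, hji]
      rw [hr, hc] at h1
      rcases abs_eq (by norm_num) |>.1 h1 with h | h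
      · exact ⟨j, true, by simp [hji], Subtype.ext (by change rr w j = _; simp; linarith)⟩
      · exact ⟨j, false, by simp [hji], Subtype.ext (by change rr w j = _; simp; linarith)⟩
  · have hM1 : M w = 1 := by
      refine le_antisymm ?_ ?_
      · refine (pi_norm_le_iff_of_nonneg zero_le_one).2 fun k => ?_
        rw [Real.norm_eq_abs, hsc', div_le_one (hrad k), abs_le]
        have := (w k).2.1; have := (w k).2.2
        by_cases hk : k = i
        · subst hk; cases ε <;> simp [ctr, rad] <;> constructor <;> linarith
        · simp only [ctr, rad, if_neg hk]; constructor <;> linarith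
      · refine le_trans (le_of_eq ?_) (hsc w j)
        rw [hsc', hw]
        by_cases hj : j = i
        · subst hj
          have : δ = !ε := by
            cases δ <;> cases ε <;> simp_all
          subst this
          cases ε <;> norm_num [ctr, rad]
        · cases δ <;> norm_num [ctr, rad, hj, abs_of_pos, abs_of_neg]
    ext k
    change rr w k = _
    simp [rr, hM1]

/-- Lifts along a Serre fibration can be extended from the union of all faces of a cube but one.
The partial lift is given by its restrictions `h j δ` to the faces `w j = bit δ`. -/
theorem horn_filling {q : C(E, B)} (hq : ∀ n, HasHomotopyLifting q (Fin n → I))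
    {m : ℕ} (i : Fin m) (ε : Bool) (b : C(Fin m → I, B)) (h : Fin m → Bool → (Fin m → I) → E)
    (hc : ∀ j δ, (j, δ) ≠ (i, ε) → ContinuousOn (h j δ) {w | w j = bit δ})
    (hb : ∀ j δ, (j, δ) ≠ (i, ε) → ∀ w : Fin m → I, w j = bit δ → q (h j δ w) = b w)
    (hh : ∀ j δ k δ', (j, δ) ≠ (i, ε) → (k, δ') ≠ (i, ε) → ∀ w : Fin m → I, w j = bit δ →
      w k = bit δ' → h j δ w = h k δ' w) :
    ∃ e : C(Fin m → I, E), (∀ w, q (e w) = b w) ∧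
      ∀ j δ, (j, δ) ≠ (i, ε) → ∀ w : Fin m → I, w j = bit δ → e w = h j δ w := by
  classical
  obtain ⟨r, hr, hr'⟩ := exists_retraction i ε
  choose fj fδ hne hf using hr
  let e₀ : (Fin m → I) → E := fun w => h (fj w) (fδ w) (r w)
  let S : Fin m × Bool → Set (Fin m → I) := fun x => {w | x ≠ (i, ε) ∧ r w x.1 = bit x.2}
  have he : ∀ w j δ, (j, δ) ≠ (i, ε) → r w j = bit δ → e₀ w = h j δ (r w) := fun w j δ h1 h2 =>
    hh _ _ _ _ (hne w) h1 _ (hf w) h2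
  have hcont : Continuous e₀ := by
    have hfin : LocallyFinite S := locallyFinite_of_finite S
    refine hfin.continuous (Set.eq_univ_of_forall fun w => ?_) (fun x => ?_) (fun x => ?_)
    · exact Set.mem_iUnion.2 ⟨(fj w, fδ w), hne w, hf w⟩
    · have : S x = {w | x ≠ (i, ε)} ∩ (fun w => r w x.1) ⁻¹' {bit x.2} := rfl
      rw [this]
      exact isClosed_const.inter (isClosed_singleton.preimage (by fun_prop))
    · by_cases hx : x = (i, ε)
      · exact fun w hw => absurd hx hw.1
      · refine ContinuousOn.congr (f := fun w => h x.1 x.2 (r w)) ?_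
          fun w hw => he w _ _ hx hw.2
        exact (hc x.1 x.2 hx).comp r.continuous.continuousOn fun w hw => hw.2
  obtain ⟨e, he1, he2⟩ := exists_lift_of_retraction hq r b ⟨e₀, hcont⟩ fun w =>
    hb _ _ (hne w) _ (hf w)
  refine ⟨e, he1, fun j δ hjδ w hw => ?_⟩
  have hrw := hr' w j δ hjδ hw
  rw [he2 w hrw]
  change e₀ w = _
  rw [he w j δ hjδ (by rw [hrw]; exact hw), hrw]

/-- Relative homotopy lifting for cubes: a lift of a homotopy of cubes can be prescribed at the
time `0` and on the boundary of the cube. -/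
theorem homotopy_horn {q : C(E, B)} (hq : ∀ n, HasHomotopyLifting q (Fin n → I))
    {m : ℕ} (b : C(I × (Fin m → I), B)) (v : C(Fin m → I, E))
    (h : Fin m → Bool → I × (Fin m → I) → E)
    (hv : ∀ s, q (v s) = b (0, s))
    (hc : ∀ j δ, ContinuousOn (h j δ) {x | x.2 j = bit δ})
    (hb : ∀ j δ t (s : Fin m → I), s j = bit δ → q (h j δ (t, s)) = b (t, s))
    (hvh : ∀ j δ (s : Fin m → I), s j = bit δ → h j δ (0, s) = v s)
    (hh : ∀ j δ k δ' t (s : Fin m → I), s j = bit δ → s k = bit δ' →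
      h j δ (t, s) = h k δ' (t, s)) :
    ∃ e : C(I × (Fin m → I), E), (∀ x, q (e x) = b x) ∧ (∀ s, e (0, s) = v s) ∧
      ∀ j δ t (s : Fin m → I), s j = bit δ → e (t, s) = h j δ (t, s) := by
  let sp : C(Fin (m + 1) → I, I × (Fin m → I)) := ⟨fun w => (w 0, Fin.tail w), by
    unfold Fin.tail; fun_prop⟩
  let jn : C(I × (Fin m → I), Fin (m + 1) → I) := ⟨fun x => Fin.cons x.1 x.2, by
    refine continuous_pi fun j => ?_
    refine Fin.cases ?_ (fun k => ?_) j
    · simp only [Fin.cons_zero]; fun_prop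
    · simp only [Fin.cons_succ]; fun_prop⟩
  let H : Fin (m + 1) → Bool → (Fin (m + 1) → I) → E := fun j δ w =>
    Fin.cases (motive := fun _ => E) (v (Fin.tail w)) (fun k => h k δ (sp w)) j
  have key : ∀ (δ : Bool), ((0 : Fin (m + 1)), δ) ≠ (0, true) → δ = false := by
    intro δ; cases δ <;> simp
  obtain ⟨e, he, he'⟩ := horn_filling hq (0 : Fin (m + 1)) true (b.comp sp) H
    (fun j δ hj => by
      induction j using Fin.cases with
      | zero =>
        have : Continuous (H 0 δ) := by
          change Continuous fun w : Fin (m + 1) → I => v (fun k => w k.succ)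
          fun_prop
        exact this.continuousOn
      | succ k =>
        exact (hc k δ).comp sp.continuous.continuousOn fun w hw => hw)
    (fun j δ hj w hw => by
      induction j using Fin.cases with
      | zero =>
        rw [key δ hj] at hw
        change q (v (Fin.tail w)) = b (w 0, Fin.tail w)
        rw [hv, hw]; rfl
      | succ k => exact hb k δ (w 0) (Fin.tail w) hw)
    (fun j δ k δ' hj hk w hw hw' => by
      induction j using Fin.cases with
      | zero =>
        induction k using Fin.cases with
        | zero => rfl
        | succ k =>
          rw [key δ hj] at hw
          change v (Fin.tail w) = h k δ' (w 0, Fin.tail w)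
          rw [hw]; exact (hvh _ _ _ hw').symm
      | succ j =>
        induction k using Fin.cases with
        | zero =>
          rw [key δ' hk] at hw'
          change h j δ (w 0, Fin.tail w) = v (Fin.tail w)
          rw [hw']; exact hvh _ _ _ hw
        | succ k => exact hh j δ k δ' (w 0) (Fin.tail w) hw hw')
  refine ⟨e.comp jn, fun x => ?_, fun s => ?_, fun j δ t s hs => ?_⟩
  · have : sp (jn x) = x := by simp [sp, jn]
    rw [ContinuousMap.comp_apply, he, ContinuousMap.comp_apply, this]
  · have := he' 0 false (by simp) (jn (0, s)) (by simp [jn])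
    rw [ContinuousMap.comp_apply, this]
    simp [H, jn]
  · have := he' j.succ δ (by simp [Fin.succ_ne_zero]) (jn (t, s)) (by simp [jn, hs])
    rw [ContinuousMap.comp_apply, this]
    simp [H, jn, sp]

end Lifting

/-! ### Pairs of cubes with the same boundary -/

section Difference

variable {E B A : Type*} [TopologicalSpace E] [TopologicalSpace B] [TopologicalSpace A]

/-- Pairs of `N`-cubes in `E` that lie over the same cube in `B` and agree on the boundary. -/
def fibrePairs (q : C(E, B)) (N : ℕ) : Set (C(Fin N → I, E) × C(Fin N → I, E)) :=
  {x | (∀ s, q (x.1 s) = q (x.2 s)) ∧ ∀ s ∈ Cube.boundary (Fin N), x.1 s = x.2 s}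

theorem fibrePairs_refl {q : C(E, B)} {N : ℕ} (u : C(Fin N → I, E)) : (u, u) ∈ fibrePairs q N :=
  ⟨fun _ => rfl, fun _ _ => rfl⟩

theorem fibrePairs_symm {q : C(E, B)} {N : ℕ} {u v : C(Fin N → I, E)}
    (h : (u, v) ∈ fibrePairs q N) : (v, u) ∈ fibrePairs q N :=
  ⟨fun s => (h.1 s).symm, fun s hs => (h.2 s hs).symm⟩

theorem fibrePairs_trans {q : C(E, B)} {N : ℕ} {u v w : C(Fin N → I, E)}
    (h : (u, v) ∈ fibrePairs q N) (h' : (v, w) ∈ fibrePairs q N) : (u, w) ∈ fibrePairs q N :=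
  ⟨fun s => (h.1 s).trans (h'.1 s), fun s hs => (h.2 s hs).trans (h'.2 s hs)⟩

/-- A path of pairs of cubes amounts to two homotopies over the same homotopy in `B` that agree on
the boundary of the cube. -/
theorem joinedIn_fibrePairs_iff {q : C(E, B)} {N : ℕ} {u v u' v' : C(Fin N → I, E)} :
    JoinedIn (fibrePairs q N) (u, v) (u', v') ↔
      ∃ H K : C(I × (Fin N → I), E), (∀ s, H (0, s) = u s) ∧ (∀ s, H (1, s) = u' s) ∧
        (∀ s, K (0, s) = v s) ∧ (∀ s, K (1, s) = v' s) ∧ (∀ x, q (H x) = q (K x)) ∧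
        ∀ t, ∀ s ∈ Cube.boundary (Fin N), H (t, s) = K (t, s) := by
  constructor
  · rintro ⟨γ, hγ⟩
    let H : C(I, C(Fin N → I, E)) := ⟨fun t => (γ t).1, by fun_prop⟩
    let K : C(I, C(Fin N → I, E)) := ⟨fun t => (γ t).2, by fun_prop⟩
    refine ⟨H.uncurry, K.uncurry, fun s => ?_, fun s => ?_, fun s => ?_, fun s => ?_,
      fun x => (hγ x.1).1 x.2, fun t s hs => (hγ t).2 s hs⟩
    · change (γ 0).1 s = _; rw [γ.source]
    · change (γ 1).1 s = _; rw [γ.target]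
    · change (γ 0).2 s = _; rw [γ.source]
    · change (γ 1).2 s = _; rw [γ.target]
  · rintro ⟨H, K, h0, h1, k0, k1, hq, hb⟩
    refine ⟨⟨⟨fun t => (H.curry t, K.curry t), by fun_prop⟩, ?_, ?_⟩, fun t => ?_⟩
    · ext s
      · exact h0 s
      · exact k0 s
    · ext s
      · exact h1 s
      · exact k1 s
    · exact ⟨fun s => hq (t, s), fun s hs => hb t s hs⟩

theorem JoinedIn.fibrePairs_swap {q : C(E, B)} {N : ℕ} {u v u' v' : C(Fin N → I, E)}
    (h : JoinedIn (fibrePairs q N) (u, v) (u', v')) :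
    JoinedIn (fibrePairs q N) (v, u) (v', u') := by
  rw [joinedIn_fibrePairs_iff] at h ⊢
  obtain ⟨H, K, h0, h1, k0, k1, hq, hb⟩ := h
  exact ⟨K, H, k0, k1, h0, h1, fun x => (hq x).symm, fun t s hs => (hb t s hs).symm⟩

/-- Functoriality of `fibrePairs` in the fibration. -/
theorem JoinedIn.fibrePairs_map {E' B' : Type*} [TopologicalSpace E'] [TopologicalSpace B']
    {q : C(E, B)} {q' : C(E', B')} (f : C(E, E')) (g : C(B, B')) (hfg : ∀ e, q' (f e) = g (q e))
    {N : ℕ} {u v u' v' : C(Fin N → I, E)} (h : JoinedIn (fibrePairs q N) (u, v) (u', v')) :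
    JoinedIn (fibrePairs q' N) (f.comp u, f.comp v) (f.comp u', f.comp v') := by
  rw [joinedIn_fibrePairs_iff] at h ⊢
  obtain ⟨H, K, h0, h1, k0, k1, hq, hb⟩ := h
  refine ⟨f.comp H, f.comp K, ?_, ?_, ?_, ?_, ?_, ?_⟩
  · intro s; simp [h0]
  · intro s; simp [h1]
  · intro s; simp [k0]
  · intro s; simp [k1]
  · intro x; simp [hfg, hq]
  · intro t s hs; simp [hb t s hs]

/-- A path of cubes in `E` can be followed by a cube that lies over the same cube in `B` and has
the same boundary. -/
theorem exists_path_fibrePairs {q : C(E, B)} (hq : ∀ n, HasHomotopyLifting q (Fin n → I))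
    {N : ℕ} {u u' v : C(Fin N → I, E)} (γ : Path u u') (huv : (u, v) ∈ fibrePairs q N) :
    ∃ v', ∃ γ' : Path v v', ∀ t, (γ t, γ' t) ∈ fibrePairs q N := by
  let H : C(I × (Fin N → I), E) := (γ : C(I, C(Fin N → I, E))).uncurry
  have H0 : ∀ s, H (0, s) = u s := fun s => by change γ 0 s = _; rw [γ.source]
  obtain ⟨K, hK, hK0, hKb⟩ := homotopy_horn hq (q.comp H) v (fun _ _ => H)
    (fun s => by simp [H0, huv.1]) (fun _ _ => H.continuous.continuousOn)
    (fun _ _ _ _ _ => rfl)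
    (fun j δ s hs => by rw [H0, huv.2 s (mem_boundary_iff.2 ⟨j, δ, hs⟩)])
    (fun _ _ _ _ _ _ _ _ => rfl)
  refine ⟨K.curry 1, ⟨⟨fun t => K.curry t, by fun_prop⟩, ContinuousMap.ext hK0, rfl⟩,
    fun t => ⟨fun s => (hK (t, s)).symm, fun s hs => ?_⟩⟩
  obtain ⟨j, δ, hs⟩ := mem_boundary_iff.1 hs
  exact (hKb j δ t s hs).symm

theorem exists_joinedIn_fibrePairs {q : C(E, B)} (hq : ∀ n, HasHomotopyLifting q (Fin n → I))
    {N : ℕ} {u u' v : C(Fin N → I, E)} (h : Joined u u') (huv : (u, v) ∈ fibrePairs q N) :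
    ∃ v', JoinedIn (fibrePairs q N) (u, v) (u', v') := by
  obtain ⟨γ⟩ := h
  obtain ⟨v', γ', h'⟩ := exists_path_fibrePairs hq γ huv
  exact ⟨v', γ.prod γ', h'⟩

theorem joined_const [PathConnectedSpace E] {N : ℕ} (u : C(Fin N → I, E)) (e : E) :
    Joined u (ContinuousMap.const _ e) := by
  have h1 : Joined u (ContinuousMap.const _ (u 0)) := by
    let H : C(I × (Fin N → I), E) := u.comp ⟨fun x j => σ x.1 * x.2 j, by fun_prop⟩
    refine ⟨⟨⟨fun t => H.curry t, by fun_prop⟩, ?_, ?_⟩⟩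
    · ext s; simp [H]
    · ext s; simp [H]; congr
  refine h1.trans ?_
  obtain ⟨γ⟩ := PathConnectedSpace.joined (u 0) e
  refine ⟨⟨⟨fun t => ContinuousMap.const _ (γ t), ?_⟩, ?_, ?_⟩⟩
  · exact ContinuousMap.continuous_const'.comp γ.continuous
  · simp
  · simp

/-- A Serre fibration `q` with path connected total space and simply connected base, together with
an embedding `ι` of a simple space as the fibre through `ι x₀`. -/
structure IsSimpleFibration (q : C(E, B)) (ι : C(A, E)) (x₀ : A) : Prop where
  lift : ∀ n, HasHomotopyLifting q (Fin n → I)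
  pathConnected : PathConnectedSpace E
  simplyConnected : SimplyConnectedSpace B
  isEmbedding : Topology.IsEmbedding ι
  proj : ∀ a, q (ι a) = q (ι x₀)
  mem_range : ∀ e, q e = q (ι x₀) → e ∈ Set.range ι
  simple : IsSimpleSpace A

variable {q : C(E, B)} {ι : C(A, E)} {x₀ : A}

/-- The difference of the constant cube and a spheroid in the fibre. -/
theorem const_mem_fibrePairs (hF : IsSimpleFibration q ι x₀) {N : ℕ} (a : GenLoop (Fin N) A x₀) :
    (ContinuousMap.const _ (ι x₀), ι.comp a.1) ∈ fibrePairs q N :=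
  ⟨fun s => (hF.proj (a s)).symm, fun s hs => congrArg ι (a.2 s hs).symm⟩

/-- A cube that is comparable with the constant cube at the base point is a spheroid in the fibre.
-/
theorem exists_genLoop (hF : IsSimpleFibration q ι x₀) {N : ℕ} {v : C(Fin N → I, E)}
    (h : (ContinuousMap.const _ (ι x₀), v) ∈ fibrePairs q N) :
    ∃ a : GenLoop (Fin N) A x₀, ι.comp a.1 = v := by
  choose f hf using fun s => hF.mem_range (v s) (h.1 s).symm
  have hc : Continuous f := hF.isEmbedding.continuous_iff.2 (by
    convert v.continuous using 1; exact funext hf)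
  refine ⟨⟨⟨f, hc⟩, fun s hs => hF.isEmbedding.injective ?_⟩, ContinuousMap.ext hf⟩
  exact (hf s).trans (h.2 s hs).symm

theorem genLoop_homotopic_joinedIn (hF : IsSimpleFibration q ι x₀) {N : ℕ}
    {a a' : GenLoop (Fin N) A x₀} (h : GenLoop.Homotopic a a') (u : C(Fin N → I, E))
    (hu : (u, ι.comp a.1) ∈ fibrePairs q N) :
    JoinedIn (fibrePairs q N) (u, ι.comp a.1) (u, ι.comp a'.1) := by
  obtain ⟨H⟩ := h
  refine joinedIn_fibrePairs_iff.2 ⟨u.comp ⟨Prod.snd, continuous_snd⟩,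
    ι.comp H.toContinuousMap, fun _ => rfl, fun _ => rfl, fun s => ?_, fun s => ?_, fun x => ?_,
    fun t s hs => ?_⟩
  · exact congrArg ι (H.apply_zero s)
  · exact congrArg ι (H.apply_one s)
  · refine (hu.1 x.2).trans ?_
    exact (hF.proj _).trans (hF.proj _).symm
  · refine (hu.2 s hs).trans ?_
    exact congrArg ι (H.eq_fst t hs).symm

/-- If the pairs `(x₀, a)` and `(x₀, a')` are homotopic, then so are the spheroids `a` and `a'`.
Contracting the cube turns the homotopy of the first cube into a loop in `E`; since `B` is simply
connected, this loop can be moved into the fibre, and there the homotopy exhibits `a'` as the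
result of transporting `a` along a loop. -/
theorem genLoop_homotopic_of_joinedIn (hF : IsSimpleFibration q ι x₀) {n : ℕ}
    {a a' : GenLoop (Fin (n + 1)) A x₀}
    (h : JoinedIn (fibrePairs q (n + 1)) (ContinuousMap.const _ (ι x₀), ι.comp a.1)
      (ContinuousMap.const _ (ι x₀), ι.comp a'.1)) : GenLoop.Homotopic a a' := by
  obtain ⟨H, K, h0, h1, k0, k1, hq, hb⟩ := joinedIn_fibrePairs_iff.1 h
  simp only [ContinuousMap.const_apply, ContinuousMap.comp_apply] at h0 h1 k0 k1
  have := hF.simplyConnected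
  have haB : ∀ (c : GenLoop (Fin (n + 1)) A x₀) s, q (ι (c.1 s)) = q (ι x₀) := fun c s =>
    hF.proj _
  have hab : ∀ (c : GenLoop (Fin (n + 1)) A x₀) s j δ, s j = bit δ → c.1 s = x₀ :=
    fun c s j δ hs => c.2 s (mem_boundary_iff.2 ⟨j, δ, hs⟩)
  -- A homotopy of `(n + 2)`-cubes with prescribed ends `a` and `a'` and prescribed lateral faces.
  have step : ∀ (b : C(I × (Fin (n + 2) → I), B)) (V : C(I × (Fin (n + 1) → I), E))
      (U : C(I × (Fin (n + 2) → I), E)),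
      (∀ s, V (0, s) = ι (a.1 s)) → (∀ s, V (1, s) = ι (a'.1 s)) →
      (∀ t s, q (V (t, s)) = b (0, Fin.cons t s)) →
      (∀ τ s, b (τ, Fin.cons 0 s) = q (ι x₀)) → (∀ τ s, b (τ, Fin.cons 1 s) = q (ι x₀)) →
      (∀ τ, ∀ s, U (τ, Fin.cons 0 s) = ι x₀) → (∀ τ, ∀ s, U (τ, Fin.cons 1 s) = ι x₀) →
      (∀ x, q (U x) = b x) →
      (∀ t, ∀ s ∈ Cube.boundary (Fin (n + 1)), U (0, Fin.cons t s) = V (t, s)) →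
      ∃ V' : C(I × (Fin (n + 1) → I), E), (∀ s, V' (0, s) = ι (a.1 s)) ∧
        (∀ s, V' (1, s) = ι (a'.1 s)) ∧ (∀ t s, q (V' (t, s)) = b (1, Fin.cons t s)) ∧
        ∀ t, ∀ s ∈ Cube.boundary (Fin (n + 1)), V' (t, s) = U (1, Fin.cons t s) := by
    intro b V U V0 V1 hV hb0 hb1 hU0 hU1 hU hUV
    let hh : Fin (n + 2) → Bool → I × (Fin (n + 2) → I) → E := fun j δ x =>
      Fin.cases (motive := fun _ => E)
        (ι (if δ then a'.1 (fun k => x.2 k.succ) else a.1 (fun k => x.2 k.succ)))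
        (fun _ => U x) j
    have hlat : ∀ (s : Fin (n + 2) → I) δ δ' (j : Fin (n + 1)) τ, s 0 = bit δ →
        s j.succ = bit δ' → hh 0 δ (τ, s) = U (τ, s) := by
      intro s δ δ' j τ hs hs'
      have e1 : s = Fin.cons (s 0) (fun k => s k.succ) := (Fin.cons_self_tail s).symm
      cases δ
      · have : hh 0 false (τ, s) = ι x₀ := by
          change ι (a.1 _) = _
          rw [hab a _ j δ' hs']
        rw [this, e1, hs]; exact (hU0 _ _).symm
      · have : hh 0 true (τ, s) = ι x₀ := by
          change ι (a'.1 _) = _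
          rw [hab a' _ j δ' hs']
        rw [this, e1, hs]; exact (hU1 _ _).symm
    obtain ⟨e, he, he0, heb⟩ := homotopy_horn hF.lift b
      (V.comp ⟨fun s => (s 0, fun k => s k.succ), by fun_prop⟩) hh
      (fun s => by
        refine (hV _ _).trans ?_
        congr 2; exact Fin.cons_self_tail s)
      (fun j δ => by
        induction j using Fin.cases with
        | zero =>
          refine Continuous.continuousOn ?_
          cases δ
          · change Continuous fun x : I × (Fin (n + 2) → I) => ι (a.1 (fun k => x.2 k.succ))
            fun_prop
          · change Continuous fun x : I × (Fin (n + 2) → I) => ι (a'.1 (fun k => x.2 k.succ))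
            fun_prop
        | succ j => exact U.continuous.continuousOn)
      (fun j δ t s hs => by
        have e1 : s = Fin.cons (s 0) (fun k => s k.succ) := (Fin.cons_self_tail s).symm
        induction j using Fin.cases with
        | zero =>
          rw [e1, hs]
          cases δ
          · rw [bit_false, hb0]; exact haB a _
          · rw [bit_true, hb1]; exact haB a' _
        | succ j => exact hU _)
      (fun j δ s hs => by
        have e1 : s = Fin.cons (s 0) (fun k => s k.succ) := (Fin.cons_self_tail s).symm
        induction j using Fin.cases with
        | zero =>
          change _ = V (s 0, fun k => s k.succ)
          rw [hs]
          cases δ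
          · exact (V0 _).symm
          · exact (V1 _).symm
        | succ j =>
          change U (0, s) = V (s 0, fun k => s k.succ)
          rw [← hUV _ _ (mem_boundary_iff.2 ⟨j, δ, hs⟩), ← e1])
      (fun j δ k δ' t s hs hs' => by
        induction j using Fin.cases with
        | zero =>
          induction k using Fin.cases with
          | zero => rw [bit_injective (hs.symm.trans hs')]
          | succ k => exact hlat s δ δ' k t hs hs'
        | succ j =>
          induction k using Fin.cases with
          | zero => exact (hlat s δ' δ j t hs' hs).symm
          | succ k => rfl)
    have hcons : Continuous fun x : I × (Fin (n + 1) → I) =>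
        (Fin.cons x.1 x.2 : Fin (n + 2) → I) := by
      refine continuous_pi fun j => ?_
      induction j using Fin.cases with
      | zero => simpa using continuous_fst
      | succ j =>
        simp only [Fin.cons_succ]
        exact (continuous_apply j).comp continuous_snd
    refine ⟨e.comp ⟨fun x => (1, Fin.cons x.1 x.2), by fun_prop⟩, fun s => ?_, fun s => ?_,
      fun t s => he _, fun t s hs => ?_⟩
    · exact heb 0 false 1 (Fin.cons 0 s) rfl
    · exact heb 0 true 1 (Fin.cons 1 s) rfl
    · obtain ⟨j, δ, hs⟩ := mem_boundary_iff.1 hs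
      exact heb j.succ δ 1 (Fin.cons t s) (by simpa using hs)
  -- First contract the cube, so that the lateral faces are given by a loop `γ` in `E`.
  let U : C(I × (Fin (n + 2) → I), E) :=
    H.comp ⟨fun x => (x.2 0, fun k => σ x.1 * x.2 k.succ), by fun_prop⟩
  obtain ⟨V, V0, V1, hV, hVb⟩ := step (q.comp U) K U k0 k1
    (fun t s => by simp [U, hq]) (fun τ s => by simp [U, h0]) (fun τ s => by simp [U, h1])
    (fun τ s => by simp [U, h0]) (fun τ s => by simp [U, h1]) (fun x => rfl)
    (fun t s hs => by simpa [U] using hb t s hs)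
  let γ : Path (ι x₀) (ι x₀) := ⟨⟨fun t => H (t, 0), by fun_prop⟩, h0 0, h1 0⟩
  have hU1 : ∀ t s, U (1, Fin.cons t s) = γ t := fun t s => by
    simp [U, γ]; congr
  -- Then deform this loop into the fibre.
  obtain ⟨G⟩ := SimplyConnectedSpace.paths_homotopic (γ.map q.continuous) (Path.refl (q (ι x₀)))
  obtain ⟨Γ, hΓ, hΓ0, hΓb⟩ := homotopy_horn hF.lift (m := 1)
    (G.toContinuousMap.comp ⟨fun x => (x.1, x.2 0), by fun_prop⟩)
    ((γ : C(I, E)).comp ⟨fun s => s 0, by fun_prop⟩) (fun _ _ _ => ι x₀)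
    (fun s => (G.apply_zero (s 0)).symm) (fun _ _ => continuousOn_const)
    (fun j δ t s hs => by
      rw [Subsingleton.elim j 0] at hs
      simp only [ContinuousMap.comp_apply, ContinuousMap.coe_mk, hs]
      cases δ
      · exact (G.source t).symm
      · exact (G.target t).symm)
    (fun j δ s hs => by
      rw [Subsingleton.elim j 0] at hs
      simp only [ContinuousMap.comp_apply, ContinuousMap.coe_mk, hs]
      cases δ
      · exact γ.source.symm
      · exact γ.target.symm)
    (fun _ _ _ _ _ _ _ _ => rfl)
  let U' : C(I × (Fin (n + 2) → I), E) := Γ.comp ⟨fun x => (x.1, fun _ => x.2 0), by fun_prop⟩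
  have hU' : ∀ τ δ s, U' (τ, Fin.cons (bit δ) s) = ι x₀ := fun τ δ s => hΓb 0 δ τ _ rfl
  obtain ⟨W, W0, W1, hW, hWb⟩ := step (q.comp U') V U' V0 V1
    (fun t s => by
      refine (hV t s).trans ((congrArg q (hU1 t s)).trans ?_)
      exact congrArg q (hΓ0 (fun _ => t)).symm)
    (fun τ s => congrArg q (hU' τ false s)) (fun τ s => congrArg q (hU' τ true s))
    (fun τ s => hU' τ false s) (fun τ s => hU' τ true s) (fun x => rfl)
    (fun t s hs => by
      rw [hVb t s hs, hU1]
      exact hΓ0 (fun _ => t))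
  have hGend : ∀ t, q (Γ (1, fun _ => t)) = q (ι x₀) := fun t => by
    rw [hΓ]; exact G.apply_one t
  -- Everything at the end of the deformation lies in the fibre.
  choose f hf using fun x : I × (Fin (n + 1) → I) => hF.mem_range (W x) (by
    have := hW x.1 x.2
    rw [this]; exact hGend x.1)
  have hfc : Continuous f := hF.isEmbedding.continuous_iff.2 (by
    convert W.continuous using 1; exact funext hf)
  choose ω hω using fun t : I => hF.mem_range (Γ (1, fun _ => t)) (hGend t)
  have hωc : Continuous ω := hF.isEmbedding.continuous_iff.2 (by
    have : Continuous fun t : I => Γ (1, fun _ => t) := by fun_prop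
    convert this using 1; exact funext hω)
  have inj := hF.isEmbedding.injective
  let ω' : Path x₀ x₀ := ⟨⟨ω, hωc⟩, inj ((hω 0).trans (hΓb 0 false 1 _ rfl)),
    inj ((hω 1).trans (hΓb 0 true 1 _ rfl))⟩
  refine hF.simple n x₀ ω' a a' ⟨⟨f, hfc⟩, fun s => inj ((hf _).trans (W0 s)),
    fun s => inj ((hf _).trans (W1 s)), fun t s hs => inj ?_⟩
  refine (hf _).trans ((hWb t s hs).trans ?_)
  exact (hω t).symm

end Difference

/-! ### Difference classes of cubes -/

section DifferenceClass

variable {E B A : Type*} [TopologicalSpace E] [TopologicalSpace B] [TopologicalSpace A]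
  {q : C(E, B)} {ι : C(A, E)} {x₀ : A}

/-- The class of a spheroid in the homotopy group. -/
def spheroidClass {N : ℕ} (a : GenLoop (Fin N) A x₀) : HomotopyGroup (Fin N) A x₀ :=
  Quotient.mk (GenLoop.Homotopic.setoid _ _) a

theorem spheroidClass_surjective {N : ℕ} :
    Function.Surjective (spheroidClass (A := A) (x₀ := x₀) (N := N)) := Quotient.exists_rep

theorem spheroidClass_eq_iff {N : ℕ} {a a' : GenLoop (Fin N) A x₀} :
    spheroidClass a = spheroidClass a' ↔ GenLoop.Homotopic a a' := Quotient.eq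

namespace IsSimpleFibration

open Classical in
/-- The difference class in `π_{n+1}` of the fibre of two `(n + 1)`-cubes in `E` over the same cube
in `B` and with the same boundary: the class of a spheroid `a` such that the pair `(u, v)` is
homotopic to the pair `(x₀, a)`. -/
def diff (_ : IsSimpleFibration q ι x₀) {n : ℕ} (u v : C(Fin (n + 1) → I, E)) :
    HomotopyGroup (Fin (n + 1)) A x₀ :=
  if h : ∃ a : GenLoop (Fin (n + 1)) A x₀, JoinedIn (fibrePairs q (n + 1)) (u, v)
      (ContinuousMap.const _ (ι x₀), ι.comp a.1) then spheroidClass h.choose else 1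

variable {n : ℕ}

/-- The difference class does not depend on the choice of the spheroid. -/
theorem diff_eq (hF : IsSimpleFibration q ι x₀) {u v : C(Fin (n + 1) → I, E)}
    {a : GenLoop (Fin (n + 1)) A x₀}
    (h : JoinedIn (fibrePairs q (n + 1)) (u, v) (ContinuousMap.const _ (ι x₀), ι.comp a.1)) :
    hF.diff u v = spheroidClass a := by
  have h' : ∃ a : GenLoop (Fin (n + 1)) A x₀, JoinedIn (fibrePairs q (n + 1)) (u, v)
      (ContinuousMap.const _ (ι x₀), ι.comp a.1) := ⟨a, h⟩
  rw [diff, dif_pos h', spheroidClass_eq_iff]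
  exact genLoop_homotopic_of_joinedIn hF (h'.choose_spec.symm.trans h)

theorem exists_spheroid (hF : IsSimpleFibration q ι x₀) {u v : C(Fin (n + 1) → I, E)}
    (h : (u, v) ∈ fibrePairs q (n + 1)) :
    ∃ a : GenLoop (Fin (n + 1)) A x₀, JoinedIn (fibrePairs q (n + 1)) (u, v)
      (ContinuousMap.const _ (ι x₀), ι.comp a.1) := by
  have := hF.pathConnected
  obtain ⟨v', hv'⟩ := exists_joinedIn_fibrePairs hF.lift (joined_const u (ι x₀)) h
  obtain ⟨a, rfl⟩ := exists_genLoop hF hv'.mem.2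
  exact ⟨a, hv'⟩

/-- Homotopic pairs of cubes have the same difference class. -/
theorem diff_congr (hF : IsSimpleFibration q ι x₀) {u v u' v' : C(Fin (n + 1) → I, E)}
    (h : JoinedIn (fibrePairs q (n + 1)) (u, v) (u', v')) : hF.diff u v = hF.diff u' v' := by
  obtain ⟨a, ha⟩ := hF.exists_spheroid h.mem.2
  rw [hF.diff_eq ha, hF.diff_eq (h.trans ha)]

theorem diff_const (hF : IsSimpleFibration q ι x₀) (a : GenLoop (Fin (n + 1)) A x₀) :
    hF.diff (ContinuousMap.const _ (ι x₀)) (ι.comp a.1) = spheroidClass a :=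
  hF.diff_eq (JoinedIn.refl (const_mem_fibrePairs hF a))

theorem diff_self (hF : IsSimpleFibration q ι x₀) (u : C(Fin (n + 1) → I, E)) :
    hF.diff u u = 1 := by
  have := hF.pathConnected
  refine (hF.diff_congr (u' := ContinuousMap.const _ (ι x₀))
    (v' := ContinuousMap.const _ (ι x₀)) ?_).trans (hF.diff_const GenLoop.const)
  obtain ⟨γ⟩ := joined_const u (ι x₀)
  exact ⟨γ.prod γ, fun t => fibrePairs_refl _⟩

theorem spheroids_mem_fibrePairs (hF : IsSimpleFibration q ι x₀)
    (a a' : GenLoop (Fin (n + 1)) A x₀) :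
    (ι.comp a.1, ι.comp a'.1) ∈ fibrePairs q (n + 1) :=
  fibrePairs_trans (fibrePairs_symm (const_mem_fibrePairs hF a)) (const_mem_fibrePairs hF a')

theorem diff_spheroids_congr (hF : IsSimpleFibration q ι x₀)
    {a a' c c' : GenLoop (Fin (n + 1)) A x₀}
    (h : spheroidClass a = spheroidClass c) (h' : spheroidClass a' = spheroidClass c') :
    hF.diff (ι.comp a.1) (ι.comp a'.1) = hF.diff (ι.comp c.1) (ι.comp c'.1) := by
  rw [hF.diff_congr (genLoop_homotopic_joinedIn hF (spheroidClass_eq_iff.1 h') _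
    (hF.spheroids_mem_fibrePairs a a'))]
  exact hF.diff_congr (genLoop_homotopic_joinedIn hF (spheroidClass_eq_iff.1 h) _
    (hF.spheroids_mem_fibrePairs c' a)).fibrePairs_swap

/-- Reparametrizing the first coordinate of two spheroids by a homotopy `c` does not change their
difference class, provided that the spheroids agree along the motion of the end faces. -/
theorem diff_reparametrize (hF : IsSimpleFibration q ι x₀) (a a' : GenLoop (Fin (n + 1)) A x₀)
    (c : C(I × I, I))
    (hc : ∀ x, c (0, x) = x)
    (h0 : ∀ t s, a (Function.update s 0 (c (t, 0))) = a' (Function.update s 0 (c (t, 0))))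
    (h1 : ∀ t s, a (Function.update s 0 (c (t, 1))) = a' (Function.update s 0 (c (t, 1))))
    (d : GenLoop (Fin (n + 1)) A x₀)
    (hd : ∀ s, a (Function.update s 0 (c (1, s 0))) = x₀)
    (hd' : ∀ s, a' (Function.update s 0 (c (1, s 0))) = d s) :
    hF.diff (ι.comp a.1) (ι.comp a'.1) = spheroidClass d := by
  refine hF.diff_eq (joinedIn_fibrePairs_iff.2 ?_)
  let C : C(I × (Fin (n + 1) → I), Fin (n + 1) → I) :=
    ⟨fun x => Function.update x.2 0 (c (x.1, x.2 0)), by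
      exact continuous_snd.update 0 (by fun_prop)⟩
  have hC : ∀ s, C (0, s) = s := fun s => by simp [C, hc]
  refine ⟨ι.comp (a.1.comp C), ι.comp (a'.1.comp C), fun s => ?_, fun s => ?_, fun s => ?_,
    fun s => ?_, fun x => ?_, ?_⟩
  · simp only [ContinuousMap.comp_apply, hC]
  · exact congrArg ι (hd s)
  · simp only [ContinuousMap.comp_apply, hC]
  · exact congrArg ι (hd' s)
  · exact (hF.proj _).trans (hF.proj _).symm
  · rintro t s ⟨j, hs⟩
    refine congrArg ι ?_
    change a (Function.update s 0 (c (t, s 0))) = a' (Function.update s 0 (c (t, s 0)))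
    by_cases hj : j = 0
    · subst hj
      rcases hs with hs | hs <;> rw [hs]
      · exact h0 t s
      · exact h1 t s
    · have hb : Function.update s 0 (c (t, s 0)) ∈ Cube.boundary (Fin (n + 1)) :=
        ⟨j, by simpa [Function.update_of_ne hj] using hs⟩
      rw [GenLoop.boundary a _ hb, GenLoop.boundary a' _ hb]

/-- The difference of `a` and `a * x` is `x`. In Mathlib's convention the class `[a] * [x]` is
represented by `x` on the first half of the cube, followed by `a`; the cube is squeezed to the first
half, where the concatenation of the constant loop and `a` is constant. -/
theorem diff_mul_right (hF : IsSimpleFibration q ι x₀) (a a' : GenLoop (Fin (n + 1)) A x₀)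
    (x : HomotopyGroup (Fin (n + 1)) A x₀) (h : spheroidClass a' = spheroidClass a * x) :
    hF.diff (ι.comp a.1) (ι.comp a'.1) = x := by
  obtain ⟨d, rfl⟩ := spheroidClass_surjective x
  have e1 : spheroidClass a = spheroidClass (GenLoop.transAt 0 GenLoop.const a) := by
    have : spheroidClass a = spheroidClass a * spheroidClass GenLoop.const :=
      (mul_one (spheroidClass a)).symm
    rw [this]; exact HomotopyGroup.mul_spec
  have e2 : spheroidClass a' = spheroidClass (GenLoop.transAt 0 d a) := by
    rw [h]; exact HomotopyGroup.mul_spec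
  rw [hF.diff_spheroids_congr e1 e2]
  refine hF.diff_reparametrize _ _ ⟨fun x => ⟨(1 - x.1 / 2) * x.2, ?_, ?_⟩, by fun_prop⟩ ?_ ?_ ?_ d
    ?_ ?_
  · have := x.1.2.1; have := x.1.2.2; have := x.2.2.1
    exact mul_nonneg (by linarith) this
  · have := x.1.2.1; have := x.1.2.2; have := x.2.2.1; have := x.2.2.2
    nlinarith
  · intro x; simp
  · intro t s
    refine (GenLoop.boundary _ _ ⟨0, Or.inl ?_⟩).trans
      (GenLoop.boundary _ _ ⟨0, Or.inl ?_⟩).symm <;>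
    · ext; simp
  · intro t s
    simp only [GenLoop.transAt, GenLoop.coe_copy, Function.update_self, ContinuousMap.coe_mk]
    split_ifs with h1
    · have ht := t.2.2
      have : (t : ℝ) = 1 := by simp at h1; linarith
      refine (GenLoop.boundary _ _ ⟨0, Or.inr ?_⟩).trans
        (GenLoop.boundary _ _ ⟨0, Or.inr ?_⟩).symm <;>
      · ext; norm_num [this]
    · rfl
  · intro s
    simp only [GenLoop.transAt, GenLoop.coe_copy, Function.update_self, ContinuousMap.coe_mk]
    have h2 := (s 0).2.2
    rw [if_pos (by simp; linarith)]
    rfl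
  · intro s
    simp only [GenLoop.transAt, GenLoop.coe_copy, Function.update_self, ContinuousMap.coe_mk]
    have h2 := (s 0).2.2
    rw [if_pos (by simp; linarith)]
    congr 1
    ext j
    refine Fin.cases ?_ (fun j => ?_) j
    · have h3 := (s 0).2.1
      have e : (2 : ℝ) * ((1 - ((1 : I) : ℝ) / 2) * (s 0 : ℝ)) = s 0 := by simp; ring
      simp only [Function.update_self, e, Set.coe_projIcc]
      rw [min_eq_right h2, max_eq_right h3]
    · simp

/-- The difference of `a` and `x * a` is `x`, by squeezing the cube to its second half. Together
with `diff_mul_right` this shows that the group is commutative. -/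
theorem diff_mul_left (hF : IsSimpleFibration q ι x₀) (a a' : GenLoop (Fin (n + 1)) A x₀)
    (x : HomotopyGroup (Fin (n + 1)) A x₀) (h : spheroidClass a' = x * spheroidClass a) :
    hF.diff (ι.comp a.1) (ι.comp a'.1) = x := by
  obtain ⟨d, rfl⟩ := spheroidClass_surjective x
  have e1 : spheroidClass a = spheroidClass (GenLoop.transAt 0 a GenLoop.const) := by
    have : spheroidClass a = spheroidClass GenLoop.const * spheroidClass a :=
      (one_mul (spheroidClass a)).symm
    rw [this]; exact HomotopyGroup.mul_spec
  have e2 : spheroidClass a' = spheroidClass (GenLoop.transAt 0 a d) := by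
    rw [h]; exact HomotopyGroup.mul_spec
  rw [hF.diff_spheroids_congr e1 e2]
  refine hF.diff_reparametrize _ _ ⟨fun x => ⟨x.1 / 2 + (1 - x.1 / 2) * x.2, ?_, ?_⟩, by fun_prop⟩
    ?_ ?_ ?_ d ?_ ?_
  · have := x.1.2.1; have := x.1.2.2; have := x.2.2.1
    have := mul_nonneg (show (0 : ℝ) ≤ 1 - x.1 / 2 by linarith) this
    linarith
  · have := x.1.2.1; have := x.1.2.2; have := x.2.2.1; have := x.2.2.2
    nlinarith
  · intro x; simp
  · intro t s
    simp only [GenLoop.transAt, GenLoop.coe_copy, Function.update_self, ContinuousMap.coe_mk]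
    have ht := t.2.2
    rw [if_pos (by simp; linarith), if_pos (by simp; linarith)]
  · intro t s
    refine (GenLoop.boundary _ _ ⟨0, Or.inr ?_⟩).trans
      (GenLoop.boundary _ _ ⟨0, Or.inr ?_⟩).symm <;>
    · ext; simp
  · intro s
    simp only [GenLoop.transAt, GenLoop.coe_copy, Function.update_self, ContinuousMap.coe_mk]
    have h2 := (s 0).2.1
    split_ifs with h1
    · simp at h1
      refine GenLoop.boundary _ _ ⟨0, Or.inr ?_⟩
      have h3 : (s 0 : ℝ) = 0 := by linarith
      ext; simp [h3]
    · rfl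
  · intro s
    simp only [GenLoop.transAt, GenLoop.coe_copy, Function.update_self, ContinuousMap.coe_mk]
    have h2 := (s 0).2.1
    have h4 := (s 0).2.2
    split_ifs with h1
    · simp at h1
      have h3 : (s 0 : ℝ) = 0 := by linarith
      refine (GenLoop.boundary _ _ ⟨0, Or.inr ?_⟩).trans (GenLoop.boundary _ _ ⟨0, Or.inl ?_⟩).symm
      · ext; simp [h3]
      · ext; simp [h3]
    · congr 1
      ext j
      refine Fin.cases ?_ (fun j => ?_) j
      · have e : (2 : ℝ) * (((1 : I) : ℝ) / 2 + (1 - ((1 : I) : ℝ) / 2) * (s 0 : ℝ)) - 1 = s 0 := by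
          simp; ring
        simp only [Function.update_self, e, Set.coe_projIcc]
        rw [min_eq_right h4, max_eq_right h2]
      · simp

/-- The homotopy groups of a simple space are commutative; here this results from comparing the
concatenation of spheroids in the two possible orders. -/
theorem mul_comm (hF : IsSimpleFibration q ι x₀) (x y : HomotopyGroup (Fin (n + 1)) A x₀) :
    x * y = y * x := by
  obtain ⟨a, rfl⟩ := spheroidClass_surjective x
  obtain ⟨a', ha'⟩ := spheroidClass_surjective (spheroidClass a * y)
  have h1 := hF.diff_mul_right a a' y ha'
  have h2 := hF.diff_mul_left a a' (spheroidClass a * y * (spheroidClass a)⁻¹) (by rw [ha']; group)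
  rw [h1] at h2
  nth_rewrite 2 [h2]
  group

/-- The homotopy groups of the fibre, as commutative groups. -/
abbrev commGroup (hF : IsSimpleFibration q ι x₀) (n : ℕ) :
    CommGroup (HomotopyGroup (Fin (n + 1)) A x₀) where
  mul_comm := hF.mul_comm

/-- Difference classes are additive. The third cube is carried along while the first two are moved
to spheroids in the fibre, and `diff_mul_right` evaluates the difference of the resulting spheroids.
-/
theorem diff_mul_diff (hF : IsSimpleFibration q ι x₀) {u v w : C(Fin (n + 1) → I, E)}
    (huv : (u, v) ∈ fibrePairs q (n + 1)) (hvw : (v, w) ∈ fibrePairs q (n + 1)) :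
    hF.diff u v * hF.diff v w = hF.diff u w := by
  obtain ⟨a, γ, hγ⟩ := hF.exists_spheroid huv
  obtain ⟨w', γ', hγ'⟩ := exists_path_fibrePairs hF.lift (γ.map continuous_snd) hvw
  have huw : JoinedIn (fibrePairs q (n + 1)) (u, w) (ContinuousMap.const _ (ι x₀), w') :=
    ⟨(γ.map continuous_fst).prod γ', fun t => fibrePairs_trans (hγ t) (hγ' t)⟩
  have hvw' : JoinedIn (fibrePairs q (n + 1)) (v, w) (ι.comp a.1, w') :=
    ⟨(γ.map continuous_snd).prod γ', hγ'⟩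
  obtain ⟨a', rfl⟩ := exists_genLoop hF huw.mem.2
  rw [hF.diff_eq ⟨γ, hγ⟩, hF.diff_congr hvw', hF.diff_eq huw,
    hF.diff_mul_right a a' ((spheroidClass a)⁻¹ * spheroidClass a') (by group)]
  group

/-- Every element of the homotopy group is the difference class of a given cube and another one. -/
theorem exists_diff_eq (hF : IsSimpleFibration q ι x₀) (u : C(Fin (n + 1) → I, E))
    (x : HomotopyGroup (Fin (n + 1)) A x₀) :
    ∃ v, (u, v) ∈ fibrePairs q (n + 1) ∧ hF.diff u v = x := by
  have := hF.pathConnected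
  obtain ⟨a, rfl⟩ := spheroidClass_surjective x
  obtain ⟨v, hv⟩ := exists_joinedIn_fibrePairs hF.lift (joined_const u (ι x₀)).symm
    (const_mem_fibrePairs hF a)
  exact ⟨v, hv.mem.2, hF.diff_eq hv.symm⟩

/-- Cubes whose difference class is trivial are homotopic relative to the boundary over `B`. -/
theorem diff_eq_one_iff (hF : IsSimpleFibration q ι x₀) {u v : C(Fin (n + 1) → I, E)}
    (huv : (u, v) ∈ fibrePairs q (n + 1)) :
    hF.diff u v = 1 ↔ JoinedIn {v | (u, v) ∈ fibrePairs q (n + 1)} u v := by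
  constructor
  · intro h1
    obtain ⟨a, ha⟩ := hF.exists_spheroid huv
    rw [hF.diff_eq ha] at h1
    have h2 := genLoop_homotopic_joinedIn hF (spheroidClass_eq_iff.1 (h1.trans
      (show 1 = spheroidClass GenLoop.const from rfl))) _ (const_mem_fibrePairs hF a)
    obtain ⟨H, K, h0, h1, k0, k1, hq, hb⟩ := joinedIn_fibrePairs_iff.1 (ha.trans h2).symm
    -- Fill the cube with faces `H`, `K` and a constant homotopy over the end of the homotopy.
    let H' : C(I × (Fin (n + 2) → I), E) :=
      H.comp ⟨fun x => (x.1, fun k => x.2 k.succ), by fun_prop⟩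
    let K' : C(I × (Fin (n + 2) → I), E) :=
      K.comp ⟨fun x => (x.1, fun k => x.2 k.succ), by fun_prop⟩
    let hh : Fin (n + 2) → Bool → I × (Fin (n + 2) → I) → E := fun j δ x =>
      Fin.cases (motive := fun _ => E) (if δ then K' x else H' x) (fun _ => H' x) j
    have hlat : ∀ (s : Fin (n + 2) → I) δ δ' (j : Fin (n + 1)) τ,
        s j.succ = bit δ' → hh 0 δ (τ, s) = H' (τ, s) := by
      intro s δ δ' j τ hs'
      cases δ
      · rfl
      · exact (hb _ _ (mem_boundary_iff.2 ⟨j, δ', hs'⟩)).symm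
    obtain ⟨L, hL, hL0, hLb⟩ := homotopy_horn hF.lift (q.comp H')
      (ContinuousMap.const _ (ι x₀)) hh
      (fun s => by simp [H', h0])
      (fun j δ => by
        induction j using Fin.cases with
        | zero =>
          refine Continuous.continuousOn ?_
          cases δ
          · exact H'.continuous
          · exact K'.continuous
        | succ j => exact H'.continuous.continuousOn)
      (fun j δ t s hs => by
        induction j using Fin.cases with
        | zero =>
          cases δ
          · rfl
          · exact (hq _).symm
        | succ j => rfl)
      (fun j δ s hs => by
        induction j using Fin.cases with
        | zero =>
          cases δ
          · exact h0 _
          · exact k0 _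
        | succ j => exact h0 _)
      (fun j δ k δ' t s hs hs' => by
        induction j using Fin.cases with
        | zero =>
          induction k using Fin.cases with
          | zero => rw [bit_injective (hs.symm.trans hs')]
          | succ k => exact hlat s δ δ' k t hs'
        | succ j =>
          induction k using Fin.cases with
          | zero => exact (hlat s δ' δ j t hs).symm
          | succ k => rfl)
    have hcons : Continuous fun x : I × (Fin (n + 1) → I) =>
        (Fin.cons x.1 x.2 : Fin (n + 2) → I) := by
      refine continuous_pi fun j => ?_
      induction j using Fin.cases with
      | zero => simpa using continuous_fst
      | succ j =>
        simp only [Fin.cons_succ]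
        exact (continuous_apply j).comp continuous_snd
    let R : C(I × (Fin (n + 1) → I), E) := L.comp ⟨fun x => (1, Fin.cons x.1 x.2), by fun_prop⟩
    refine ⟨⟨⟨fun t => R.curry t, by fun_prop⟩, ContinuousMap.ext fun s => ?_,
      ContinuousMap.ext fun s => ?_⟩, fun t => ⟨fun s => ?_, fun s hs => ?_⟩⟩
    · exact (hLb 0 false 1 (Fin.cons 0 s) rfl).trans (h1 s)
    · exact (hLb 0 true 1 (Fin.cons 1 s) rfl).trans (k1 s)
    · exact ((hL (1, Fin.cons t s)).trans (congrArg q (h1 s))).symm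
    · obtain ⟨j, δ, hs⟩ := mem_boundary_iff.1 hs
      exact ((hLb j.succ δ 1 (Fin.cons t s) (by simpa using hs)).trans (h1 s)).symm
  · rintro ⟨γ, hγ⟩
    rw [← hF.diff_self u]
    exact (hF.diff_congr ⟨(Path.refl u).prod γ, hγ⟩).symm

end IsSimpleFibration
end DifferenceClass

/-! ### Alternating products over the faces of a cube -/

section Alternating

variable {G : Type*} [CommGroup G]

/-- The alternating product over the faces of an `m`-cube: the face `w j = 1` is counted with the
sign `(-1) ^ j`, the face `w j = 0` with the opposite sign. -/
def faceProd {m : ℕ} (X : Fin m → Bool → G) : G :=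
  ∏ j, (X j true * (X j false)⁻¹) ^ ((-1 : ℤ) ^ (j : ℕ))

theorem faceProd_mul {m : ℕ} (X X' : Fin m → Bool → G) :
    faceProd (fun j δ => X j δ * X' j δ) = faceProd X * faceProd X' := by
  simp only [faceProd, ← Finset.prod_mul_distrib, ← mul_zpow]
  refine Finset.prod_congr rfl fun j _ => ?_
  congr 1
  rw [mul_inv, mul_mul_mul_comm]

/-- Opposite faces are counted with opposite signs. -/
theorem faceProd_eq_one_of_opposite {m : ℕ} (X : Fin m → Bool → G) (i : Fin m)
    (h : ∀ j δ, j ≠ i → X j δ = 1) (hi : X i true = X i false) : faceProd X = 1 := by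
  refine Finset.prod_eq_one fun j _ => ?_
  by_cases hj : j = i
  · subst hj; simp [hi]
  · simp [h j _ hj]

/-- Adjacent faces through the vertex `0` are counted with opposite signs. -/
theorem faceProd_eq_one_of_adjacent {m : ℕ} (X : Fin (m + 1) → Bool → G) (i : Fin m)
    (h : ∀ j δ, (j, δ) ≠ (i.castSucc, false) → (j, δ) ≠ (i.succ, false) → X j δ = 1)
    (hi : X i.castSucc false = X i.succ false) : faceProd X = 1 := by
  have hne : i.castSucc ≠ i.succ := (Fin.castSucc_lt_succ).ne
  rw [faceProd, Finset.prod_eq_mul i.castSucc i.succ hne]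
  · rw [h _ true (by simp) (by simp), h _ true (by simp) (by simp), hi]
    simp only [one_mul, Fin.val_castSucc, Fin.val_succ, pow_succ, mul_neg, mul_one, zpow_neg]
    exact mul_inv_cancel _
  · rintro j - ⟨h1, h2⟩
    rw [h _ _ (by simp) (by simp), h _ _ (by simp [h1]) (by simp [h2])]; simp
  · simp
  · simp

/-- The double alternating product over the faces of codimension two is trivial, since each of them
is contained in two faces of codimension one, with opposite signs. -/
theorem faceProd_faceProd {m : ℕ} (X : Fin (m + 2) → Bool → Fin (m + 1) → Bool → G)
    (h : ∀ i ε j δ, X (i.succAbove j) δ (j.predAbove i) ε = X i ε j δ) :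
    faceProd (fun i ε => faceProd (X i ε)) = 1 := by
  let b : Fin (m + 2) × Fin (m + 1) → G := fun x =>
    X x.1 true x.2 true * (X x.1 true x.2 false)⁻¹ *
      (X x.1 false x.2 true * (X x.1 false x.2 false)⁻¹)⁻¹
  have hb : faceProd (fun i ε => faceProd (X i ε)) =
      ∏ x : Fin (m + 2) × Fin (m + 1), b x ^ ((-1 : ℤ) ^ (x.1 + x.2 : ℕ)) := by
    rw [Fintype.prod_prod_type]
    refine Finset.prod_congr rfl fun i _ => ?_
    simp only [faceProd, ← Finset.prod_inv_distrib, ← Finset.prod_mul_distrib,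
      ← Finset.prod_zpow]
    refine Finset.prod_congr rfl fun j _ => ?_
    rw [pow_add, mul_comm ((-1 : ℤ) ^ (i : ℕ)), zpow_mul, ← inv_zpow, ← mul_zpow]
  rw [hb]
  refine Finset.prod_ninvolution (fun x => (x.1.succAbove x.2, x.2.predAbove x.1)) ?_ ?_
    (fun _ => Finset.mem_univ _) ?_
  · rintro ⟨i, j⟩
    have h1 : b (i.succAbove j, j.predAbove i) = b (i, j) := by
      simp only [b, h]
      simp only [mul_inv, inv_inv, mul_assoc]
      congr 1
      rw [mul_left_comm]
    simp only [h1, Fin.neg_one_pow_succAbove_add_predAbove]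
    rw [zpow_neg, mul_inv_cancel]
  · rintro ⟨i, j⟩ - h1
    exact Fin.succAbove_ne i j (congrArg Prod.fst h1)
  · rintro ⟨i, j⟩
    simp only [Fin.succAbove_succAbove_predAbove, Fin.predAbove_predAbove_succAbove]

end Alternating

/-! ### Faces of cubes -/

section Faces

/-- The inclusion of the face `w j = bit δ` of a cube. -/
def faceMap {m : ℕ} (j : Fin (m + 1)) (δ : Bool) : C(Fin m → I, Fin (m + 1) → I) where
  toFun s := j.insertNth (bit δ) s
  continuous_toFun := Continuous.finInsertNth j continuous_const continuous_id

@[simp] theorem faceMap_same {m : ℕ} (j : Fin (m + 1)) (δ : Bool) (s : Fin m → I) :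
    faceMap j δ s j = bit δ := Fin.insertNth_apply_same (α := fun _ => I) _ _ _

@[simp] theorem faceMap_succAbove {m : ℕ} (j : Fin (m + 1)) (δ : Bool) (s : Fin m → I)
    (k : Fin m) : faceMap j δ s (j.succAbove k) = s k :=
  Fin.insertNth_apply_succAbove (α := fun _ => I) _ _ _ _

theorem faceMap_removeNth {m : ℕ} {j : Fin (m + 1)} {δ : Bool} {w : Fin (m + 1) → I}
    (h : w j = bit δ) : faceMap j δ (j.removeNth w) = w := by
  change j.insertNth (bit δ) _ = w
  rw [← h]; exact Fin.insertNth_self_removeNth _ _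

theorem removeNth_faceMap {m : ℕ} (j : Fin (m + 1)) (δ : Bool) (s : Fin m → I) :
    j.removeNth (faceMap j δ s) = s := by
  funext k; exact faceMap_succAbove j δ s k

/-- The two ways of reaching a face of codimension two. -/
theorem faceMap_faceMap {m : ℕ} (i : Fin (m + 2)) (ε : Bool) (j : Fin (m + 1)) (δ : Bool)
    (s : Fin m → I) :
    faceMap (i.succAbove j) δ (faceMap (j.predAbove i) ε s) = faceMap i ε (faceMap j δ s) := by
  have h : ∀ k, k = i ∨ ∃ k', k = i.succAbove k' := fun k => by
    by_cases hk : k = i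
    · exact Or.inl hk
    · obtain ⟨k', hk'⟩ := Fin.exists_succAbove_eq hk
      exact Or.inr ⟨k', hk'.symm⟩
  funext k
  rcases h k with rfl | ⟨k', rfl⟩
  · rw [faceMap_same]
    have := faceMap_succAbove (k.succAbove j) δ (faceMap (j.predAbove k) ε s) (j.predAbove k)
    rw [Fin.succAbove_succAbove_predAbove] at this
    rw [this, faceMap_same]
  · rw [faceMap_succAbove]
    by_cases hk : k' = j
    · subst hk; simp
    · obtain ⟨l, rfl⟩ := Fin.exists_succAbove_eq hk
      rw [faceMap_succAbove, ← Fin.succAbove_succAbove_succAbove_predAbove, faceMap_succAbove,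
        faceMap_succAbove]

variable {E B A : Type*} [TopologicalSpace E] [TopologicalSpace B] [TopologicalSpace A]

/-- The points of a cube that lie on at least two different pairs of opposite faces. -/
def codimTwo (m : ℕ) : Set (Fin m → I) :=
  {w | ∃ j k δ δ', j ≠ k ∧ w j = bit δ ∧ w k = bit δ'}

theorem faceMap_mem_codimTwo {m : ℕ} {j : Fin (m + 1)} {δ : Bool} {s : Fin m → I}
    (hs : s ∈ Cube.boundary (Fin m)) : faceMap j δ s ∈ codimTwo (m + 1) := by
  obtain ⟨k, δ', h⟩ := mem_boundary_iff.1 hs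
  exact ⟨j, j.succAbove k, δ, δ', (Fin.succAbove_ne j k).symm, by simp, by simp [h]⟩

theorem removeNth_mem_boundary {m : ℕ} {j k : Fin (m + 1)} {δ' : Bool} {w : Fin (m + 1) → I}
    (hjk : j ≠ k) (hk : w k = bit δ') : j.removeNth w ∈ Cube.boundary (Fin m) := by
  obtain ⟨l, rfl⟩ := Fin.exists_succAbove_eq hjk.symm
  exact mem_boundary_iff.2 ⟨l, δ', hk⟩

end Faces

/-! ### Difference classes of the faces of cubes -/

section Obstruction

variable {E B A : Type*} [TopologicalSpace E] [TopologicalSpace B] [TopologicalSpace A]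
  {q : C(E, B)} {ι : C(A, E)} {x₀ : A}

/-- The faces of a cube. -/
def cubeFaces {m : ℕ} (e : C(Fin (m + 1) → I, E)) : Fin (m + 1) → Bool → C(Fin m → I, E) :=
  fun j δ => e.comp (faceMap j δ)

theorem cubeFaces_mem {m : ℕ} {e e' : C(Fin (m + 1) → I, E)} (hq : ∀ w, q (e w) = q (e' w))
    (h : Set.EqOn e e' (codimTwo (m + 1))) (j : Fin (m + 1)) (δ : Bool) :
    (cubeFaces e j δ, cubeFaces e' j δ) ∈ fibrePairs q m :=
  ⟨fun _ => hq _, fun _ hs => h (faceMap_mem_codimTwo hs)⟩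

/-- A family of lifts, along `q`, of the restrictions of a map `b` on a cube to the faces of the
cube, subject to the obvious compatibilities. -/
structure IsShell {m : ℕ} (q : C(E, B)) (b : C(Fin (m + 1) → I, B))
    (f : Fin (m + 1) → Bool → C(Fin m → I, E)) : Prop where
  proj : ∀ j δ s, q (f j δ s) = b (faceMap j δ s)
  compat : ∀ j δ k δ' s s', faceMap j δ s = faceMap k δ' s' → f j δ s = f k δ' s'

/-- A shell bounds a lift up to one face; on that face, the lift and the shell agree on the
boundary. -/
theorem IsShell.exists_filling {m : ℕ} (hq : ∀ n, HasHomotopyLifting q (Fin n → I))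
    {b : C(Fin (m + 1) → I, B)} {f : Fin (m + 1) → Bool → C(Fin m → I, E)} (hf : IsShell q b f)
    (i : Fin (m + 1)) (ε : Bool) :
    ∃ e : C(Fin (m + 1) → I, E), (∀ w, q (e w) = b w) ∧
      (∀ j δ, (j, δ) ≠ (i, ε) → cubeFaces e j δ = f j δ) ∧
      ∀ j δ, (cubeFaces e j δ, f j δ) ∈ fibrePairs q m := by
  obtain ⟨e, he, he'⟩ := horn_filling hq i ε b (fun j δ w => f j δ (j.removeNth w))
    (fun j δ _ => by
      refine Continuous.continuousOn ?_
      unfold Fin.removeNth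
      fun_prop)
    (fun j δ _ w hw => by rw [hf.proj, faceMap_removeNth hw])
    (fun j δ k δ' _ _ w hw hw' => hf.compat _ _ _ _ _ _ (by
      rw [faceMap_removeNth hw, faceMap_removeNth hw']))
  have h1 : ∀ j δ, (j, δ) ≠ (i, ε) → cubeFaces e j δ = f j δ := fun j δ hj => by
    ext s
    simp only [cubeFaces, ContinuousMap.comp_apply]
    rw [he' j δ hj _ (faceMap_same _ _ _), removeNth_faceMap]
  refine ⟨e, he, h1, fun j δ => ⟨fun s => ?_, fun s hs => ?_⟩⟩
  · simp [cubeFaces, he, hf.proj]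
  · by_cases hj : (j, δ) = (i, ε)
    · obtain ⟨k, δ', hk⟩ := mem_boundary_iff.1 hs
      have hk' : faceMap j δ s (j.succAbove k) = bit δ' := by simp [hk]
      have hne : (j.succAbove k, δ') ≠ (i, ε) := by
        intro h; rw [← hj] at h; exact Fin.succAbove_ne j k (congrArg Prod.fst h)
      simp only [cubeFaces, ContinuousMap.comp_apply]
      rw [he' _ _ hne _ hk']
      exact hf.compat _ _ _ _ _ _ (faceMap_removeNth hk')
    · rw [h1 j δ hj]

namespace IsSimpleFibration

variable {n : ℕ}

/-- The alternating product of the difference classes of two families of cubes. -/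
def faceDiff (hF : IsSimpleFibration q ι x₀) {m : ℕ} (f g : Fin m → Bool → C(Fin (n + 1) → I, E)) :
    HomotopyGroup (Fin (n + 1)) A x₀ :=
  letI := hF.commGroup n
  faceProd fun j δ => hF.diff (f j δ) (g j δ)

theorem faceDiff_mul (hF : IsSimpleFibration q ι x₀) {m : ℕ}
    {f g h : Fin m → Bool → C(Fin (n + 1) → I, E)}
    (hfg : ∀ j δ, (f j δ, g j δ) ∈ fibrePairs q (n + 1))
    (hgh : ∀ j δ, (g j δ, h j δ) ∈ fibrePairs q (n + 1)) :
    hF.faceDiff f g * hF.faceDiff g h = hF.faceDiff f h := by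
  let := hF.commGroup n
  refine (faceProd_mul _ _).symm.trans ?_
  unfold faceDiff
  congr 1
  funext j δ
  exact hF.diff_mul_diff (hfg j δ) (hgh j δ)

theorem faceDiff_self (hF : IsSimpleFibration q ι x₀) {m : ℕ}
    (f : Fin m → Bool → C(Fin (n + 1) → I, E)) : hF.faceDiff f f = 1 := by
  let := hF.commGroup n
  simp [faceDiff, faceProd, hF.diff_self]

/-- Two cubes that differ in two opposite faces only: sliding from one face to the other shows that
the difference classes of these faces agree. -/
theorem faceDiff_eq_one_of_opposite (hF : IsSimpleFibration q ι x₀)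
    {e e' : C(Fin (n + 2) → I, E)} (hq : ∀ w, q (e w) = q (e' w)) (i : Fin (n + 2))
    (h : ∀ j δ, j ≠ i → ∀ w : Fin (n + 2) → I, w j = bit δ → e w = e' w) :
    hF.faceDiff (cubeFaces e) (cubeFaces e') = 1 := by
  let := hF.commGroup n
  refine faceProd_eq_one_of_opposite _ i (fun j δ hj => ?_) ?_
  · have : cubeFaces e j δ = cubeFaces e' j δ := by
      ext s; exact h j δ hj _ (faceMap_same _ _ _)
    rw [this]; exact hF.diff_self _
  · refine hF.diff_congr (JoinedIn.symm (joinedIn_fibrePairs_iff.2 ?_))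
    let S : C(I × (Fin (n + 1) → I), Fin (n + 2) → I) :=
      ⟨fun x => i.insertNth x.1 x.2, Continuous.finInsertNth i continuous_fst continuous_snd⟩
    refine ⟨e.comp S, e'.comp S, fun s => rfl, fun s => rfl, fun s => rfl, fun s => rfl,
      fun x => hq _, fun t s hs => ?_⟩
    obtain ⟨k, δ, hk⟩ := mem_boundary_iff.1 hs
    refine h (i.succAbove k) δ (Fin.succAbove_ne i k) _ ?_
    exact (Fin.insertNth_apply_succAbove (α := fun _ => I) _ _ _ _).trans hk

/-- Two cubes that differ in the two faces `w i = 0` and `w (i + 1) = 0` only: rotating one face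
into the other shows that their difference classes agree. -/
theorem faceDiff_eq_one_of_adjacent (hF : IsSimpleFibration q ι x₀)
    {e e' : C(Fin (n + 2) → I, E)} (hq : ∀ w, q (e w) = q (e' w)) (i : Fin (n + 1))
    (h2 : Set.EqOn e e' (codimTwo (n + 2)))
    (h : ∀ j δ, (j, δ) ≠ (i.castSucc, false) → (j, δ) ≠ (i.succ, false) →
      ∀ w : Fin (n + 2) → I, w j = bit δ → e w = e' w) :
    hF.faceDiff (cubeFaces e) (cubeFaces e') = 1 := by
  let := hF.commGroup n
  refine faceProd_eq_one_of_adjacent _ i (fun j δ hj hj' => ?_) ?_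
  · have : cubeFaces e j δ = cubeFaces e' j δ := by
      ext s; exact h j δ hj hj' _ (faceMap_same _ _ _)
    rw [this]; exact hF.diff_self _
  · -- The coordinate `s i` is split into the two coordinates `s i * min 1 (2 t)` and
    -- `s i * min 1 (2 - 2 t)`, at least one of which is equal to `s i`.
    let c : I → I := fun t => Set.projIcc 0 1 zero_le_one (2 * t)
    have hc : Continuous c := continuous_projIcc.comp (by fun_prop)
    let S : C(I × (Fin (n + 1) → I), Fin (n + 2) → I) :=
      ⟨fun x => i.castSucc.insertNth (x.2 i * c x.1)
        (Function.update x.2 i (x.2 i * c (σ x.1))), by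
        refine Continuous.finInsertNth (A := fun _ => I) i.castSucc ?_ ?_
        · exact (show Continuous fun x : I × (Fin (n + 1) → I) => x.2 i * c x.1 by fun_prop)
        · exact continuous_snd.update i (by fun_prop)⟩
    have hS1 : ∀ t s, S (t, s) i.castSucc = s i * c t := fun t s =>
      Fin.insertNth_apply_same (α := fun _ => I) _ _ _
    have hS2 : ∀ t s k, S (t, s) (i.castSucc.succAbove k) =
        (Function.update s i (s i * c (σ t)) : Fin (n + 1) → I) k := fun t s k =>
      Fin.insertNth_apply_succAbove (α := fun _ => I) _ _ _ _
    have hsucc : i.castSucc.succAbove i = i.succ := Fin.succAbove_castSucc_self i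
    have hS3 : ∀ t s, S (t, s) i.succ = s i * c (σ t) := fun t s => by
      rw [← hsucc, hS2, Function.update_self]
    have c0 : c 0 = 0 := by ext; simp [c]
    have c1 : c 1 = 1 := by ext; simp [c, Set.coe_projIcc]
    have hS0 : ∀ s, S (0, s) = faceMap i.castSucc false s := fun s => by
      funext k
      by_cases hk : k = i.castSucc
      · subst hk; rw [hS1]; simp [c0]
      · obtain ⟨l, rfl⟩ := Fin.exists_succAbove_eq hk
        rw [hS2, faceMap_succAbove]; simp [c1]
    have hS4 : ∀ s, S (1, s) = faceMap i.succ false s := fun s => by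
      funext k
      by_cases hk : k = i.castSucc
      · subst hk
        rw [hS1]
        have : i.castSucc = i.succ.succAbove i := (Fin.succAbove_succ_self i).symm
        rw [this, faceMap_succAbove]; simp [c1]
      · obtain ⟨l, rfl⟩ := Fin.exists_succAbove_eq hk
        rw [hS2]
        by_cases hl : l = i
        · subst hl; rw [hsucc]; simp [c0]
        · have : i.castSucc.succAbove l = i.succ.succAbove l := by
            rcases lt_or_gt_of_ne hl with h | h
            · rw [Fin.succAbove_castSucc_of_lt _ _ h, Fin.succAbove_succ_of_le _ _ h.le]
            · rw [Fin.succAbove_castSucc_of_le _ _ h.le, Fin.succAbove_succ_of_lt _ _ h]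
          rw [this, faceMap_succAbove]; simp [Function.update_of_ne hl]
    have hmax : ∀ t, c t = 1 ∨ c (σ t) = 1 := fun t => by
      rcases le_total (1 / 2 : ℝ) t with ht | ht
      · left; exact Set.projIcc_of_right_le _ (by linarith)
      · right; exact Set.projIcc_of_right_le _ (by simp; linarith)
    refine hF.diff_congr (joinedIn_fibrePairs_iff.2 ⟨e.comp S, e'.comp S, fun s => ?_, fun s => ?_,
      fun s => ?_, fun s => ?_, fun x => hq _, fun t s hs => ?_⟩)
    · simp [hS0, cubeFaces]
    · simp [hS4, cubeFaces]
    · simp [hS0, cubeFaces]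
    · simp [hS4, cubeFaces]
    · obtain ⟨k, δ, hk⟩ := mem_boundary_iff.1 hs
      simp only [ContinuousMap.comp_apply]
      by_cases hki : k = i
      · subst hki
        cases δ
        · refine h2 ⟨k.castSucc, k.succ, false, false, (Fin.castSucc_lt_succ).ne, ?_, ?_⟩
          · rw [hS1, hk]; simp
          · rw [hS3, hk]; simp
        · rcases hmax t with ht | ht
          · exact h k.castSucc true (by simp) (by simp) _ (by rw [hS1, hk, ht]; simp)
          · exact h k.succ true (by simp) (by simp) _ (by rw [hS3, hk, ht]; simp)
      · refine h (i.castSucc.succAbove k) δ ?_ ?_ _ ?_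
        · intro h'; exact Fin.succAbove_ne _ _ (congrArg Prod.fst h')
        · intro h'; rw [← hsucc] at h'
          exact hki (Fin.succAbove_right_injective (congrArg Prod.fst h'))
        · rw [hS2, Function.update_of_ne hki, hk]

end IsSimpleFibration
end Obstruction

/-! ### Obstruction classes of shells -/

section ObstructionClass

variable {E B A : Type*} [TopologicalSpace E] [TopologicalSpace B] [TopologicalSpace A]
  {q : C(E, B)} {ι : C(A, E)} {x₀ : A}

/-- Two cubes over the same cube that agree in codimension two: one face of the first cube can be
replaced by the corresponding face of the second, at the expense of changing another face. -/
theorem exists_replace_face (hq : ∀ n, HasHomotopyLifting q (Fin n → I)) {m : ℕ}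
    {e e' : C(Fin m → I, E)} (hqe : ∀ w, q (e w) = q (e' w)) (h2 : Set.EqOn e e' (codimTwo m))
    {i k : Fin m} {ε κ : Bool} (hik : (i, ε) ≠ (k, κ)) :
    ∃ e'' : C(Fin m → I, E), (∀ w, q (e'' w) = q (e w)) ∧
      (∀ w : Fin m → I, w i = bit ε → e'' w = e' w) ∧
      (∀ j δ, (j, δ) ≠ (i, ε) → (j, δ) ≠ (k, κ) → ∀ w : Fin m → I, w j = bit δ → e'' w = e w) ∧
      Set.EqOn e'' e (codimTwo m) := by
  classical
  obtain ⟨e'', h0, h1⟩ := horn_filling hq k κ (q.comp e)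
    (fun j δ w => if (j, δ) = (i, ε) then e' w else e w)
    (fun j δ _ => by
      split_ifs
      · exact e'.continuous.continuousOn
      · exact e.continuous.continuousOn)
    (fun j δ _ w _ => by
      split_ifs
      · exact (hqe w).symm
      · rfl)
    (fun j δ j' δ' _ _ w hw hw' => by
      by_cases hj : j = j'
      · subst hj; rw [bit_injective (hw.symm.trans hw')]
      · have := h2 ⟨j, j', δ, δ', hj, hw, hw'⟩
        split_ifs <;> simp [this])
  have hα : ∀ w : Fin m → I, w i = bit ε → e'' w = e' w := fun w hw => by
    rw [h1 i ε hik w hw, if_pos rfl]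
  have hne : ∀ j δ, (j, δ) ≠ (i, ε) → (j, δ) ≠ (k, κ) → ∀ w : Fin m → I, w j = bit δ →
      e'' w = e w := fun j δ hj hj' w hw => by
    rw [h1 j δ hj' w hw, if_neg hj]
  refine ⟨e'', h0, hα, hne, ?_⟩
  rintro w ⟨j, l, δ, δ', hjl, hj, hl⟩
  have hw := h2 ⟨j, l, δ, δ', hjl, hj, hl⟩
  have key : ∀ j δ, w j = bit δ → (j, δ) ≠ (k, κ) → e'' w = e w := fun j δ hj hjk => by
    by_cases hji : (j, δ) = (i, ε)
    · obtain ⟨rfl, rfl⟩ := Prod.ext_iff.1 hji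
      rw [hα w hj, hw]
    · exact hne j δ hji hjk w hj
  by_cases hjk : (j, δ) = (k, κ)
  · refine key l δ' hl fun h => hjl ?_
    exact (congrArg Prod.fst hjk).trans (congrArg Prod.fst h).symm
  · exact key j δ hj hjk

namespace IsSimpleFibration

variable {n : ℕ}

/-- For two cubes over the same cube that agree in codimension two, the alternating product of the
difference classes of their faces is trivial. The faces of the first cube are replaced one after
the other by those of the second; each replacement moves the difference to the opposite face or to
an adjacent one, until only one face is left. -/
theorem faceDiff_cubeFaces (hF : IsSimpleFibration q ι x₀) {e e' : C(Fin (n + 2) → I, E)}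
    (hqe : ∀ w, q (e w) = q (e' w)) (h2 : Set.EqOn e e' (codimTwo (n + 2))) :
    hF.faceDiff (cubeFaces e) (cubeFaces e') = 1 := by
  -- `P S`: without changing the alternating product, `e` can be replaced by a cube that agrees with
  -- `e'` on the faces in `S`.
  let P : (Fin (n + 2) → Bool → Prop) → Prop := fun S => ∃ e₁ : C(Fin (n + 2) → I, E),
    (∀ w, q (e₁ w) = q (e' w)) ∧ Set.EqOn e₁ e' (codimTwo (n + 2)) ∧
      hF.faceDiff (cubeFaces e) (cubeFaces e') = hF.faceDiff (cubeFaces e₁) (cubeFaces e') ∧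
      ∀ j δ, S j δ → ∀ w : Fin (n + 2) → I, w j = bit δ → e₁ w = e' w
  have step : ∀ (S : Fin (n + 2) → Bool → Prop) i ε k κ, (i, ε) ≠ (k, κ) → ¬ S k κ →
      (∀ e₁ e₂ : C(Fin (n + 2) → I, E), (∀ w, q (e₁ w) = q (e₂ w)) →
        Set.EqOn e₁ e₂ (codimTwo (n + 2)) → (∀ j δ, (j, δ) ≠ (i, ε) → (j, δ) ≠ (k, κ) →
          ∀ w : Fin (n + 2) → I, w j = bit δ → e₁ w = e₂ w) →
        hF.faceDiff (cubeFaces e₁) (cubeFaces e₂) = 1) → P S →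
      P (fun j δ => S j δ ∨ (j, δ) = (i, ε)) := by
    rintro S i ε k κ hik hk hd ⟨e₁, hq1, h21, hd1, hS⟩
    obtain ⟨e₂, hq2, hi, hne, h22⟩ := exists_replace_face hF.lift hq1 h21 hik
    refine ⟨e₂, fun w => (hq2 w).trans (hq1 w), h22.trans h21, ?_, ?_⟩
    · rw [hd1, ← hF.faceDiff_mul (g := cubeFaces e₂)
        (cubeFaces_mem (fun w => (hq2 w).symm) h22.symm)
        (cubeFaces_mem (fun w => (hq2 w).trans (hq1 w)) (h22.trans h21)),
        hd e₁ e₂ (fun w => (hq2 w).symm) h22.symm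
          (fun j δ h h' w hw => (hne j δ h h' w hw).symm), one_mul]
    · intro j δ hj w hw
      by_cases hji : (j, δ) = (i, ε)
      · obtain ⟨rfl, rfl⟩ := Prod.ext_iff.1 hji
        exact hi w hw
      · have hj := hj.resolve_right hji
        rw [hne j δ hji (fun h => hk (by
          obtain ⟨rfl, rfl⟩ := Prod.ext_iff.1 h; exact hj)) w hw]
        exact hS j δ hj w hw
  have hmono : ∀ S S' : Fin (n + 2) → Bool → Prop, (∀ j δ, S' j δ → S j δ) → P S → P S' := by
    rintro S S' h ⟨e₁, h1, h2, h3, h4⟩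
    exact ⟨e₁, h1, h2, h3, fun j δ hj => h4 j δ (h j δ hj)⟩
  -- Move the differences on the faces `w i = 1` to the faces `w i = 0`.
  have h1 : ∀ i : ℕ, i ≤ n + 2 → P (fun j δ => δ = true ∧ (j : ℕ) < i) := by
    intro i
    induction i with
    | zero => exact fun _ => ⟨e, hqe, h2, rfl, fun j δ hj => absurd hj.2 (Nat.not_lt_zero _)⟩
    | succ i ih =>
      intro hi
      refine hmono _ _ ?_ (step _ ⟨i, hi⟩ true ⟨i, hi⟩ false (by simp) (by simp) ?_
        (ih (by omega)))
      · rintro j δ ⟨rfl, hj⟩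
        rcases Nat.lt_succ_iff_lt_or_eq.1 hj with h | h
        · exact Or.inl ⟨rfl, h⟩
        · exact Or.inr (by simp [Fin.ext_iff, h])
      · intro e₁ e₂ hq _ h
        exact hF.faceDiff_eq_one_of_opposite hq ⟨i, hi⟩ fun j δ hj =>
          h j δ (by simp [hj]) (by simp [hj])
  -- Move the differences on the faces `w i = 0` to the last one of these faces.
  have h0 : ∀ i : ℕ, i ≤ n + 1 → P (fun j δ => δ = true ∨ (j : ℕ) < i) := by
    intro i
    induction i with
    | zero => exact fun _ => hmono _ _ (fun j δ hj => by simpa using hj) (h1 (n + 2) le_rfl)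
    | succ i ih =>
      intro hi
      let i' : Fin (n + 1) := ⟨i, hi⟩
      refine hmono _ _ ?_ (step _ i'.castSucc false i'.succ false
        (by simp [(Fin.castSucc_lt_succ (i := i')).ne]) (by simp [i']) ?_ (ih (by omega)))
      · rintro j δ (rfl | hj)
        · exact Or.inl (Or.inl rfl)
        · cases δ
          · rcases Nat.lt_succ_iff_lt_or_eq.1 hj with h | h
            · exact Or.inl (Or.inr h)
            · exact Or.inr (by simp [Fin.ext_iff, h, i'])
          · exact Or.inl (Or.inl rfl)
      · intro e₁ e₂ hq h2 h
        exact hF.faceDiff_eq_one_of_adjacent hq i' h2 h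
  obtain ⟨e₁, hq1, -, hd1, hS⟩ := h0 (n + 1) le_rfl
  rw [hd1]
  refine hF.faceDiff_eq_one_of_opposite hq1 (Fin.last _) fun j δ hj => hS j δ (Or.inr ?_)
  have h3 := Fin.val_lt_last hj
  simpa using h3

open Classical in
/-- The obstruction class of a shell over an `(n + 2)`-cube `b`: the alternating product of the
difference classes between the faces of an auxiliary lift of `b`, which agrees with the shell in
codimension two, and those of the shell. -/
def obst (hF : IsSimpleFibration q ι x₀) (b : C(Fin (n + 2) → I, B))
    (f : Fin (n + 2) → Bool → C(Fin (n + 1) → I, E)) : HomotopyGroup (Fin (n + 1)) A x₀ :=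
  if h : ∃ e : C(Fin (n + 2) → I, E), (∀ w, q (e w) = b w) ∧
      ∀ j δ, (cubeFaces e j δ, f j δ) ∈ fibrePairs q (n + 1)
  then hF.faceDiff (cubeFaces h.choose) f else 1

/-- The obstruction class does not depend on the auxiliary lift, by `faceDiff_cubeFaces`. -/
theorem obst_eq (hF : IsSimpleFibration q ι x₀) {b : C(Fin (n + 2) → I, B)}
    {f : Fin (n + 2) → Bool → C(Fin (n + 1) → I, E)} {e : C(Fin (n + 2) → I, E)}
    (he : ∀ w, q (e w) = b w) (hef : ∀ j δ, (cubeFaces e j δ, f j δ) ∈ fibrePairs q (n + 1)) :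
    hF.obst b f = hF.faceDiff (cubeFaces e) f := by
  have h : ∃ e : C(Fin (n + 2) → I, E), (∀ w, q (e w) = b w) ∧
      ∀ j δ, (cubeFaces e j δ, f j δ) ∈ fibrePairs q (n + 1) := ⟨e, he, hef⟩
  rw [obst, dif_pos h]
  obtain ⟨h1, h2⟩ := h.choose_spec
  have hee : ∀ j δ, (cubeFaces e j δ, cubeFaces h.choose j δ) ∈ fibrePairs q (n + 1) :=
    fun j δ => fibrePairs_trans (hef j δ) (fibrePairs_symm (h2 j δ))
  rw [← hF.faceDiff_mul hee h2, hF.faceDiff_cubeFaces (fun w => (he w).trans (h1 w).symm) ?_,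
    one_mul]
  rintro w ⟨j, k, δ, δ', hjk, hj, hk⟩
  have := (hee j δ).2 _ (removeNth_mem_boundary hjk hk)
  simpa [cubeFaces, faceMap_removeNth hj] using this

theorem obst_eq_one_of_filling (hF : IsSimpleFibration q ι x₀) (e : C(Fin (n + 2) → I, E)) :
    hF.obst (q.comp e) (cubeFaces e) = 1 := by
  rw [hF.obst_eq (e := e) (fun _ => rfl) (fun _ _ => fibrePairs_refl _), hF.faceDiff_self]

/-- A shell whose obstruction class is trivial can be filled. -/
theorem exists_filling_of_obst_eq_one (hF : IsSimpleFibration q ι x₀)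
    {b : C(Fin (n + 2) → I, B)} {f : Fin (n + 2) → Bool → C(Fin (n + 1) → I, E)}
    (hf : IsShell q b f) (h : hF.obst b f = 1) :
    ∃ e : C(Fin (n + 2) → I, E), (∀ w, q (e w) = b w) ∧ ∀ j δ, cubeFaces e j δ = f j δ := by
  classical
  obtain ⟨e, he, hne, hef⟩ := hf.exists_filling hF.lift 0 false
  rw [hF.obst_eq he hef] at h
  have hd : hF.diff (cubeFaces e 0 false) (f 0 false) = 1 := by
    let := hF.commGroup n
    have h3 : ∀ (X : Fin (n + 2) → Bool → HomotopyGroup (Fin (n + 1)) A x₀),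
        (∀ j δ, (j, δ) ≠ (0, false) → X j δ = 1) → faceProd X = 1 → X 0 false = 1 := by
      intro X hX h
      rw [faceProd, Fin.prod_univ_succ, Finset.prod_eq_one (fun j _ => by
        rw [hX _ _ (by simp [Fin.succ_ne_zero]), hX _ _ (by simp [Fin.succ_ne_zero])]; simp),
        hX _ _ (by simp)] at h
      simpa using h
    refine h3 _ (fun j δ hj => ?_) h
    rw [hne j δ hj, hF.diff_self]
  obtain ⟨γ, hγ⟩ := (hF.diff_eq_one_iff (hef 0 false)).1 hd
  -- Glue the homotopy `γ` of the remaining face to the constant homotopies of the others.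
  let K : C(I × (Fin (n + 1) → I), E) := (γ : C(I, C(Fin (n + 1) → I, E))).uncurry
  have hK : ∀ t s k δ', s k = bit δ' → K (t, s) = e (faceMap 0 false s) := fun t s k δ' hs =>
    ((hγ t).2 s (mem_boundary_iff.2 ⟨k, δ', hs⟩)).symm
  have hedge : ∀ (w : Fin (n + 2) → I) k δ' t, k ≠ 0 → w 0 = bit false → w k = bit δ' →
      K (t, (0 : Fin (n + 2)).removeNth w) = e w := fun w k δ' t hk0 hw0 hk => by
    obtain ⟨l, rfl⟩ := Fin.exists_succAbove_eq hk0
    rw [hK t _ l δ' hk, faceMap_removeNth hw0]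
  obtain ⟨L, hL, hL0, hLb⟩ := homotopy_horn hF.lift (b.comp ⟨Prod.snd, continuous_snd⟩) e
    (fun j δ x => if (j, δ) = (0, false) then K (x.1, (0 : Fin (n + 2)).removeNth x.2) else e x.2)
    he
    (fun j δ => by
      refine Continuous.continuousOn ?_
      split_ifs
      · unfold Fin.removeNth; fun_prop
      · fun_prop)
    (fun j δ t s hs => by
      dsimp only
      split_ifs with hj
      · obtain ⟨rfl, rfl⟩ := Prod.ext_iff.1 hj
        refine ((hγ t).1 _).symm.trans ?_
        simp only [cubeFaces, ContinuousMap.comp_apply, he, faceMap_removeNth hs]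
        rfl
      · exact he s)
    (fun j δ s hs => by
      dsimp only
      split_ifs with hj
      · obtain ⟨rfl, rfl⟩ := Prod.ext_iff.1 hj
        change γ 0 _ = _
        rw [γ.source]
        exact congrArg e (faceMap_removeNth hs)
      · rfl)
    (fun j δ k δ' t s hs hs' => by
      by_cases hjk : j = k
      · subst hjk; rw [bit_injective (hs.symm.trans hs')]
      · dsimp only
        split_ifs with h1 h2 h2
        · rfl
        · obtain ⟨rfl, rfl⟩ := Prod.ext_iff.1 h1
          exact hedge s k δ' t (Ne.symm hjk) hs hs'
        · obtain ⟨rfl, rfl⟩ := Prod.ext_iff.1 h2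
          exact (hedge s j δ t hjk hs' hs).symm
        · rfl)
  refine ⟨L.curry 1, fun w => hL (1, w), fun j δ => ContinuousMap.ext fun s => ?_⟩
  refine (hLb j δ 1 _ (faceMap_same _ _ _)).trans ?_
  dsimp only
  split_ifs with hj
  · obtain ⟨rfl, rfl⟩ := Prod.ext_iff.1 hj
    rw [removeNth_faceMap]
    change γ 1 s = _
    rw [γ.target]
  · rw [← hne j δ hj]; rfl

/-- The effect on the obstruction class of changing a shell without changing it in codimension
two. -/
theorem obst_change (hF : IsSimpleFibration q ι x₀)
    {b : C(Fin (n + 2) → I, B)} {f g : Fin (n + 2) → Bool → C(Fin (n + 1) → I, E)}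
    (hf : IsShell q b f) (hfg : ∀ j δ, (f j δ, g j δ) ∈ fibrePairs q (n + 1)) :
    hF.obst b g = hF.obst b f * hF.faceDiff f g := by
  obtain ⟨e, he, -, hef⟩ := hf.exists_filling hF.lift 0 false
  rw [hF.obst_eq he hef, hF.faceDiff_mul hef hfg]
  exact hF.obst_eq he fun j δ => fibrePairs_trans (hef j δ) (hfg j δ)

end IsSimpleFibration

/-- A partial lift that is defined on the faces of codimension two of a cube can be replaced by a
total lift without changing it in codimension three. -/
theorem exists_lift_of_codimTwo (hq : ∀ n, HasHomotopyLifting q (Fin n → I)) {m : ℕ}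
    (b : C(Fin (m + 3) → I, B)) (e : (Fin (m + 3) → I) → E)
    (hc : ContinuousOn e (codimTwo (m + 3))) (hb : ∀ w ∈ codimTwo (m + 3), q (e w) = b w) :
    ∃ e' : C(Fin (m + 3) → I, E), (∀ w, q (e' w) = b w) ∧
      ∀ i ε, ∀ w ∈ codimTwo (m + 2), e' (faceMap i ε w) = e (faceMap i ε w) := by
  let cn : C(I × (Fin (m + 2) → I), Fin (m + 3) → I) := ⟨fun x => Fin.cons x.1 x.2, by
    refine continuous_pi fun j => ?_
    induction j using Fin.cases with
    | zero => simpa using continuous_fst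
    | succ j =>
      simp only [Fin.cons_succ]
      exact (continuous_apply j).comp continuous_snd⟩
  have cn0 : ∀ t s, cn (t, s) 0 = t := fun _ _ => rfl
  have cns : ∀ t s k, cn (t, s) k.succ = s k := fun _ _ _ => rfl
  -- Lift over the face `w 0 = 0`: the lift is known on the boundary of that face, and all but one
  -- of the faces of the boundary are kept.
  obtain ⟨f₁, hf₁, hf₁'⟩ := horn_filling hq (0 : Fin (m + 2)) false
    (b.comp (cn.comp ⟨fun s => (0, s), by fun_prop⟩)) (fun _ _ w => e (cn (0, w)))
    (fun j δ _ => hc.comp (by fun_prop) fun w hw =>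
      ⟨0, j.succ, false, δ, (Fin.succ_ne_zero j).symm, cn0 _ _, (cns _ _ _).trans hw⟩)
    (fun j δ _ w hw => hb _
      ⟨0, j.succ, false, δ, (Fin.succ_ne_zero j).symm, cn0 _ _, (cns _ _ _).trans hw⟩)
    (fun _ _ _ _ _ _ _ _ _ => rfl)
  have hf₁e : ∀ w ∈ codimTwo (m + 2), f₁ w = e (cn (0, w)) := by
    rintro w ⟨j, k, δ, δ', hjk, hj, hk⟩
    by_cases h : (j, δ) = (0, false)
    · refine hf₁' k δ' (fun h' => hjk ?_) w hk
      exact (congrArg Prod.fst h).trans (congrArg Prod.fst h').symm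
    · exact hf₁' j δ h w hj
  -- Lift over the faces `w j = bit δ` with `j ≠ 0`: regarded as homotopies in the direction of
  -- `w 0`, they start on the face `w 0 = 0`, and the lateral faces are kept.
  have hlat : ∀ j δ, ∃ g : C(I × (Fin (m + 1) → I), E),
      (∀ x, q (g x) = b (cn (x.1, faceMap j δ x.2))) ∧
      (∀ s, g (0, s) = f₁ (faceMap j δ s)) ∧
      ∀ (k : Fin (m + 1)) δ' t (s : Fin (m + 1) → I), s k = bit δ' →
        g (t, s) = e (cn (t, faceMap j δ s)) := by
    intro j δ
    have hmem : ∀ k δ' t (s : Fin (m + 1) → I), s k = bit δ' →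
        cn (t, faceMap j δ s) ∈ codimTwo (m + 3) := fun k δ' t s hs =>
      ⟨j.succ, (j.succAbove k).succ, δ, δ', by simp [(Fin.succAbove_ne j k).symm],
        by rw [cns]; simp, by rw [cns]; simp [hs]⟩
    exact homotopy_horn hq
      (b.comp (cn.comp ⟨fun x => (x.1, faceMap j δ x.2), by fun_prop⟩))
      (f₁.comp (faceMap j δ)) (fun _ _ x => e (cn (x.1, faceMap j δ x.2)))
      (fun s => hf₁ _)
      (fun k δ' => hc.comp (by fun_prop) fun x hx => hmem k δ' x.1 x.2 hx)
      (fun k δ' t s hs => hb _ (hmem k δ' t s hs))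
      (fun k δ' s hs => (hf₁e _ (faceMap_mem_codimTwo (mem_boundary_iff.2 ⟨k, δ', hs⟩))).symm)
      (fun _ _ _ _ _ _ _ _ => rfl)
  choose g hg hg0 hge using hlat
  have hge' : ∀ j δ k δ' t (s : Fin (m + 2) → I), j ≠ k → s j = bit δ → s k = bit δ' →
      g j δ (t, j.removeNth s) = e (cn (t, s)) := fun j δ k δ' t s hjk hs hs' => by
    obtain ⟨l, rfl⟩ := Fin.exists_succAbove_eq hjk.symm
    rw [hge j δ l δ' t (j.removeNth s) hs', faceMap_removeNth hs]
  -- Fill the cube, with no condition on the face `w 0 = 1`.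
  obtain ⟨e', he', -, heb⟩ := homotopy_horn hq (b.comp cn) f₁
    (fun j δ x => g j δ (x.1, j.removeNth x.2)) (fun s => hf₁ s)
    (fun j δ => by
      refine Continuous.continuousOn ?_
      unfold Fin.removeNth; fun_prop)
    (fun j δ t s hs => by simp [hg, faceMap_removeNth hs])
    (fun j δ s hs => by simp [hg0, faceMap_removeNth hs])
    (fun j δ k δ' t s hs hs' => by
      by_cases hjk : j = k
      · subst hjk; rw [bit_injective (hs.symm.trans hs')]
      · dsimp only
        rw [hge' j δ k δ' t s hjk hs hs', hge' k δ' j δ t s (Ne.symm hjk) hs' hs])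
  let sp : C(Fin (m + 3) → I, I × (Fin (m + 2) → I)) :=
    ⟨fun w => (w 0, fun k => w k.succ), by fun_prop⟩
  have hsp : ∀ w, cn (sp w) = w := fun w => Fin.cons_self_tail w
  have key : ∀ (w : Fin (m + 3) → I) (j k : Fin (m + 2)) δ δ', j ≠ k → w j.succ = bit δ →
      w k.succ = bit δ' → e' (sp w) = e w := fun w j k δ δ' hjk hj hk => by
    refine (heb j δ (w 0) _ hj).trans ((hge' j δ k δ' _ _ hjk hj hk).trans ?_)
    exact congrArg e (hsp w)
  refine ⟨e'.comp sp, fun w => ?_, ?_⟩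
  · simp [he', hsp]
  · rintro i ε w ⟨j, k, δ, δ', hjk, hj, hk⟩
    -- Of the three coordinates `i`, `j` and `k`, at least two are different from `0`.
    have hw : ∀ l κ, w l = bit κ → faceMap i ε w (i.succAbove l) = bit κ := fun l κ h => by
      simp [h]
    have key' : ∀ (j k : Fin (m + 3)) δ δ', j ≠ k → j ≠ 0 → k ≠ 0 → faceMap i ε w j = bit δ →
        faceMap i ε w k = bit δ' → e' (sp (faceMap i ε w)) = e (faceMap i ε w) := by
      intro j k δ δ' hjk hj0 hk0 hj hk
      obtain ⟨j, rfl⟩ := Fin.exists_succ_eq.2 hj0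
      obtain ⟨k, rfl⟩ := Fin.exists_succ_eq.2 hk0
      exact key _ j k δ δ' (fun h => hjk (by rw [h])) hj hk
    have hjk' : i.succAbove j ≠ i.succAbove k := fun h => hjk (Fin.succAbove_right_injective h)
    by_cases h1 : i.succAbove j = 0
    · have hi0 : i ≠ 0 := by rintro rfl; exact Fin.succAbove_ne _ _ h1
      exact key' i (i.succAbove k) ε δ' (Fin.succAbove_ne i k).symm hi0
        (fun h => hjk' (h1.trans h.symm)) (faceMap_same _ _ _) (hw _ _ hk)
    · by_cases h2 : i.succAbove k = 0
      · have hi0 : i ≠ 0 := by rintro rfl; exact Fin.succAbove_ne _ _ h2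
        exact key' i (i.succAbove j) ε δ (Fin.succAbove_ne i j).symm hi0 h1
          (faceMap_same _ _ _) (hw _ _ hj)
      · exact key' _ _ δ δ' hjk' h1 h2 (hw _ _ hj) (hw _ _ hk)

/-- The cocycle condition: for a partial lift that is defined on the faces of codimension two of a
cube, the alternating product of the obstruction classes of the faces of codimension one is
trivial. -/
theorem IsSimpleFibration.faceProd_obst (hF : IsSimpleFibration q ι x₀) {n : ℕ}
    (b : C(Fin (n + 3) → I, B)) (e : (Fin (n + 3) → I) → E)
    (hc : ContinuousOn e (codimTwo (n + 3))) (hb : ∀ w ∈ codimTwo (n + 3), q (e w) = b w)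
    (f : Fin (n + 3) → Bool → Fin (n + 2) → Bool → C(Fin (n + 1) → I, E))
    (hf : ∀ i ε j δ s, f i ε j δ s = e (faceMap i ε (faceMap j δ s))) :
    letI := hF.commGroup n
    faceProd (fun i ε => hF.obst (b.comp (faceMap i ε)) (f i ε)) = 1 := by
  let := hF.commGroup n
  obtain ⟨e', he', hee⟩ := exists_lift_of_codimTwo hF.lift b e hc hb
  have h1 : ∀ i ε, hF.obst (b.comp (faceMap i ε)) (f i ε) = faceProd fun j δ =>
      hF.diff ((e'.comp (faceMap i ε)).comp (faceMap j δ)) (f i ε j δ) := fun i ε => by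
    refine hF.obst_eq (e := e'.comp (faceMap i ε)) (fun w => he' _)
      fun j δ => ⟨fun s => ?_, fun s hs => ?_⟩
    · rw [hf, hb _ ⟨i, i.succAbove j, ε, δ, (Fin.succAbove_ne i j).symm, by simp, by simp⟩]
      exact he' _
    · rw [hf]; exact hee i ε _ (faceMap_mem_codimTwo hs)
  simp only [h1]
  refine faceProd_faceProd _ fun i ε j δ => ?_
  congr 1
  · ext s; simp [faceMap_faceMap]
  · ext s; simp [hf, faceMap_faceMap]

end ObstructionClass

/-! ### Simplices, their skeleta, and the map from the cube to the simplex -/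

section Simplex

theorem stdSimplex_map_apply {X Y : Type*} [Fintype X] [Fintype Y] [DecidableEq Y] (f : X → Y)
    (x : stdSimplex ℝ X) (k : Y) :
    stdSimplex.map f x k = ∑ j with f j = k, x j := by
  rw [stdSimplex.map_coe, FunOnFinite.linearMap_apply_apply]

/-- The set of vertices at which a point of the simplex has a non-zero coordinate. -/
def simplexSupport {m : ℕ} (x : stdSimplex ℝ (Fin (m + 1))) : Finset (Fin (m + 1)) :=
  Finset.univ.filter fun k => x k ≠ 0

@[simp] theorem mem_simplexSupport {m : ℕ} {x : stdSimplex ℝ (Fin (m + 1))} {k : Fin (m + 1)} :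
    k ∈ simplexSupport x ↔ x k ≠ 0 := by simp [simplexSupport]

theorem simplexSupport_map {m l : ℕ} (f : Fin (m + 1) → Fin (l + 1))
    (x : stdSimplex ℝ (Fin (m + 1))) :
    simplexSupport (stdSimplex.map f x) = (simplexSupport x).image f := by
  ext k
  rw [mem_simplexSupport, stdSimplex_map_apply, Ne,
    Finset.sum_eq_zero_iff_of_nonneg fun _ _ => stdSimplex.zero_le x _]
  simp [and_comm]

theorem simplexSupport_nonempty {m : ℕ} (x : stdSimplex ℝ (Fin (m + 1))) :
    (simplexSupport x).Nonempty := by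
  by_contra h
  rw [Finset.not_nonempty_iff_eq_empty] at h
  have h0 : ∀ k, x k = 0 := fun k => by
    by_contra hk
    have := mem_simplexSupport.2 hk
    simp [h] at this
  have := stdSimplex.sum_eq_one x
  simp [h0] at this

/-- The `(n - 1)`-skeleton of the `m`-simplex: the points with at most `n` non-zero coordinates. -/
def skeleton (n m : ℕ) : Set (stdSimplex ℝ (Fin (m + 1))) :=
  {x | (simplexSupport x).card ≤ n}

theorem mem_skeleton_of_lt {n m : ℕ} (h : m < n) (x : stdSimplex ℝ (Fin (m + 1))) :
    x ∈ skeleton n m := by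
  have := (simplexSupport x).card_le_univ
  rw [Fintype.card_fin] at this
  exact this.trans (by omega)

theorem skeleton_mono {n n' m : ℕ} (h : n ≤ n') : skeleton n m ⊆ skeleton n' m := fun _ hx =>
  le_trans (show _ ≤ n from hx) h

theorem map_mem_skeleton {n m l : ℕ} (f : Fin (m + 1) → Fin (l + 1))
    {x : stdSimplex ℝ (Fin (m + 1))} (hx : x ∈ skeleton n m) :
    stdSimplex.map f x ∈ skeleton n l := by
  change (simplexSupport (stdSimplex.map f _)).card ≤ n
  rw [simplexSupport_map]
  exact Finset.card_image_le.trans hx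

theorem map_mem_skeleton_of_card {n m l : ℕ} (f : Fin (m + 1) → Fin (l + 1))
    (h : (Finset.univ.image f).card ≤ n) (x : stdSimplex ℝ (Fin (m + 1))) :
    stdSimplex.map f x ∈ skeleton n l := by
  change (simplexSupport (stdSimplex.map f _)).card ≤ n
  rw [simplexSupport_map]
  exact (Finset.card_le_card (Finset.image_subset_image (Finset.subset_univ _))).trans h

theorem isClosed_skeleton (n m : ℕ) : IsClosed (skeleton n m) := by
  have : skeleton n m = ⋃ S : {S : Finset (Fin (m + 1)) // S.card ≤ n},
      ⋂ k : {k // k ∉ S.1}, {x : stdSimplex ℝ (Fin (m + 1)) | x k = 0} := by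
    ext x
    simp only [Set.mem_iUnion, Set.mem_iInter, Set.mem_ofPred_eq]
    constructor
    · intro hx
      exact ⟨⟨simplexSupport x, hx⟩, fun k => by simpa using k.2⟩
    · rintro ⟨S, hS⟩
      refine (Finset.card_le_card fun k hk => ?_).trans S.2
      by_contra h
      exact mem_simplexSupport.1 hk (hS ⟨k, h⟩)
  rw [this]
  refine isClosed_iUnion_of_finite fun S => isClosed_iInter fun k => ?_
  exact isClosed_eq ((continuous_apply _).comp continuous_subtype_val) continuous_const

theorem stdSimplex_map_injective {m l : ℕ} {f : Fin (m + 1) → Fin (l + 1)}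
    (hf : Function.Injective f) :
    Function.Injective (stdSimplex.map (S := ℝ) f) := by
  intro x y h
  ext k
  have := DFunLike.congr_fun h (f k)
  simpa [stdSimplex_map_apply, hf.eq_iff, Finset.sum_filter] using this

/-- Every point of a simplex is an interior point of a face. -/
theorem exists_map_eq {k m : ℕ} (x : stdSimplex ℝ (Fin (m + 1)))
    (hx : (simplexSupport x).card = k + 1) :
    ∃ (θ : Fin (k + 1) →o Fin (m + 1)) (y : stdSimplex ℝ (Fin (k + 1))),
      StrictMono θ ∧ simplexSupport y = Finset.univ ∧ stdSimplex.map θ y = x := by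
  let θ := (simplexSupport x).orderEmbOfFin hx
  have hr : ∀ l, l ∈ simplexSupport x ↔ ∃ j, θ j = l := fun l => by
    have := (simplexSupport x).range_orderEmbOfFin hx
    rw [← Finset.mem_coe, ← this]; rfl
  refine ⟨θ.toOrderHom, ⟨fun j => x (θ j), fun j => stdSimplex.zero_le x _, ?_⟩, θ.strictMono,
    ?_, ?_⟩
  · rw [← stdSimplex.sum_eq_one x, ← Finset.sum_subset (Finset.subset_univ (simplexSupport x))
      fun l _ hl => by simpa using hl]
    refine Finset.sum_bij (fun j _ => θ j) (fun j _ => (hr _).2 ⟨j, rfl⟩)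
      (fun _ _ _ _ h => θ.injective h) (fun l hl => ?_) (fun _ _ => rfl)
    obtain ⟨j, hj⟩ := (hr l).1 hl
    exact ⟨j, Finset.mem_univ _, hj⟩
  · ext j
    simp only [mem_simplexSupport, Finset.mem_univ, iff_true]
    change x (θ j) ≠ 0
    exact mem_simplexSupport.1 ((hr _).2 ⟨j, rfl⟩)
  · ext l
    rw [stdSimplex_map_apply]
    change ∑ j with θ j = l, x (θ j) = x l
    by_cases hl : l ∈ simplexSupport x
    · obtain ⟨j, rfl⟩ := (hr l).1 hl
      simp [θ.injective.eq_iff, Finset.sum_filter]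
    · rw [Finset.sum_eq_zero, eq_comm]
      · simpa using hl
      · intro j hj
        exact absurd ((hr l).2 ⟨j, (Finset.mem_filter.1 hj).2⟩) hl

/-- The uniqueness part of `exists_map_eq`. -/
theorem map_eq_map_iff {k m : ℕ} {θ θ' : Fin (k + 1) →o Fin (m + 1)}
    {y y' : stdSimplex ℝ (Fin (k + 1))} (hθ : StrictMono θ) (hθ' : StrictMono θ')
    (hy : simplexSupport y = Finset.univ) (hy' : simplexSupport y' = Finset.univ)
    (h : stdSimplex.map θ y = stdSimplex.map θ' y') : θ = θ' ∧ y = y' := by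
  have h1 : θ = θ' := by
    have h2 := congrArg simplexSupport h
    rw [simplexSupport_map, simplexSupport_map, hy, hy'] at h2
    have h3 : Set.range θ = Set.range θ' := by
      have := congrArg (fun s : Finset (Fin (m + 1)) => (s : Set (Fin (m + 1)))) h2
      simpa using this
    exact DFunLike.coe_injective ((StrictMono.range_inj hθ hθ').1 h3)
  subst h1
  exact ⟨rfl, stdSimplex_map_injective hθ.injective h⟩

/-- The barycentric coordinates of the image of a point of the `m`-cube in the `m`-simplex, which is
the join of the vertex `0` and the face opposite to it. -/
def cubeCoord : ∀ m : ℕ, (Fin m → I) → Fin (m + 1) → ℝ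
  | 0, _ => fun _ => 1
  | m + 1, s => Fin.cons (1 - (s 0 : ℝ)) fun k => (s 0 : ℝ) * cubeCoord m (Fin.tail s) k

theorem cubeCoord_nonneg : ∀ (m : ℕ) (s : Fin m → I) k, 0 ≤ cubeCoord m s k
  | 0, _, _ => zero_le_one
  | m + 1, s, k => by
    refine Fin.cases ?_ (fun k => ?_) k
    · simpa [cubeCoord] using (s 0).2.2
    · simpa [cubeCoord] using mul_nonneg (s 0).2.1 (cubeCoord_nonneg m _ k)

theorem sum_cubeCoord : ∀ (m : ℕ) (s : Fin m → I), ∑ k, cubeCoord m s k = 1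
  | 0, _ => by simp [cubeCoord]
  | m + 1, s => by
    rw [Fin.sum_univ_succ]
    simp [cubeCoord, ← Finset.mul_sum, sum_cubeCoord m]

theorem continuous_cubeCoord : ∀ (m : ℕ) (k : Fin (m + 1)), Continuous fun s => cubeCoord m s k
  | 0, _ => continuous_const
  | m + 1, k => by
    refine Fin.cases ?_ (fun k => ?_) k
    · simp only [cubeCoord, Fin.cons_zero]; fun_prop
    · simp only [cubeCoord, Fin.cons_succ]
      have h := continuous_cubeCoord m k
      refine Continuous.mul (by fun_prop) (h.comp ?_)
      unfold Fin.tail; fun_prop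

/-- The map from the cube to the simplex that collapses the faces `s j = 0`. -/
def cubeToSimplex (m : ℕ) : C(Fin m → I, stdSimplex ℝ (Fin (m + 1))) where
  toFun s := ⟨cubeCoord m s, cubeCoord_nonneg m s, sum_cubeCoord m s⟩
  continuous_toFun := (continuous_pi (continuous_cubeCoord m)).subtype_mk _

theorem map_succAbove_apply {m : ℕ} (i : Fin (m + 2)) (x : stdSimplex ℝ (Fin (m + 1))) :
    (stdSimplex.map i.succAbove x : Fin (m + 2) → ℝ) = i.insertNth 0 (x : Fin (m + 1) → ℝ) := by
  funext k
  rw [stdSimplex_map_apply]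
  by_cases hk : k = i
  · subst hk
    rw [Fin.insertNth_apply_same, Finset.sum_eq_zero]
    intro j hj
    exact absurd (Finset.mem_filter.1 hj).2 (Fin.succAbove_ne _ _)
  · obtain ⟨l, rfl⟩ := Fin.exists_succAbove_eq hk
    rw [Fin.insertNth_apply_succAbove]
    simp [Finset.sum_filter]

theorem cubeCoord_cons {m : ℕ} (a : I) (s : Fin m → I) :
    cubeCoord (m + 1) (Fin.cons a s : Fin (m + 1) → I) =
      Fin.cons (1 - (a : ℝ)) fun k => (a : ℝ) * cubeCoord m s k := rfl

theorem cubeCoord_insertNth_one : ∀ (m : ℕ) (i : Fin (m + 1)) (s : Fin m → I),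
    cubeCoord (m + 1) (i.insertNth (1 : I) s) =
      i.castSucc.insertNth (0 : ℝ) (cubeCoord m s) := by
  intro m
  induction m with
  | zero =>
    intro i s
    obtain rfl : i = 0 := Fin.ext (by omega)
    change _ = (0 : Fin 2).insertNth (α := fun _ => ℝ) (0 : ℝ) _
    rw [Fin.insertNth_zero', Fin.insertNth_zero']
    simp [cubeCoord]
  | succ m ih =>
    intro i s
    refine Fin.cases ?_ (fun i => ?_) i
    · change _ = (0 : Fin (m + 3)).insertNth (α := fun _ => ℝ) (0 : ℝ) _
      rw [Fin.insertNth_zero', Fin.insertNth_zero', cubeCoord]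
      simp
    · obtain ⟨a, s, rfl⟩ : ∃ (a : I) (s' : Fin m → I), s = Fin.cons a s' :=
        ⟨s 0, Fin.tail s, (Fin.cons_self_tail s).symm⟩
      rw [Fin.insertNth_succ_cons, cubeCoord_cons, cubeCoord_cons]
      simp only [ih]
      rw [← Fin.succ_castSucc, Fin.insertNth_succ_cons]
      congr 1
      funext k
      by_cases hk : k = i.castSucc
      · subst hk; simp
      · obtain ⟨l, rfl⟩ := Fin.exists_succAbove_eq hk
        simp

theorem cubeCoord_insertNth_last_zero : ∀ (m : ℕ) (s : Fin m → I),
    cubeCoord (m + 1) ((Fin.last m).insertNth (0 : I) s) =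
      (Fin.last (m + 1)).insertNth (0 : ℝ) (cubeCoord m s) := by
  intro m
  induction m with
  | zero =>
    intro s
    funext k
    change cubeCoord 1 ((0 : Fin 1).insertNth (α := fun _ => I) (0 : I) s) k =
      (Fin.succ 0).insertNth (α := fun _ => ℝ) (0 : ℝ) _ k
    have : cubeCoord 0 s = Fin.cons 1 (fun k => k.elim0) := by
      funext k; obtain rfl : k = 0 := Fin.ext (by omega)
      rfl
    rw [this, Fin.insertNth_succ_cons, Fin.insertNth_zero', Fin.insertNth_zero', cubeCoord]
    refine Fin.cases ?_ (fun k => ?_) k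
    · simp
    · obtain rfl : k = 0 := Fin.ext (by omega)
      simp
  | succ m ih =>
    intro s
    obtain ⟨a, s, rfl⟩ : ∃ (a : I) (s' : Fin m → I), s = Fin.cons a s' :=
      ⟨s 0, Fin.tail s, (Fin.cons_self_tail s).symm⟩
    rw [← Fin.succ_last, Fin.insertNth_succ_cons, cubeCoord_cons, cubeCoord_cons]
    simp only [ih]
    rw [← Fin.succ_last (m + 1), Fin.insertNth_succ_cons]
    congr 1
    funext k
    by_cases hk : k = Fin.last (m + 1)
    · subst hk; simp
    · obtain ⟨l, rfl⟩ := Fin.exists_succAbove_eq hk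
      simp

/-- The faces `s i = 1` of the cube are mapped to the faces of the simplex except the last one. -/
theorem cubeToSimplex_face_one {m : ℕ} (i : Fin (m + 1)) (s : Fin m → I) :
    cubeToSimplex (m + 1) (faceMap i true s) =
      stdSimplex.map i.castSucc.succAbove (cubeToSimplex m s) := by
  apply stdSimplex.ext
  rw [map_succAbove_apply]
  exact cubeCoord_insertNth_one m i s

/-- The face of the cube where the last coordinate vanishes is mapped to the last face of the
simplex. -/
theorem cubeToSimplex_face_last {m : ℕ} (s : Fin m → I) :
    cubeToSimplex (m + 1) (faceMap (Fin.last m) false s) =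
      stdSimplex.map (Fin.last (m + 1)).succAbove (cubeToSimplex m s) := by
  apply stdSimplex.ext
  rw [map_succAbove_apply]
  exact cubeCoord_insertNth_last_zero m s

theorem cubeCoord_eq_zero : ∀ (m : ℕ) (s : Fin m → I) (i : Fin m) (k : Fin (m + 1)), s i = 0 →
    i.castSucc < k → cubeCoord m s k = 0
  | 0, _, i, _, _, _ => i.elim0
  | m + 1, s, i, k, hs, hk => by
    obtain ⟨k, rfl⟩ := Fin.exists_succ_eq.2 (Fin.ne_zero_of_lt hk)
    rw [cubeCoord, Fin.cons_succ]
    induction i using Fin.cases with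
    | zero => simp [hs]
    | succ i =>
      rw [cubeCoord_eq_zero m (Fin.tail s) i k hs (by
        rw [← Fin.succ_castSucc] at hk; exact Fin.succ_lt_succ_iff.1 hk), mul_zero]

/-- The faces `s i = 0` of the cube other than the last one are mapped to faces of the simplex of
smaller dimension. -/
theorem cubeToSimplex_mem_skeleton {m n : ℕ} {s : Fin m → I} {i : Fin m} (hs : s i = 0)
    (hi : (i : ℕ) < n) : cubeToSimplex m s ∈ skeleton n m := by
  have : simplexSupport (cubeToSimplex m s) ⊆ Finset.Iic i.castSucc := fun k hk => by
    rw [Finset.mem_Iic]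
    by_contra h
    exact mem_simplexSupport.1 hk (cubeCoord_eq_zero m s i k hs (not_le.1 h))
  have := Finset.card_le_card this
  rw [Fin.card_Iic, Fin.val_castSucc] at this
  exact this.trans (by omega)

theorem cubeToSimplex_boundary {m : ℕ} {s : Fin (m + 1) → I}
    (hs : s ∈ Cube.boundary (Fin (m + 1))) :
    cubeToSimplex (m + 1) s ∈ skeleton (m + 1) (m + 1) := by
  obtain ⟨j, δ, hj⟩ := mem_boundary_iff.1 hs
  cases δ
  · exact cubeToSimplex_mem_skeleton hj (by omega)
  · rw [← faceMap_removeNth hj, cubeToSimplex_face_one]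
    exact map_mem_skeleton _ (mem_skeleton_of_lt (Nat.lt_succ_self _) _)

theorem cubeToSimplex_codimTwo {m : ℕ} {w : Fin (m + 2) → I} (hw : w ∈ codimTwo (m + 2)) :
    cubeToSimplex (m + 2) w ∈ skeleton (m + 1) (m + 2) := by
  obtain ⟨j, k, δ, δ', hjk, hj, hk⟩ := hw
  have hb := removeNth_mem_boundary hjk hk
  cases δ
  · by_cases hl : j = Fin.last _
    · subst hl
      rw [← faceMap_removeNth hj, cubeToSimplex_face_last]
      exact map_mem_skeleton _ (cubeToSimplex_boundary hb)
    · have := Fin.val_lt_last hl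
      exact cubeToSimplex_mem_skeleton hj (by omega)
  · rw [← faceMap_removeNth hj, cubeToSimplex_face_one]
    exact map_mem_skeleton _ (cubeToSimplex_boundary hb)

theorem cubeCoord_ne_zero : ∀ (m : ℕ) (s : Fin m → I), (∀ i, s i ≠ 0 ∧ s i ≠ 1) → ∀ k,
    cubeCoord m s k ≠ 0
  | 0, _, _, _ => one_ne_zero
  | m + 1, s, hs, k => by
    have h0 : (s 0 : ℝ) ≠ 0 := fun h => (hs 0).1 (Subtype.ext h)
    have h1 : (s 0 : ℝ) ≠ 1 := fun h => (hs 0).2 (Subtype.ext h)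
    rw [cubeCoord]
    refine Fin.cases ?_ (fun k => ?_) k
    · rw [Fin.cons_zero]; exact sub_ne_zero.2 h1.symm
    · rw [Fin.cons_succ]
      exact mul_ne_zero h0 (cubeCoord_ne_zero m _ (fun i => hs i.succ) k)

/-- The interior of the cube is mapped to the interior of the simplex. -/
theorem mem_boundary_of_cubeToSimplex {m : ℕ} {s : Fin (m + 1) → I}
    (hs : cubeToSimplex (m + 1) s ∈ skeleton (m + 1) (m + 1)) :
    s ∈ Cube.boundary (Fin (m + 1)) := by
  by_contra h
  have h1 : simplexSupport (cubeToSimplex (m + 1) s) = Finset.univ := by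
    ext k
    simp only [mem_simplexSupport, Finset.mem_univ, iff_true]
    refine cubeCoord_ne_zero _ s (fun i => ?_) k
    constructor
    · exact fun h0 => h ⟨i, Or.inl h0⟩
    · exact fun h0 => h ⟨i, Or.inr h0⟩
  have : (simplexSupport (cubeToSimplex (m + 1) s)).card ≤ m + 1 := hs
  rw [h1, Finset.card_univ, Fintype.card_fin] at this
  omega

/-- The map from the cube to the simplex is injective away from the faces that it collapses. -/
theorem cubeCoord_injective : ∀ (m : ℕ) (s s' : Fin m → I), (∀ i, s i ≠ 0) →
    cubeCoord m s = cubeCoord m s' → s = s'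
  | 0, _, _, _, _ => Subsingleton.elim _ _
  | m + 1, s, s', hs, h => by
    have h0 := congrFun h 0
    simp only [cubeCoord, Fin.cons_zero] at h0
    have h1 : (s 0 : ℝ) = s' 0 := by linarith
    have hne : (s 0 : ℝ) ≠ 0 := fun h => hs 0 (Subtype.ext h)
    have h2 : Fin.tail s = Fin.tail s' := by
      refine cubeCoord_injective m _ _ (fun i => hs i.succ) (funext fun k => ?_)
      have := congrFun h k.succ
      simp only [cubeCoord, Fin.cons_succ, ← h1] at this
      exact mul_left_cancel₀ hne this
    rw [← Fin.cons_self_tail s, ← Fin.cons_self_tail s', h2, Subtype.ext h1]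

theorem cubeCoord_surjective : ∀ (m : ℕ) (x : Fin (m + 1) → ℝ), (∀ k, 0 ≤ x k) → ∑ k, x k = 1 →
    ∃ s, cubeCoord m s = x
  | 0, x, _, h => ⟨0, funext fun k => by
      rw [Fin.sum_univ_one] at h
      obtain rfl : k = 0 := Fin.ext (by omega)
      rw [h]; rfl⟩
  | m + 1, x, h0, h => by
    rw [Fin.sum_univ_succ] at h
    have hs : 0 ≤ ∑ k : Fin (m + 1), x k.succ := Finset.sum_nonneg fun k _ => h0 _
    have hx0 := h0 0
    let a : I := ⟨1 - x 0, by linarith, by linarith⟩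
    by_cases ha : 1 - x 0 = 0
    · refine ⟨Fin.cons a 0, funext fun k => ?_⟩
      have hz : ∀ k : Fin (m + 1), x k.succ = 0 := fun k =>
        (Finset.sum_eq_zero_iff_of_nonneg fun k _ => h0 k.succ).1 (by linarith) k
          (Finset.mem_univ _)
      rw [cubeCoord]
      refine Fin.cases ?_ (fun k => ?_) k
      · simp [a]
      · simp [a, ha, hz]
    · have hpos : 0 < 1 - x 0 := lt_of_le_of_ne (by linarith) (Ne.symm ha)
      obtain ⟨s, hs⟩ := cubeCoord_surjective m (fun k => x k.succ / (1 - x 0))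
        (fun k => div_nonneg (h0 _) hpos.le) (by
          rw [← Finset.sum_div, div_eq_one_iff_eq ha]; linarith)
      refine ⟨Fin.cons a s, funext fun k => ?_⟩
      rw [cubeCoord]
      refine Fin.cases ?_ (fun k => ?_) k
      · simp [a]
      · simp only [Fin.cons_succ, Fin.cons_zero, Fin.tail_cons, hs, a]
        field_simp

theorem cubeToSimplex_surjective (m : ℕ) : Function.Surjective (cubeToSimplex m) := fun x => by
  obtain ⟨s, hs⟩ := cubeCoord_surjective m x (stdSimplex.zero_le x) (stdSimplex.sum_eq_one x)
  exact ⟨s, stdSimplex.ext hs⟩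

/-- A map on the cube descends to the simplex if it does so on the boundary. -/
theorem exists_descend {E : Type*} [TopologicalSpace E] {m : ℕ} (e : C(Fin (m + 1) → I, E))
    (κ₀ : stdSimplex ℝ (Fin (m + 2)) → E)
    (h : ∀ s ∈ Cube.boundary (Fin (m + 1)), e s = κ₀ (cubeToSimplex (m + 1) s)) :
    ∃ κ : C(stdSimplex ℝ (Fin (m + 2)), E), κ.comp (cubeToSimplex (m + 1)) = e ∧
      Set.EqOn κ κ₀ (skeleton (m + 1) (m + 1)) := by
  choose r hr using cubeToSimplex_surjective (m + 1)
  have hκ : ∀ s, e (r (cubeToSimplex (m + 1) s)) = e s := fun s => by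
    by_cases hs : s ∈ Cube.boundary (Fin (m + 1))
    · have h1 : r (cubeToSimplex (m + 1) s) ∈ Cube.boundary (Fin (m + 1)) :=
        mem_boundary_of_cubeToSimplex (by rw [hr]; exact cubeToSimplex_boundary hs)
      rw [h _ h1, hr, h _ hs]
    · congr 1
      refine (cubeCoord_injective _ _ _ (fun i hi => hs ⟨i, Or.inl hi⟩) ?_).symm
      exact (congrArg (fun x : stdSimplex ℝ (Fin (m + 2)) => (x : Fin (m + 2) → ℝ))
        (hr (cubeToSimplex (m + 1) s))).symm
  have hquot : Topology.IsQuotientMap (cubeToSimplex (m + 1)) :=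
    (cubeToSimplex (m + 1)).continuous.isClosedMap.isQuotientMap
      (cubeToSimplex (m + 1)).continuous (cubeToSimplex_surjective _)
  refine ⟨⟨fun x => e (r x), hquot.continuous_iff.2 ?_⟩, ContinuousMap.ext hκ, fun x hx => ?_⟩
  · convert e.continuous using 1
    exact funext hκ
  · obtain ⟨s, rfl⟩ := cubeToSimplex_surjective _ x
    exact (hκ s).trans (h s (mem_boundary_of_cubeToSimplex hx))

end Simplex

/-! ### Normalized cochains on the nerve -/

section AltProd

variable {G : Type*} [CommGroup G]

/-- The alternating product of finitely many elements of a commutative group. -/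
def altProd {m : ℕ} (X : Fin m → G) : G := ∏ j, X j ^ ((-1 : ℤ) ^ (j : ℕ))

theorem altProd_eq_faceProd {m : ℕ} (X : Fin m → G) :
    altProd X = faceProd fun j δ => cond δ (X j) 1 := by
  simp [altProd, faceProd]

/-- The double alternating product over the faces of codimension two of a simplex is trivial. -/
theorem altProd_altProd {m : ℕ} (X : Fin (m + 2) → Fin (m + 1) → G)
    (h : ∀ i j, X (i.succAbove j) (j.predAbove i) = X i j) :
    altProd (fun i => altProd (X i)) = 1 := by
  have h1 : altProd (fun i => altProd (X i)) =
      faceProd fun i ε => faceProd fun j δ => cond ε (cond δ (X i j) 1) 1 := by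
    rw [altProd_eq_faceProd]
    congr 1
    funext i ε
    cases ε
    · simp [faceProd]
    · exact altProd_eq_faceProd _
  rw [h1]
  refine faceProd_faceProd _ fun i ε j δ => ?_
  cases ε <;> cases δ <;> simp [h]

theorem altProd_eq_one_of_adjacent {m : ℕ} (X : Fin (m + 1) → G) (i : Fin m)
    (h : ∀ j, j ≠ i.castSucc → j ≠ i.succ → X j = 1) (hi : X i.castSucc = X i.succ) :
    altProd X = 1 := by
  have hne : i.castSucc ≠ i.succ := (Fin.castSucc_lt_succ).ne
  rw [altProd, Finset.prod_eq_mul i.castSucc i.succ hne]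
  · rw [hi]
    simp only [Fin.val_castSucc, Fin.val_succ, pow_succ, mul_neg, mul_one, zpow_neg]
    exact mul_inv_cancel _
  · rintro j - ⟨h1, h2⟩
    rw [h _ h1 h2, one_zpow]
  · simp
  · simp

theorem map_altProd {H : Type*} [CommGroup H] (φ : G →* H) {m : ℕ} (X : Fin m → G) :
    φ (altProd X) = altProd fun j => φ (X j) := by
  simp [altProd]

theorem altProd_mul {m : ℕ} (X Y : Fin m → G) :
    altProd (fun j => X j * Y j) = altProd X * altProd Y := by
  simp [altProd, mul_zpow, Finset.prod_mul_distrib]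

theorem altProd_inv {m : ℕ} (X : Fin m → G) : altProd (fun j => (X j)⁻¹) = (altProd X)⁻¹ := by
  simp [altProd]

theorem altProd_zpow {m : ℕ} (X : Fin m → G) (k : ℤ) :
    altProd (fun j => X j ^ k) = altProd X ^ k := by
  simp only [altProd, ← Finset.prod_zpow, ← zpow_mul, mul_comm]

end AltProd

section Nerve

theorem val_succAbove {n : ℕ} (i : Fin (n + 1)) (j : Fin n) :
    (i.succAbove j : ℕ) = if (j : ℕ) < i then (j : ℕ) else j + 1 := by
  simp only [Fin.succAbove, Fin.lt_def, Fin.val_castSucc]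
  split_ifs <;> rfl

theorem val_predAbove {n : ℕ} (i : Fin n) (j : Fin (n + 1)) :
    (i.predAbove j : ℕ) = if (i : ℕ) < j then (j : ℕ) - 1 else j := by
  simp only [Fin.predAbove, Fin.lt_def, Fin.val_castSucc]
  split_ifs <;> rfl

variable {C : Type w} [Category.{v} C]

/-- The simplex `θ^* τ` of the nerve. -/
abbrev nervePull {m l : ℕ} (θ : Fin (m + 1) →o Fin (l + 1)) (τ : Fin (l + 1) ⥤ C) :
    Fin (m + 1) ⥤ C := θ.monotone.functor ⋙ τ

/-- The inclusion of the face opposite to the vertex `k`. -/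
def coface {m : ℕ} (k : Fin (m + 2)) : Fin (m + 1) →o Fin (m + 2) :=
  ⟨k.succAbove, (Fin.strictMono_succAbove k).monotone⟩

/-- The degeneracy that takes the value `i` twice. -/
def codegen {m : ℕ} (i : Fin (m + 1)) : Fin (m + 2) →o Fin (m + 1) :=
  ⟨i.predAbove, Fin.predAbove_right_monotone i⟩

@[simp] theorem coface_apply {m : ℕ} (k : Fin (m + 2)) (j : Fin (m + 1)) :
    coface k j = k.succAbove j := rfl

@[simp] theorem codegen_apply {m : ℕ} (i : Fin (m + 1)) (j : Fin (m + 2)) :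
    codegen i j = i.predAbove j := rfl

theorem coface_comp_coface {m : ℕ} (i : Fin (m + 3)) (j : Fin (m + 2)) :
    (coface (i.succAbove j)).comp (coface (j.predAbove i)) = (coface i).comp (coface j) := by
  ext1; funext k
  exact Fin.succAbove_succAbove_succAbove_predAbove i j k

theorem codegen_comp_coface_castSucc {m : ℕ} (i : Fin (m + 1)) :
    (codegen i).comp (coface i.castSucc) = OrderHom.id := by
  ext1; funext k
  simp

theorem codegen_comp_coface_succ {m : ℕ} (i : Fin (m + 1)) :
    (codegen i).comp (coface i.succ) = OrderHom.id := by
  ext1; funext k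
  simp only [OrderHom.comp_coe, Function.comp_apply, coface_apply, codegen_apply, Fin.ext_iff,
    val_succAbove, val_predAbove, Fin.val_succ, OrderHom.id_coe, id_eq]
  split_ifs <;> omega

/-- A map that takes the same value at `i` and `i + 1` factors through the degeneracy. -/
theorem comp_coface_comp_codegen {m l : ℕ} (θ : Fin (m + 2) →o Fin (l + 1)) (i : Fin (m + 1))
    (h : θ i.castSucc = θ i.succ) : (θ.comp (coface i.castSucc)).comp (codegen i) = θ := by
  ext1; funext k
  simp only [OrderHom.comp_coe, Function.comp_apply, coface_apply, codegen_apply]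
  by_cases hk : k = i.castSucc
  · subst hk; simp [h]
  · congr 1
    rw [Fin.ext_iff] at hk ⊢
    simp only [val_succAbove, val_predAbove, Fin.val_castSucc] at hk ⊢
    split_ifs <;> omega

theorem comp_coface_castSucc_eq {m l : ℕ} (θ : Fin (m + 2) →o Fin (l + 1)) (i : Fin (m + 1))
    (h : θ i.castSucc = θ i.succ) :
    θ.comp (coface i.castSucc) = θ.comp (coface i.succ) := by
  conv_rhs => rw [← comp_coface_comp_codegen θ i h]
  rw [OrderHom.comp_assoc, codegen_comp_coface_succ]; rfl

end Nerve

section Normalized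

variable {C : Type w} [Category.{v} C]

/-- The edge from the first vertex of `τ` to the first vertex of `θ^* τ`. -/
def nerveEdge {m l : ℕ} (θ : Fin (m + 1) →o Fin (l + 1)) (τ : Fin (l + 1) ⥤ C) :
    τ.obj 0 ⟶ (nervePull θ τ).obj 0 :=
  τ.map (homOfLE (Fin.zero_le (θ 0)))

theorem nerveEdge_comp {m k l : ℕ} (τ : Fin (l + 1) ⥤ C)
    (θ : Fin (k + 1) →o Fin (l + 1)) (θ' : Fin (m + 1) →o Fin (k + 1)) :
    nerveEdge θ τ ≫ nerveEdge θ' (nervePull θ τ) = nerveEdge (θ.comp θ') τ := by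
  change τ.map _ ≫ τ.map _ = τ.map _
  rw [← τ.map_comp]
  rfl

/-- A contravariant functor from `C` to groups, with the groups given beforehand. -/
structure NerveCoeff (A : C → Type u) [∀ c, CommGroup (A c)] where
  /-- the map induced by a morphism -/
  map : ∀ {c c' : C}, (c ⟶ c') → A c' →* A c
  map_id : ∀ (c : C) (x : A c), map (𝟙 c) x = x
  map_comp : ∀ {c c' c'' : C} (α : c ⟶ c') (β : c' ⟶ c'') (x : A c''),
    map (α ≫ β) x = map α (map β x)

variable {A : C → Type u} [∀ c, CommGroup (A c)]

/-- A cochain is trivial on the simplices that are degenerate at the vertex `i`. -/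
def VanishesAt {m : ℕ} (t : NerveCochain A (m + 1)) (i : Fin (m + 1)) : Prop :=
  ∀ (l : ℕ) (τ : Fin (l + 1) ⥤ C) (θ : Fin (m + 2) →o Fin (l + 1)), θ i.castSucc = θ i.succ →
    t (nervePull θ τ) = 1

namespace NerveCoeff

variable (φ : NerveCoeff A)

/-- The value of a cochain on `θ^* τ`, as an element of the group at the first vertex of `τ`. -/
def eval {m l : ℕ} (t : NerveCochain A m) (τ : Fin (l + 1) ⥤ C)
    (θ : Fin (m + 1) →o Fin (l + 1)) : A (τ.obj 0) :=
  φ.map (nerveEdge θ τ) (t (nervePull θ τ))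

/-- The coboundary of a cochain. -/
def coboundary {m : ℕ} (t : NerveCochain A m) : NerveCochain A (m + 1) := fun ν =>
  altProd fun k => φ.eval t ν (coface k)

/-- The coboundary agrees with the one defined by products of lists. -/
theorem nerveCoboundary_eq {m : ℕ} (t : NerveCochain A m) :
    nerveCoboundary (fun α x => φ.map α x) t = φ.coboundary t := by
  funext ν
  rw [nerveCoboundary, List.prod_ofFn]
  rfl

/-- Evaluation is compatible with passing to `θ^* τ`. -/
theorem map_eval {m k l : ℕ} (t : NerveCochain A m) (τ : Fin (l + 1) ⥤ C)
    (θ : Fin (k + 1) →o Fin (l + 1)) (θ' : Fin (m + 1) →o Fin (k + 1)) :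
    φ.map (nerveEdge θ τ) (φ.eval t (nervePull θ τ) θ') = φ.eval t τ (θ.comp θ') :=
  (φ.map_comp _ _ _).symm.trans
    (congrArg (fun f => φ.map f (t (nervePull (θ.comp θ') τ))) (nerveEdge_comp τ θ θ'))

/-- If `θ` fixes the first vertex, the map along the edge from `τ 0` to `(θ^* τ) 0` is injective,
since the two objects are equal and the edge is an identity. -/
theorem eq_one_of_map_eq_one {m l : ℕ} (τ : Fin (l + 1) ⥤ C) (θ : Fin (m + 1) →o Fin (l + 1))
    (h : θ 0 = 0) (x : A ((nervePull θ τ).obj 0)) (hx : φ.map (nerveEdge θ τ) x = 1) : x = 1 := by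
  have : ∀ (a : Fin (l + 1)) (_ : a = 0) (f : 0 ⟶ a) (x : A (τ.obj a)), φ.map (τ.map f) x = 1 →
      x = 1 := by
    rintro a rfl f x hx
    obtain rfl : f = 𝟙 _ := Subsingleton.elim _ _
    rwa [τ.map_id, φ.map_id] at hx
  exact this _ h _ x hx

theorem coboundary_mul {m : ℕ} (t t' : NerveCochain A m) :
    φ.coboundary (fun ν => t ν * t' ν) = fun ν => φ.coboundary t ν * φ.coboundary t' ν := by
  funext ν
  simp only [coboundary, eval, map_mul, altProd_mul]

theorem coboundary_inv {m : ℕ} (t : NerveCochain A m) :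
    φ.coboundary (fun ν => (t ν)⁻¹) = fun ν => (φ.coboundary t ν)⁻¹ := by
  funext ν
  simp only [coboundary, eval, map_inv, altProd_inv]

theorem eval_coboundary {m l : ℕ} (t : NerveCochain A m) (τ : Fin (l + 1) ⥤ C)
    (θ : Fin (m + 2) →o Fin (l + 1)) :
    φ.eval (φ.coboundary t) τ θ = altProd fun k => φ.eval t τ (θ.comp (coface k)) := by
  rw [eval, coboundary, map_altProd]
  simp only [map_eval]

theorem coboundary_coboundary {m : ℕ} (t : NerveCochain A m) (ν : Fin (m + 3) ⥤ C) :
    φ.coboundary (φ.coboundary t) ν = 1 := by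
  rw [coboundary]
  simp only [eval_coboundary]
  refine altProd_altProd _ fun i j => ?_
  rw [coface_comp_coface]

set_option linter.unusedSimpArgs false in
/-- If a cochain is trivial on the simplices degenerate at a vertex before `i` and its coboundary is
trivial on degenerate simplices, one can make it trivial on the simplices degenerate at `i`, too. -/
theorem exists_vanishesAt_step {m : ℕ} (t : NerveCochain A (m + 1)) (i : Fin (m + 1))
    (ht : ∀ k < i, VanishesAt t k)
    (hδ : ∀ k, VanishesAt (φ.coboundary t) k) :
    ∃ t' : NerveCochain A (m + 1), φ.coboundary t' = φ.coboundary t ∧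
      ∀ k ≤ i, VanishesAt t' k := by
  -- The cochain `t` is divided by the coboundary of `h`, which is, up to sign, the restriction of
  -- `t` to the `i`-th degeneracies.
  let h : NerveCochain A m := fun ν =>
    (φ.eval t ν (codegen i)) ^ ((-1 : ℤ) ^ (i : ℕ))
  have hev : ∀ {l : ℕ} (τ : Fin (l + 1) ⥤ C) (θ : Fin (m + 1) →o Fin (l + 1)),
      φ.eval h τ θ = φ.eval t τ (θ.comp (codegen i)) ^ ((-1 : ℤ) ^ (i : ℕ)) := by
    intro l τ θ
    change φ.map (nerveEdge θ τ)
      ((φ.eval t (nervePull θ τ) (codegen i)) ^ ((-1 : ℤ) ^ (i : ℕ))) = _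
    rw [map_zpow, map_eval]
  have ht1 : ∀ {l : ℕ} (τ : Fin (l + 1) ⥤ C) (k : Fin (m + 1)) (θ : Fin (m + 2) →o Fin (l + 1)),
      k < i → θ k.castSucc = θ k.succ → φ.eval t τ θ = 1 := by
    intro l τ k θ hk hθ
    rw [eval, ht k hk l τ θ hθ, map_one]
  -- a coincidence at `p < i` survives the composition with the `i`-th degeneracy
  have hlow : ∀ {l : ℕ} (τ : Fin (l + 1) ⥤ C) (θ : Fin (m + 1) →o Fin (l + 1)) (p : ℕ)
      (hp : p < i), θ ⟨p, by omega⟩ = θ ⟨p + 1, by omega⟩ →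
      φ.eval t τ (θ.comp (codegen i)) = 1 := by
    intro l τ θ p hp hθ
    refine ht1 τ ⟨p, by omega⟩ _ hp ?_
    have h1 : codegen i (Fin.castSucc ⟨p, by omega⟩) = (⟨p, by omega⟩ : Fin (m + 1)) := by
      rw [Fin.ext_iff]
      simp only [codegen_apply, val_succAbove, val_predAbove, Fin.val_castSucc, Fin.val_succ]
      split_ifs <;> omega
    have h2 : codegen i (Fin.succ ⟨p, by omega⟩) = (⟨p + 1, by omega⟩ : Fin (m + 1)) := by
      rw [Fin.ext_iff]
      simp only [codegen_apply, val_succAbove, val_predAbove, Fin.val_castSucc, Fin.val_succ]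
      split_ifs <;> omega
    simp only [OrderHom.comp_coe, Function.comp_apply, h1, h2, hθ]
  have key : ∀ {l : ℕ} (τ : Fin (l + 1) ⥤ C) (k : Fin (m + 1)) (θ : Fin (m + 2) →o Fin (l + 1)),
      k ≤ i → θ k.castSucc = θ k.succ →
      altProd (fun j => φ.eval h τ (θ.comp (coface j))) = φ.eval t τ θ := by
    intro l τ k θ hk hθ
    simp only [hev]
    rcases hk.lt_or_eq with hk | rfl
    · rw [ht1 τ k θ hk hθ]
      refine altProd_eq_one_of_adjacent _ k (fun j h1 h2 => ?_) ?_
      · have hlt : (k : ℕ) < i := hk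
        have h1' : (j : ℕ) ≠ k := fun h => h1 (Fin.ext h)
        have h2' : (j : ℕ) ≠ k + 1 := fun h => h2 (Fin.ext h)
        rcases lt_or_gt_of_ne h1' with hj | hj
        · rw [hlow τ _ (k - 1) (by omega), one_zpow]
          have e1 : j.succAbove ⟨k - 1, by omega⟩ = k.castSucc := by
            rw [Fin.ext_iff]
            simp only [codegen_apply, val_succAbove, val_predAbove, Fin.val_castSucc, Fin.val_succ]
            split_ifs <;> omega
          have e2 : j.succAbove ⟨k - 1 + 1, by omega⟩ = k.succ := by
            rw [Fin.ext_iff]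
            simp only [codegen_apply, val_succAbove, val_predAbove, Fin.val_castSucc, Fin.val_succ]
            split_ifs <;> omega
          simp only [OrderHom.comp_coe, Function.comp_apply, coface_apply, e1, e2, hθ]
        · rw [hlow τ _ k (by omega), one_zpow]
          have e1 : j.succAbove ⟨k, by omega⟩ = k.castSucc := by
            rw [Fin.ext_iff]
            simp only [codegen_apply, val_succAbove, val_predAbove, Fin.val_castSucc, Fin.val_succ]
            split_ifs <;> omega
          have e2 : j.succAbove ⟨k + 1, by omega⟩ = k.succ := by
            rw [Fin.ext_iff]
            simp only [codegen_apply, val_succAbove, val_predAbove, Fin.val_castSucc, Fin.val_succ]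
            split_ifs <;> omega
          simp only [OrderHom.comp_coe, Function.comp_apply, coface_apply, e1, e2, hθ]
      · rw [comp_coface_castSucc_eq θ k hθ]
    · -- compare with the coboundary on the doubly degenerate simplex
      have h0 : φ.eval (φ.coboundary t) τ (θ.comp (codegen k.castSucc)) = 1 := by
        rw [eval, hδ k.castSucc l τ, map_one]
        simp
      rw [eval_coboundary, altProd,
        Fin.prod_univ_succAbove _ k.castSucc.castSucc] at h0
      -- The `k`-th face is `θ` again. The values on the other faces are either trivial or agree
      -- with those on the degeneracies of the faces of `θ`, with the opposite sign.
      have hX : ∀ j : Fin (m + 2), φ.eval t τ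
          ((θ.comp (codegen k.castSucc)).comp (coface (k.castSucc.castSucc.succAbove j))) ^
            ((-1 : ℤ) ^ (k.castSucc.castSucc.succAbove j : ℕ)) =
          (φ.eval t τ ((θ.comp (coface j)).comp (codegen k)) ^ ((-1 : ℤ) ^ (j : ℕ)))⁻¹ := by
        intro j
        by_cases hj : (j : ℕ) < k
        · rw [hlow τ _ (k - 1) (by omega), ht1 τ ⟨k - 1, by omega⟩ _ (by
            rw [Fin.lt_def]; change (k : ℕ) - 1 < k; omega)]
          · simp
          · have e0 : k.castSucc.castSucc.succAbove j = j.castSucc := by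
              rw [Fin.ext_iff]
              simp only [codegen_apply, val_succAbove, val_predAbove, Fin.val_castSucc,
                Fin.val_succ]
              split_ifs <;> omega
            rw [e0]
            have e1 : k.castSucc.predAbove (j.castSucc.succAbove (Fin.castSucc ⟨k - 1, by omega⟩)) =
                k.castSucc := by
              rw [Fin.ext_iff]
              simp only [codegen_apply, val_succAbove, val_predAbove, Fin.val_castSucc,
                Fin.val_succ]
              split_ifs <;> omega
            have e2 : k.castSucc.predAbove (j.castSucc.succAbove (Fin.succ ⟨k - 1, by omega⟩)) =
                k.castSucc := by
              rw [Fin.ext_iff]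
              simp only [codegen_apply, val_succAbove, val_predAbove, Fin.val_castSucc,
                Fin.val_succ]
              split_ifs <;> omega
            simp only [OrderHom.comp_coe, Function.comp_apply, coface_apply, codegen_apply, e1, e2]
          · have e1 : j.succAbove ⟨k - 1, by omega⟩ = k.castSucc := by
              rw [Fin.ext_iff]
              simp only [codegen_apply, val_succAbove, val_predAbove, Fin.val_castSucc,
                Fin.val_succ]
              split_ifs <;> omega
            have e2 : j.succAbove ⟨k - 1 + 1, by omega⟩ = k.succ := by
              rw [Fin.ext_iff]
              simp only [codegen_apply, val_succAbove, val_predAbove, Fin.val_castSucc,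
                Fin.val_succ]
              split_ifs <;> omega
            simp only [OrderHom.comp_coe, Function.comp_apply, coface_apply, e1, e2, hθ]
        · have e0 : k.castSucc.castSucc.succAbove j = j.succ := by
            rw [Fin.ext_iff]
            simp only [codegen_apply, val_succAbove, val_predAbove, Fin.val_castSucc, Fin.val_succ]
            split_ifs <;> omega
          have e : (θ.comp (codegen k.castSucc)).comp (coface (k.castSucc.castSucc.succAbove j)) =
              (θ.comp (coface j)).comp (codegen k) := by
            ext1; funext x
            rw [e0]
            simp only [OrderHom.comp_coe, Function.comp_apply, coface_apply, codegen_apply]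
            by_cases hx : k.castSucc.predAbove (j.succ.succAbove x) = j.succAbove (k.predAbove x)
            · rw [hx]
            · have : k.castSucc.predAbove (j.succ.succAbove x) = k.castSucc ∧
                  j.succAbove (k.predAbove x) = k.succ ∨
                  k.castSucc.predAbove (j.succ.succAbove x) = k.succ ∧
                  j.succAbove (k.predAbove x) = k.castSucc := by
                rw [Fin.ext_iff] at hx
                simp only [Fin.ext_iff]
                simp only [val_succAbove, val_predAbove, Fin.val_castSucc, Fin.val_succ] at hx ⊢
                split_ifs at hx ⊢ <;> omega
              rcases this with ⟨h1, h2⟩ | ⟨h1, h2⟩ <;> rw [h1, h2, hθ]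
          rw [e, e0, Fin.val_succ, pow_succ, mul_neg, mul_one, zpow_neg]
      rw [Finset.prod_congr rfl fun j _ => hX j, Finset.prod_inv_distrib, mul_inv_eq_one,
        OrderHom.comp_assoc, codegen_comp_coface_castSucc] at h0
      simp only [Fin.val_castSucc] at h0
      rw [altProd_zpow]
      unfold altProd
      rw [← h0, ← zpow_mul, ← mul_pow]
      simp
  refine ⟨fun ν => t ν * (φ.coboundary h ν)⁻¹, ?_, fun k hk l τ θ hθ => ?_⟩
  · rw [coboundary_mul, coboundary_inv]
    funext ν
    simp only [coboundary_coboundary, inv_one, mul_one]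
  · -- the values on `θ^* τ` are compared in the group at the first vertex of a face of it
    have h1 := key (nervePull (θ.comp (coface k.castSucc)) τ) k (codegen k) hk (by simp)
    have h2 : nervePull (codegen k) (nervePull (θ.comp (coface k.castSucc)) τ) = nervePull θ τ := by
      conv_rhs => rw [← comp_coface_comp_codegen θ k hθ]
      rfl
    rw [← eval_coboundary] at h1
    rw [← h2, mul_inv_eq_one]
    rw [← mul_inv_eq_one]
    refine φ.eq_one_of_map_eq_one (nervePull (θ.comp (coface k.castSucc)) τ) (codegen k)
      (by simp) _ ?_
    rw [map_mul, map_inv, mul_inv_eq_one]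
    exact h1.symm

/-- A normalized cochain that is a coboundary is the coboundary of a normalized cochain. -/
theorem exists_normalized {m : ℕ} (t : NerveCochain A (m + 1))
    (hδ : ∀ k, VanishesAt (φ.coboundary t) k) :
    ∃ t' : NerveCochain A (m + 1), φ.coboundary t' = φ.coboundary t ∧
      ∀ k, VanishesAt t' k := by
  have : ∀ i : ℕ, i ≤ m + 1 → ∃ t' : NerveCochain A (m + 1),
      φ.coboundary t' = φ.coboundary t ∧ ∀ k : Fin (m + 1), (k : ℕ) < i →
        VanishesAt t' k := by
    intro i
    induction i with
    | zero => exact fun _ => ⟨t, rfl, fun k hk => absurd hk (by omega)⟩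
    | succ i ih =>
      intro hi
      obtain ⟨t', h1, h2⟩ := ih (by omega)
      obtain ⟨t'', h3, h4⟩ := φ.exists_vanishesAt_step t' ⟨i, hi⟩
        (fun k hk => h2 k hk) (by rw [h1]; exact hδ)
      exact ⟨t'', h3.trans h1, fun k hk => h4 k (Nat.lt_succ_iff.1 hk)⟩
  obtain ⟨t', h1, h2⟩ := this _ le_rfl
  exact ⟨t', h1, fun k => h2 k k.2⟩

end NerveCoeff

end Normalized

/-! ### Lifts over the skeleta of the nerve -/

section Degenerate

variable {C : Type w} [Category.{v} C]

/-- The monotone map that takes `i + 1` to `i` and fixes the other vertices. -/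
def collapse {m : ℕ} (i : Fin m) : Fin (m + 1) →o Fin (m + 1) where
  toFun j := if j = i.succ then i.castSucc else j
  monotone' j k hjk := by
    rw [Fin.le_def] at hjk ⊢
    simp only [Fin.ext_iff, Fin.val_succ]
    split_ifs <;> (try simp only [Fin.val_castSucc]) <;> omega

theorem val_collapse {m : ℕ} (i : Fin m) (j : Fin (m + 1)) :
    (collapse i j : ℕ) = if (j : ℕ) = i + 1 then (i : ℕ) else j := by
  change ((if j = i.succ then i.castSucc else j : Fin (m + 1)) : ℕ) = _
  simp only [Fin.ext_iff, Fin.val_succ]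
  split_ifs <;> rfl

theorem collapse_zero {m : ℕ} (i : Fin m) : collapse i 0 = 0 := by
  rw [Fin.ext_iff, val_collapse]
  simp

theorem comp_collapse {m l : ℕ} (θ : Fin (m + 1) →o Fin (l + 1)) (i : Fin m)
    (h : θ i.castSucc = θ i.succ) : θ.comp (collapse i) = θ := by
  ext1; funext j
  change θ (if j = i.succ then i.castSucc else j) = θ j
  split_ifs with hj
  · rw [h, hj]
  · rfl

/-- The relation by which the two ways of lifting a simplex that is degenerate at `i` and at `k`
agree. -/
theorem collapse_comp_collapse_comp_collapse {m : ℕ} {i k : Fin m} (h : i ≤ k) :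
    ((collapse i).comp (collapse k)).comp (collapse i) = (collapse i).comp (collapse k) := by
  ext1; funext j
  rw [Fin.le_def] at h
  simp only [OrderHom.comp_coe, Function.comp_apply, Fin.ext_iff, val_collapse]
  split_ifs <;> omega

theorem collapse_mem_skeleton {m : ℕ} (i : Fin m) (x : stdSimplex ℝ (Fin (m + 1))) :
    stdSimplex.map (collapse i) x ∈ skeleton m m := by
  refine map_mem_skeleton_of_card _ ?_ x
  have : Finset.univ.image (collapse i) ⊆ Finset.univ.erase i.succ := fun j hj => by
    obtain ⟨k, -, rfl⟩ := Finset.mem_image.1 hj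
    refine Finset.mem_erase.2 ⟨fun h => ?_, Finset.mem_univ _⟩
    rw [Fin.ext_iff, val_collapse, Fin.val_succ] at h
    split_ifs at h <;> omega
  simpa using Finset.card_le_card this

/-- A simplex of the nerve is degenerate if it is pulled back from itself along a collapse. -/
def IsDegenerate {m : ℕ} (τ : Fin (m + 1) ⥤ C) : Prop :=
  ∃ i : Fin m, nervePull (collapse i) τ = τ

theorem nervePull_collapse {m l : ℕ} (θ : Fin (m + 1) →o Fin (l + 1)) (τ : Fin (l + 1) ⥤ C)
    (i : Fin m) (h : θ i.castSucc = θ i.succ) :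
    nervePull (collapse i) (nervePull θ τ) = nervePull θ τ := by
  conv_rhs => rw [← comp_collapse θ i h]
  rfl

/-- If `θ` fixes the first vertex, the edge between the first vertices of `τ` and `θ^* τ` is an
identity. -/
theorem nerveEdge_eq_eqToHom {m l : ℕ} (θ : Fin (m + 1) →o Fin (l + 1)) (τ : Fin (l + 1) ⥤ C)
    (h : τ.obj 0 = (nervePull θ τ).obj 0) (h0 : θ 0 = 0) : nerveEdge θ τ = eqToHom h := by
  have : ∀ (a : Fin (l + 1)) (_ : a = 0) (f : 0 ⟶ a) (h : τ.obj 0 = τ.obj a),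
      τ.map f = eqToHom h := by
    rintro a rfl f h
    obtain rfl : f = 𝟙 _ := Subsingleton.elim _ _
    simp
  exact this _ h0 _ h

end Degenerate

/-- Over a category, a diagram of fibrations `q c : E c → B c` with simple fibres, together with
compatible simplices `b τ` in the bases, one for each simplex `τ` of the nerve, and with lifts `g c`
of their vertices. Morphisms act contravariantly. -/
structure LiftSystem {C : Type w} [Category.{v} C] (E : C → Type u) (B : C → Type y)
    (A : C → Type z) [∀ c, TopologicalSpace (E c)] [∀ c, TopologicalSpace (B c)]
    [∀ c, TopologicalSpace (A c)] where
  /-- the fibrations -/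
  q : ∀ c, C(E c, B c)
  /-- the action of morphisms on the total spaces -/
  pullE : ∀ {c c' : C}, (c ⟶ c') → C(E c', E c)
  /-- the action of morphisms on the bases -/
  pullB : ∀ {c c' : C}, (c ⟶ c') → C(B c', B c)
  pullE_id : ∀ c e, pullE (𝟙 c) e = e
  pullE_comp : ∀ {c c' c'' : C} (α : c ⟶ c') (β : c' ⟶ c'') e,
    pullE (α ≫ β) e = pullE α (pullE β e)
  pullB_id : ∀ c e, pullB (𝟙 c) e = e
  q_pullE : ∀ {c c' : C} (α : c ⟶ c') e, q c (pullE α e) = pullB α (q c' e)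
  /-- the inclusions of the fibres -/
  ι : ∀ c, C(A c, E c)
  /-- the base points of the fibres -/
  base : ∀ c, A c
  fibration : ∀ c, IsSimpleFibration (q c) (ι c) (base c)
  /-- the simplices in the bases -/
  b : ∀ {m : ℕ} (τ : Fin (m + 1) ⥤ C), C(stdSimplex ℝ (Fin (m + 1)), B (τ.obj 0))
  b_map : ∀ {m l : ℕ} (θ : Fin (m + 1) →o Fin (l + 1)) (τ : Fin (l + 1) ⥤ C) x,
    b τ (stdSimplex.map θ x) = pullB (nerveEdge θ τ) (b (nervePull θ τ) x)
  /-- the lifts of the vertices -/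
  g : ∀ c, E c
  q_g : ∀ (τ : Fin (0 + 1) ⥤ C) x, q _ (g (τ.obj 0)) = b τ x

namespace LiftSystem

variable {C : Type w} [Category.{v} C] {E : C → Type u} {B : C → Type y}
    {A : C → Type z} [∀ c, TopologicalSpace (E c)] [∀ c, TopologicalSpace (B c)]
    [∀ c, TopologicalSpace (A c)] (S : LiftSystem E B A)

/-- Compatible lifts of the simplices `b τ` over their `(n - 1)`-skeleta. The values away from the
skeleta are irrelevant. -/
structure PartialLift (n : ℕ) where
  /-- the lifts -/
  e : ∀ {m : ℕ} (τ : Fin (m + 1) ⥤ C), stdSimplex ℝ (Fin (m + 1)) → E (τ.obj 0)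
  continuousOn : ∀ {m : ℕ} (τ : Fin (m + 1) ⥤ C), ContinuousOn (e τ) (skeleton n m)
  q_e : ∀ {m : ℕ} (τ : Fin (m + 1) ⥤ C), ∀ x ∈ skeleton n m, S.q _ (e τ x) = S.b τ x
  e_map : ∀ {m l : ℕ} (θ : Fin (m + 1) →o Fin (l + 1)) (τ : Fin (l + 1) ⥤ C),
    ∀ x ∈ skeleton n m, e τ (stdSimplex.map θ x) = S.pullE (nerveEdge θ τ) (e (nervePull θ τ) x)

theorem b_collapse {m : ℕ} (i : Fin m) (τ : Fin (m + 1) ⥤ C)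
    (h : nervePull (collapse i) τ = τ) (x : stdSimplex ℝ (Fin (m + 1))) :
    S.b τ (stdSimplex.map (collapse i) x) = S.b τ x := by
  have h0 : τ.obj 0 = (nervePull (collapse i) τ).obj 0 := by rw [h]
  rw [S.b_map, nerveEdge_eq_eqToHom _ _ h0 (collapse_zero i)]
  have : ∀ (τ' : Fin (m + 1) ⥤ C) (_ : τ' = τ) (h0 : τ.obj 0 = τ'.obj 0),
      S.pullB (eqToHom h0) (S.b τ' x) = S.b τ x := by
    rintro τ' rfl h0
    exact S.pullB_id _ _
  exact this _ h h0

namespace PartialLift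

variable {S} {n : ℕ} (P : S.PartialLift n)

/-- Forgetting the lifts of the simplices of the highest dimension. -/
def restrict {n' : ℕ} (h : n' ≤ n) : S.PartialLift n' where
  e := P.e
  continuousOn τ := (P.continuousOn τ).mono (skeleton_mono h)
  q_e τ x hx := P.q_e τ x (skeleton_mono h hx)
  e_map θ τ x hx := P.e_map θ τ x (skeleton_mono h hx)

theorem e_collapse {m : ℕ} (i : Fin m) (τ : Fin (m + 1) ⥤ C)
    (h : nervePull (collapse i) τ = τ) {x : stdSimplex ℝ (Fin (m + 1))} (hx : x ∈ skeleton n m) :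
    P.e τ (stdSimplex.map (collapse i) x) = P.e τ x := by
  have h0 : τ.obj 0 = (nervePull (collapse i) τ).obj 0 := by rw [h]
  rw [P.e_map _ _ _ hx, nerveEdge_eq_eqToHom _ _ h0 (collapse_zero i)]
  have : ∀ (τ' : Fin (m + 1) ⥤ C) (_ : τ' = τ) (h0 : τ.obj 0 = τ'.obj 0),
      S.pullE (eqToHom h0) (P.e τ' x) = P.e τ x := by
    rintro τ' rfl h0
    exact S.pullE_id _ _
  exact this _ h h0

theorem map_map {k m l : ℕ} (θ : Fin (k + 1) →o Fin (m + 1)) (θ' : Fin (m + 1) →o Fin (l + 1))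
    (x : stdSimplex ℝ (Fin (k + 1))) :
    stdSimplex.map θ' (stdSimplex.map θ x) = stdSimplex.map (θ'.comp θ) x :=
  stdSimplex.map_comp_apply _ _ _

/-- If a simplex is degenerate in several ways, the resulting lifts agree. -/
theorem e_collapse_eq (τ : Fin (n + 1) ⥤ C) {i k : Fin n}
    (hi : nervePull (collapse i) τ = τ) (hk : nervePull (collapse k) τ = τ)
    (x : stdSimplex ℝ (Fin (n + 1))) :
    P.e τ (stdSimplex.map (collapse i) x) = P.e τ (stdSimplex.map (collapse k) x) := by
  wlog h : i ≤ k generalizing i k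
  · exact (this hk hi (le_of_not_ge h)).symm
  have h1 := P.e_collapse i τ hi (collapse_mem_skeleton k x)
  have h2 := P.e_collapse k τ hk (collapse_mem_skeleton i x)
  have h3 := P.e_collapse i τ hi (map_mem_skeleton (collapse k) (collapse_mem_skeleton i x))
  rw [← h1, ← h2, ← h3]
  simp only [map_map]
  rw [← OrderHom.comp_assoc, collapse_comp_collapse_comp_collapse h]

theorem continuous_e_map {m l : ℕ} (τ : Fin (l + 1) ⥤ C) (θ : Fin (m + 1) →o Fin (l + 1))
    (h : ∀ x, stdSimplex.map θ x ∈ skeleton n l) :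
    Continuous fun x : stdSimplex ℝ (Fin (m + 1)) => P.e τ (stdSimplex.map θ x) :=
  (P.continuousOn τ).comp_continuous (stdSimplex.continuous_map _) h

open Classical in
/-- The lifts of all `n`-simplices, given lifts of the non-degenerate ones. -/
def filler (κ : ∀ τ : Fin (n + 1) ⥤ C, ¬ IsDegenerate τ →
    C(stdSimplex ℝ (Fin (n + 1)), E (τ.obj 0))) (τ : Fin (n + 1) ⥤ C) :
    C(stdSimplex ℝ (Fin (n + 1)), E (τ.obj 0)) :=
  if h : IsDegenerate τ then ⟨_, P.continuous_e_map τ (collapse h.choose)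
    (collapse_mem_skeleton _)⟩ else κ τ h

section Extend

variable (κ : ∀ τ : Fin (n + 1) ⥤ C, ¬ IsDegenerate τ →
    C(stdSimplex ℝ (Fin (n + 1)), E (τ.obj 0)))

theorem filler_eq {τ : Fin (n + 1) ⥤ C} {i : Fin n} (hi : nervePull (collapse i) τ = τ)
    (x : stdSimplex ℝ (Fin (n + 1))) :
    P.filler κ τ x = P.e τ (stdSimplex.map (collapse i) x) := by
  have h : IsDegenerate τ := ⟨i, hi⟩
  rw [filler, dif_pos h]
  exact P.e_collapse_eq τ h.choose_spec hi x

theorem filler_of_not {τ : Fin (n + 1) ⥤ C} (h : ¬ IsDegenerate τ) : P.filler κ τ = κ τ h :=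
  dif_neg h

variable (hq : ∀ τ h x, S.q _ (κ τ h x) = S.b τ x)
  (hκ : ∀ τ h, Set.EqOn (κ τ h) (P.e τ) (skeleton n n))

include hq in
theorem q_filler (τ : Fin (n + 1) ⥤ C) (x : stdSimplex ℝ (Fin (n + 1))) :
    S.q _ (P.filler κ τ x) = S.b τ x := by
  by_cases h : IsDegenerate τ
  · obtain ⟨i, hi⟩ := h
    rw [P.filler_eq κ hi, P.q_e _ _ (collapse_mem_skeleton _ _), S.b_collapse i τ hi]
  · rw [P.filler_of_not κ h, hq]

include hκ in
/-- The fillers extend the given lift, also for degenerate simplices. -/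
theorem filler_eqOn (τ : Fin (n + 1) ⥤ C) {x : stdSimplex ℝ (Fin (n + 1))}
    (hx : x ∈ skeleton n n) : P.filler κ τ x = P.e τ x := by
  by_cases h : IsDegenerate τ
  · obtain ⟨i, hi⟩ := h
    rw [P.filler_eq κ hi, P.e_collapse i τ hi hx]
  · rw [P.filler_of_not κ h, hκ _ _ hx]

open Classical in
/-- The extended lift: an interior point of an `n`-dimensional face is lifted by the filler of that
face. -/
def extendFun {m : ℕ} (τ : Fin (m + 1) ⥤ C) (x : stdSimplex ℝ (Fin (m + 1))) : E (τ.obj 0) :=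
  if h : ∃ (θ : Fin (n + 1) →o Fin (m + 1)) (y : stdSimplex ℝ (Fin (n + 1))),
    StrictMono θ ∧ simplexSupport y = Finset.univ ∧ stdSimplex.map θ y = x
  then S.pullE (nerveEdge h.choose τ) (P.filler κ _ h.choose_spec.choose) else P.e τ x

theorem extendFun_of_mem {m : ℕ} (τ : Fin (m + 1) ⥤ C) {x : stdSimplex ℝ (Fin (m + 1))}
    (hx : x ∈ skeleton n m) : P.extendFun κ τ x = P.e τ x := by
  rw [extendFun, dif_neg]
  rintro ⟨θ, y, hθ, hy, rfl⟩
  have h1 : (simplexSupport (stdSimplex.map θ y)).card ≤ n := hx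
  rw [simplexSupport_map, Finset.card_image_of_injective _ hθ.injective, hy, Finset.card_univ,
    Fintype.card_fin] at h1
  omega

include hκ in
/-- The extended lift is natural for all maps into a simplex, not only for the inclusions of faces:
a map that is not injective factors through a simplex of smaller dimension. -/
theorem extendFun_map {m : ℕ} (τ : Fin (m + 1) ⥤ C) (θ : Fin (n + 1) →o Fin (m + 1))
    (y : stdSimplex ℝ (Fin (n + 1))) :
    P.extendFun κ τ (stdSimplex.map θ y) =
      S.pullE (nerveEdge θ τ) (P.filler κ (nervePull θ τ) y) := by
  by_cases hθ : StrictMono θ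
  · by_cases hy : y ∈ skeleton n n
    · rw [P.extendFun_of_mem κ τ (map_mem_skeleton θ hy), P.e_map θ τ y hy,
        P.filler_eqOn κ hκ _ hy]
    · have hy' : simplexSupport y = Finset.univ := by
        rw [← Finset.card_eq_iff_eq_univ, Fintype.card_fin]
        have h1 : ¬ (simplexSupport y).card ≤ n := hy
        have h2 := (simplexSupport y).card_le_univ
        rw [Fintype.card_fin] at h2
        omega
      have h : ∃ (θ' : Fin (n + 1) →o Fin (m + 1)) (y' : stdSimplex ℝ (Fin (n + 1))),
          StrictMono θ' ∧ simplexSupport y' = Finset.univ ∧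
            stdSimplex.map θ' y' = stdSimplex.map θ y := ⟨θ, y, hθ, hy', rfl⟩
      rw [extendFun, dif_pos h]
      obtain ⟨h1, h2, h3⟩ := h.choose_spec.choose_spec
      obtain ⟨h4, h5⟩ := map_eq_map_iff h1 hθ h2 hy' h3
      have h6 : ∀ θ' (_ : θ' = θ) y' (_ : y' = y),
          S.pullE (nerveEdge θ' τ) (P.filler κ (nervePull θ' τ) y') =
            S.pullE (nerveEdge θ τ) (P.filler κ (nervePull θ τ) y) := by
        rintro _ rfl _ rfl; rfl
      exact h6 _ h4 _ h5
  · -- the map factors through a collapse, and the filler is determined by the lower skeleton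
    obtain ⟨i, hi⟩ : ∃ i : Fin n, θ i.castSucc = θ i.succ := by
      by_contra! h
      exact hθ (Fin.strictMono_iff_lt_succ.2 fun i =>
        lt_of_le_of_ne (θ.monotone Fin.castSucc_lt_succ.le) (h i))
    have h1 : stdSimplex.map θ y = stdSimplex.map θ (stdSimplex.map (collapse i) y) := by
      rw [map_map, comp_collapse θ i hi]
    have h2 := collapse_mem_skeleton i y
    rw [h1, P.extendFun_of_mem κ τ (map_mem_skeleton θ h2), P.e_map θ τ _ h2,
      P.filler_eq κ (nervePull_collapse θ τ i hi)]

/-- The `n`-skeleton is the union of the `(n - 1)`-skeleton and the `n`-dimensional faces. -/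
theorem mem_skeleton_succ {m : ℕ} {x : stdSimplex ℝ (Fin (m + 1))} (hx : x ∈ skeleton (n + 1) m) :
    x ∈ skeleton n m ∨ ∃ (θ : Fin (n + 1) →o Fin (m + 1)) (y : stdSimplex ℝ (Fin (n + 1))),
      StrictMono θ ∧ stdSimplex.map θ y = x := by
  by_cases h : (simplexSupport x).card ≤ n
  · exact Or.inl h
  · have hx' : (simplexSupport x).card ≤ n + 1 := hx
    obtain ⟨θ, y, h1, -, h2⟩ := exists_map_eq (k := n) x (by omega)
    exact Or.inr ⟨θ, y, h1, h2⟩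

include hκ in
theorem continuousOn_extendFun {m : ℕ} (τ : Fin (m + 1) ⥤ C) :
    ContinuousOn (P.extendFun κ τ) (skeleton (n + 1) m) := by
  let s : Option {θ : Fin (n + 1) →o Fin (m + 1) // StrictMono θ} →
      Set (stdSimplex ℝ (Fin (m + 1))) := fun o =>
    o.elim (skeleton n m) fun θ => Set.range (stdSimplex.map θ.1)
  have hs : skeleton (n + 1) m ⊆ ⋃ o, s o := fun x hx => by
    rcases mem_skeleton_succ hx with h | ⟨θ, y, hθ, rfl⟩
    · exact Set.mem_iUnion.2 ⟨none, h⟩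
    · exact Set.mem_iUnion.2 ⟨some ⟨θ, hθ⟩, y, rfl⟩
  have : Finite {θ : Fin (n + 1) →o Fin (m + 1) // StrictMono θ} :=
    Finite.of_injective (fun θ => (θ.1 : Fin (n + 1) → Fin (m + 1)))
      fun _ _ h => Subtype.ext (DFunLike.coe_injective h)
  have hcl : ∀ θ : {θ : Fin (n + 1) →o Fin (m + 1) // StrictMono θ},
      Topology.IsClosedEmbedding (stdSimplex.map (S := ℝ) θ.1) := fun θ =>
    (stdSimplex.continuous_map _).isClosedEmbedding (stdSimplex_map_injective θ.2.injective)
  refine (LocallyFinite.continuousOn_iUnion (locallyFinite_of_finite s) ?_ ?_).mono hs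
  · rintro (_ | θ)
    · exact isClosed_skeleton n m
    · exact (hcl θ).isClosed_range
  · rintro (_ | θ)
    · exact (P.continuousOn τ).congr fun x hx => P.extendFun_of_mem κ τ hx
    · change ContinuousOn _ (Set.range (stdSimplex.map θ.1))
      rw [continuousOn_iff_continuous_domRestrict,
        ← ((hcl θ).isEmbedding.toHomeomorph).comp_continuous_iff']
      have : Continuous fun y => S.pullE (nerveEdge θ.1 τ) (P.filler κ (nervePull θ.1 τ) y) :=
        (S.pullE _).continuous.comp (P.filler κ _).continuous
      convert this using 1
      funext y
      exact P.extendFun_map κ hκ τ θ.1 y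

/-- The extension of a lift to the `n`-simplices by given lifts of the non-degenerate ones. -/
def extend : S.PartialLift (n + 1) where
  e := P.extendFun κ
  continuousOn := P.continuousOn_extendFun κ hκ
  q_e τ x hx := by
    rcases mem_skeleton_succ hx with h | ⟨θ, y, hθ, rfl⟩
    · rw [P.extendFun_of_mem κ τ h, P.q_e τ x h]
    · rw [P.extendFun_map κ hκ, S.q_pullE, P.q_filler κ hq, S.b_map]
  e_map θ τ x hx := by
    rcases mem_skeleton_succ hx with h | ⟨η, y, hη, rfl⟩
    · rw [P.extendFun_of_mem κ τ (map_mem_skeleton θ h), P.extendFun_of_mem κ _ h, P.e_map θ τ x h]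
    · rw [map_map, P.extendFun_map κ hκ, P.extendFun_map κ hκ, ← S.pullE_comp, nerveEdge_comp]
      rfl

theorem extend_e_of_mem {m : ℕ} (τ : Fin (m + 1) ⥤ C) {x : stdSimplex ℝ (Fin (m + 1))}
    (hx : x ∈ skeleton n m) : (P.extend κ hq hκ).e τ x = P.e τ x :=
  P.extendFun_of_mem κ τ hx

theorem extend_e_of_not {τ : Fin (n + 1) ⥤ C} (h : ¬ IsDegenerate τ)
    (x : stdSimplex ℝ (Fin (n + 1))) : (P.extend κ hq hκ).e τ x = κ τ h x := by
  have h1 := P.extendFun_map κ hκ τ OrderHom.id x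
  have h2 : nerveEdge OrderHom.id τ = 𝟙 (τ.obj 0) := nerveEdge_eq_eqToHom _ _ rfl rfl
  rw [h2] at h1
  have h3 : stdSimplex.map (OrderHom.id : Fin (n + 1) →o Fin (n + 1)) x = x :=
    stdSimplex.map_id_apply x
  rw [h3] at h1
  refine h1.trans ((S.pullE_id _ _).trans ?_)
  exact DFunLike.congr_fun (P.filler_of_not κ h) x

end Extend

end PartialLift

end LiftSystem

/-! ### Extension of lifts over the next skeleton -/

/-- An alternating product over the faces of a cube reduces to one over the faces of a simplex if
the faces `w j = 0` other than the last one do not contribute. -/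
theorem faceProd_eq_altProd {G : Type*} [CommGroup G] {m : ℕ} (X : Fin (m + 1) → Bool → G)
    (Y : Fin (m + 2) → G) (h1 : ∀ j, X j true = Y j.castSucc)
    (h2 : X (Fin.last m) false = Y (Fin.last (m + 1))) (h3 : ∀ j, j ≠ Fin.last m → X j false = 1) :
    faceProd X = altProd Y := by
  rw [altProd, Fin.prod_univ_castSucc, faceProd]
  simp only [mul_zpow, Finset.prod_mul_distrib]
  congr 1
  · exact Finset.prod_congr rfl fun j _ => by rw [h1, Fin.val_castSucc]
  · rw [Finset.prod_eq_single (Fin.last m) (fun j _ hj => by rw [h3 j hj]; simp) (by simp), h2]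
    simp [pow_succ]

theorem map_faceProd {G H : Type*} [CommGroup G] [CommGroup H] (φ : G →* H) {m : ℕ}
    (X : Fin m → Bool → G) : φ (faceProd X) = faceProd fun j δ => φ (X j δ) := by
  simp [faceProd]

namespace LiftSystem

variable {C : Type w} [Category.{v} C] {E : C → Type u} {B : C → Type y}
    {A : C → Type z} [∀ c, TopologicalSpace (E c)] [∀ c, TopologicalSpace (B c)]
    [∀ c, TopologicalSpace (A c)] (S : LiftSystem E B A)

/-- The homotopy groups of the fibres, as commutative groups. The underlying group structure is that
of Mathlib, to which the definition of the cohomology refers. -/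
instance (n : ℕ) (c : C) : CommGroup (HomotopyGroup (Fin (n + 1)) (A c) (S.base c)) :=
  (S.fibration c).commGroup n

theorem pullE_mem_fibrePairs {c c' : C} (α : c ⟶ c') {N : ℕ} {u v : C(Fin N → I, E c')}
    (h : (u, v) ∈ fibrePairs (S.q c') N) :
    ((S.pullE α).comp u, (S.pullE α).comp v) ∈ fibrePairs (S.q c) N :=
  ⟨fun s => (S.q_pullE α _).trans ((congrArg _ (h.1 s)).trans (S.q_pullE α _).symm),
    fun s hs => congrArg _ (h.2 s hs)⟩

/-- The maps `φ` between the homotopy groups of the fibres are induced by the maps `pullE` between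
the total spaces: they are compatible with difference classes. -/
def IsInduced {n : ℕ} (φ : ∀ {c c' : C}, (c ⟶ c') → HomotopyGroup (Fin (n + 1)) (A c') (S.base c') →
    HomotopyGroup (Fin (n + 1)) (A c) (S.base c)) : Prop :=
  ∀ {c c' : C} (α : c ⟶ c') (u v : C(Fin (n + 1) → I, E c')), (u, v) ∈ fibrePairs (S.q c') (n + 1) →
    φ α ((S.fibration c').diff u v) =
      (S.fibration c).diff ((S.pullE α).comp u) ((S.pullE α).comp v)

theorem exists_diff (n : ℕ) (c : C) (x : HomotopyGroup (Fin (n + 1)) (A c) (S.base c)) :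
    ∃ u v, (u, v) ∈ fibrePairs (S.q c) (n + 1) ∧ (S.fibration c).diff u v = x :=
  ⟨_, (S.fibration c).exists_diff_eq (ContinuousMap.const _ (S.ι c (S.base c))) x⟩

section Coeff

variable {S} {n : ℕ} {φ : ∀ {c c' : C}, (c ⟶ c') →
    HomotopyGroup (Fin (n + 1)) (A c') (S.base c') → HomotopyGroup (Fin (n + 1)) (A c) (S.base c)}
  (hφ : S.IsInduced φ)

/-- Induced maps make the homotopy groups of the fibres a functor. -/
def IsInduced.coeff : NerveCoeff fun c => HomotopyGroup (Fin (n + 1)) (A c) (S.base c) where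
  map {c c'} α := MonoidHom.mk' (φ α) fun x y => by
    obtain ⟨u, v, huv, rfl⟩ := S.exists_diff n c' x
    obtain ⟨w, hvw, rfl⟩ := (S.fibration c').exists_diff_eq v y
    have h1 := (S.fibration c').diff_mul_diff huv hvw
    refine (congrArg (φ α) h1).trans ?_
    have e1 : φ α ((S.fibration c').diff u v) = _ := hφ α _ _ huv
    have e2 : φ α ((S.fibration c').diff v w) = _ := hφ α _ _ hvw
    rw [e1, e2]
    refine (hφ α _ _ (fibrePairs_trans huv hvw)).trans ?_
    exact ((S.fibration c).diff_mul_diff (S.pullE_mem_fibrePairs α huv)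
      (S.pullE_mem_fibrePairs α hvw)).symm
  map_id c x := by
    obtain ⟨u, v, huv, rfl⟩ := S.exists_diff n c x
    refine (hφ _ _ _ huv).trans ?_
    congr 1 <;> exact ContinuousMap.ext fun _ => S.pullE_id _ _
  map_comp {c c' c''} α β x := by
    obtain ⟨u, v, huv, rfl⟩ := S.exists_diff n c'' x
    refine (hφ _ _ _ huv).trans ?_
    refine Eq.trans ?_ ((congrArg (φ α) (hφ β _ _ huv)).trans
      (hφ α _ _ (S.pullE_mem_fibrePairs β huv))).symm
    congr 1 <;> exact ContinuousMap.ext fun _ => S.pullE_comp _ _ _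

theorem IsInduced.coeff_map_diff {c c' : C} (α : c ⟶ c') {u v : C(Fin (n + 1) → I, E c')}
    (huv : (u, v) ∈ fibrePairs (S.q c') (n + 1)) :
    hφ.coeff.map α ((S.fibration c').diff u v) =
      (S.fibration c).diff ((S.pullE α).comp u) ((S.pullE α).comp v) := hφ α u v huv

/-- Induced maps are compatible with obstruction classes. -/
theorem IsInduced.coeff_map_obst {c c' : C} (α : c ⟶ c') {b : C(Fin (n + 2) → I, B c')}
    {f : Fin (n + 2) → Bool → C(Fin (n + 1) → I, E c')} (hf : IsShell (S.q c') b f) :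
    hφ.coeff.map α ((S.fibration c').obst b f) =
      (S.fibration c).obst ((S.pullB α).comp b) fun j δ => (S.pullE α).comp (f j δ) := by
  obtain ⟨e, he, -, hef⟩ := hf.exists_filling (S.fibration c').lift 0 false
  rw [(S.fibration c').obst_eq he hef, (S.fibration c).obst_eq (e := (S.pullE α).comp e)
    (fun w => (S.q_pullE α _).trans (congrArg _ (he w)))
    (fun j δ => S.pullE_mem_fibrePairs α (hef j δ))]
  refine (map_faceProd (hφ.coeff.map α) _).trans ?_
  unfold IsSimpleFibration.faceDiff
  refine congrArg _ (funext fun j => funext fun δ => ?_)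
  exact hφ.coeff_map_diff α (hef j δ)

end Coeff

namespace PartialLift

variable {S}

section Cubes

variable {m : ℕ} (P : S.PartialLift (m + 1))

/-- The lift of an `m`-simplex, as a cube. -/
def cube (τ : Fin (m + 1) ⥤ C) : C(Fin m → I, E (τ.obj 0)) :=
  ⟨fun s => P.e τ (cubeToSimplex m s), (P.continuousOn τ).comp_continuous
    (cubeToSimplex m).continuous fun _ => mem_skeleton_of_lt (Nat.lt_succ_self m) _⟩

theorem faceMap_mem_boundary (j : Fin (m + 1)) (δ : Bool) (s : Fin m → I) :
    faceMap j δ s ∈ Cube.boundary (Fin (m + 1)) :=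
  mem_boundary_iff.2 ⟨j, δ, faceMap_same j δ s⟩

/-- The lift of the boundary of an `m + 1`-simplex, as a family of cubes. -/
def shell (τ : Fin (m + 2) ⥤ C) (j : Fin (m + 1)) (δ : Bool) : C(Fin m → I, E (τ.obj 0)) :=
  ⟨fun s => P.e τ (cubeToSimplex (m + 1) (faceMap j δ s)), (P.continuousOn τ).comp_continuous
    ((cubeToSimplex (m + 1)).continuous.comp (faceMap j δ).continuous)
    fun s => cubeToSimplex_boundary (faceMap_mem_boundary j δ s)⟩

theorem isShell_shell (τ : Fin (m + 2) ⥤ C) :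
    IsShell (S.q _) ((S.b τ).comp (cubeToSimplex (m + 1))) (P.shell τ) where
  proj j δ s := P.q_e τ _ (cubeToSimplex_boundary (faceMap_mem_boundary j δ s))
  compat _ _ _ _ _ _ h := congrArg (fun w => P.e τ (cubeToSimplex (m + 1) w)) h

/-- The faces `s j = 1` are the lifts of the faces of the simplex other than the last one. -/
theorem shell_true (τ : Fin (m + 2) ⥤ C) (j : Fin (m + 1)) :
    P.shell τ j true = (S.pullE (nerveEdge (coface j.castSucc) τ)).comp
      (P.cube (nervePull (coface j.castSucc) τ)) := by
  ext s
  refine (congrArg (P.e τ) (cubeToSimplex_face_one j s)).trans ?_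
  exact P.e_map (coface j.castSucc) τ _ (mem_skeleton_of_lt (Nat.lt_succ_self m) _)

/-- The face where the last coordinate vanishes is the lift of the last face of the simplex. -/
theorem shell_last (τ : Fin (m + 2) ⥤ C) :
    P.shell τ (Fin.last m) false = (S.pullE (nerveEdge (coface (Fin.last (m + 1))) τ)).comp
      (P.cube (nervePull (coface (Fin.last (m + 1))) τ)) := by
  ext s
  refine (congrArg (P.e τ) (cubeToSimplex_face_last s)).trans ?_
  exact P.e_map (coface (Fin.last (m + 1))) τ _ (mem_skeleton_of_lt (Nat.lt_succ_self m) _)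

/-- A filling of the cube descends to the simplex. -/
theorem exists_of_cube_filling (τ : Fin (m + 2) ⥤ C) (e : C(Fin (m + 1) → I, E (τ.obj 0)))
    (he : ∀ w, S.q _ (e w) = S.b τ (cubeToSimplex (m + 1) w))
    (hf : ∀ w ∈ Cube.boundary (Fin (m + 1)), e w = P.e τ (cubeToSimplex (m + 1) w)) :
    ∃ κ : C(stdSimplex ℝ (Fin (m + 2)), E (τ.obj 0)), (∀ x, S.q _ (κ x) = S.b τ x) ∧
      Set.EqOn κ (P.e τ) (skeleton (m + 1) (m + 1)) ∧ κ.comp (cubeToSimplex (m + 1)) = e := by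
  obtain ⟨κ, h1, h2⟩ := exists_descend e (P.e τ) hf
  refine ⟨κ, fun x => ?_, h2, h1⟩
  obtain ⟨s, rfl⟩ := cubeToSimplex_surjective _ x
  rw [← he, ← h1]; rfl

end Cubes

/-- A lift over the `(n - 1)`-skeleton extends to the `n`-skeleton if it extends to the
non-degenerate `n`-simplices; conditions `Q` on the single extensions can be imposed. -/
theorem exists_extend {n : ℕ} (P : S.PartialLift n)
    (Q : ∀ τ : Fin (n + 1) ⥤ C, C(stdSimplex ℝ (Fin (n + 1)), E (τ.obj 0)) → Prop)
    (H : ∀ τ : Fin (n + 1) ⥤ C, ¬ IsDegenerate τ → ∃ κ : C(stdSimplex ℝ (Fin (n + 1)), E (τ.obj 0)),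
      (∀ x, S.q _ (κ x) = S.b τ x) ∧ Set.EqOn κ (P.e τ) (skeleton n n) ∧ Q τ κ) :
    ∃ P' : S.PartialLift (n + 1),
      (∀ {m : ℕ} (τ : Fin (m + 1) ⥤ C), ∀ x ∈ skeleton n m, P'.e τ x = P.e τ x) ∧
      ∀ τ : Fin (n + 1) ⥤ C, ¬ IsDegenerate τ → ∃ κ, Q τ κ ∧ ∀ x, P'.e τ x = κ x := by
  choose κ h1 h2 h3 using H
  exact ⟨P.extend κ h1 h2, fun τ x hx => P.extend_e_of_mem κ h1 h2 τ hx,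
    fun τ h => ⟨κ τ h, h3 τ h, fun x => P.extend_e_of_not κ h1 h2 h x⟩⟩

section Obstruction

variable {n : ℕ} (P : S.PartialLift (n + 2))

/-- The obstruction cochain of a lift over the `n + 1`-skeleton. -/
def obstCochain :
    NerveCochain (fun c => HomotopyGroup (Fin (n + 1)) (A c) (S.base c)) (n + 2) := fun τ =>
  (S.fibration _).obst ((S.b τ).comp (cubeToSimplex (n + 2))) (P.shell τ)

/-- The obstruction cochain is normalized: over a degenerate simplex, the lift of the simplex onto
which it collapses fills the shell. -/
theorem obstCochain_of_isDegenerate (τ : Fin (n + 3) ⥤ C) (h : IsDegenerate τ) :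
    P.obstCochain τ = 1 := by
  obtain ⟨i, hi⟩ := h
  let e : C(Fin (n + 2) → I, E (τ.obj 0)) :=
    ⟨fun s => P.e τ (stdSimplex.map (collapse i) (cubeToSimplex (n + 2) s)),
      (P.continuous_e_map τ (collapse i) (collapse_mem_skeleton i)).comp
        (cubeToSimplex (n + 2)).continuous⟩
  have h1 : (S.q _).comp e = (S.b τ).comp (cubeToSimplex (n + 2)) := ContinuousMap.ext fun s =>
    (P.q_e τ _ (collapse_mem_skeleton i _)).trans (S.b_collapse i τ hi _)
  have h2 : cubeFaces e = P.shell τ := by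
    funext j δ
    exact ContinuousMap.ext fun s =>
      P.e_collapse i τ hi (cubeToSimplex_boundary (faceMap_mem_boundary j δ s))
  rw [obstCochain, ← h1, ← h2]
  exact (S.fibration _).obst_eq_one_of_filling e

variable {φ : ∀ {c c' : C}, (c ⟶ c') →
    HomotopyGroup (Fin (n + 1)) (A c') (S.base c') → HomotopyGroup (Fin (n + 1)) (A c) (S.base c)}
  (hφ : S.IsInduced φ)

/-- The obstruction cochain at `θ^* τ`, moved to the first vertex of `τ`, is the obstruction class
of the lift of `τ` pulled back along `θ`. -/
theorem eval_obstCochain {l : ℕ} (τ : Fin (l + 1) ⥤ C) (θ : Fin (n + 3) →o Fin (l + 1))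
    (b : C(Fin (n + 2) → I, B (τ.obj 0)))
    (f : Fin (n + 2) → Bool → C(Fin (n + 1) → I, E (τ.obj 0)))
    (hb : ∀ s, b s = S.b τ (stdSimplex.map θ (cubeToSimplex (n + 2) s)))
    (hf : ∀ j δ s, f j δ s =
      P.e τ (stdSimplex.map θ (cubeToSimplex (n + 2) (faceMap j δ s)))) :
    hφ.coeff.eval P.obstCochain τ θ = (S.fibration _).obst b f := by
  refine (hφ.coeff_map_obst _ (P.isShell_shell _)).trans ?_
  congr 1
  · exact ContinuousMap.ext fun s => (S.b_map θ τ _).symm.trans (hb s).symm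
  · funext j δ
    exact ContinuousMap.ext fun s => (P.e_map θ τ _
      (cubeToSimplex_boundary (faceMap_mem_boundary j δ s))).symm.trans (hf j δ s).symm

/-- The obstruction cochain is a cocycle, by the cocycle condition for cubes. -/
theorem coboundary_obstCochain (τ : Fin (n + 4) ⥤ C) :
    hφ.coeff.coboundary P.obstCochain τ = 1 := by
  let f : Fin (n + 3) → Bool → Fin (n + 2) → Bool → C(Fin (n + 1) → I, E (τ.obj 0)) :=
    fun i ε j δ => ⟨fun s => P.e τ (cubeToSimplex (n + 3) (faceMap i ε (faceMap j δ s))),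
      (P.continuousOn τ).comp_continuous ((cubeToSimplex (n + 3)).continuous.comp
        ((faceMap i ε).continuous.comp (faceMap j δ).continuous)) fun s =>
        cubeToSimplex_codimTwo (faceMap_mem_codimTwo (faceMap_mem_boundary j δ s))⟩
  have h1 := (S.fibration (τ.obj 0)).faceProd_obst ((S.b τ).comp (cubeToSimplex (n + 3)))
    (fun w => P.e τ (cubeToSimplex (n + 3) w))
    ((P.continuousOn τ).comp (cubeToSimplex (n + 3)).continuous.continuousOn
      fun w hw => cubeToSimplex_codimTwo hw)
    (fun w hw => P.q_e τ _ (cubeToSimplex_codimTwo hw)) f (fun _ _ _ _ _ => rfl)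
  refine Eq.trans (Eq.symm ?_) h1
  refine faceProd_eq_altProd _ _ (fun i => ?_) ?_ (fun i hi => ?_)
  · refine (P.eval_obstCochain hφ τ (coface i.castSucc) _ _ (fun s => ?_) fun j δ s => ?_).symm
    · exact congrArg (S.b τ) (cubeToSimplex_face_one i s)
    · exact congrArg (P.e τ) (cubeToSimplex_face_one i _)
  · refine (P.eval_obstCochain hφ τ (coface (Fin.last _)) _ _ (fun s => ?_) fun j δ s => ?_).symm
    · exact congrArg (S.b τ) (cubeToSimplex_face_last s)
    · exact congrArg (P.e τ) (cubeToSimplex_face_last _)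
  · -- this face of the cube is mapped to the part of the simplex where the lift is defined
    have hi' : (i : ℕ) < n + 2 := Fin.val_lt_last hi
    have hsk : ∀ s, cubeToSimplex (n + 3) (faceMap i false s) ∈ skeleton (n + 2) (n + 3) :=
      fun s => cubeToSimplex_mem_skeleton (faceMap_same i false s) hi'
    let e : C(Fin (n + 2) → I, E (τ.obj 0)) :=
      ⟨fun s => P.e τ (cubeToSimplex (n + 3) (faceMap i false s)),
        (P.continuousOn τ).comp_continuous ((cubeToSimplex (n + 3)).continuous.comp
          (faceMap i false).continuous) hsk⟩
    have h2 : (S.q _).comp e = ((S.b τ).comp (cubeToSimplex (n + 3))).comp (faceMap i false) :=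
      ContinuousMap.ext fun s => P.q_e τ _ (hsk s)
    have h3 := (S.fibration (τ.obj 0)).obst_eq_one_of_filling e
    rw [h2] at h3
    exact h3

/-- Two lifts over the `n + 1`-skeleton that agree on the `n`-skeleton differ by a cochain `t`;
their obstruction cochains differ by the coboundary of `t`. -/
theorem obstCochain_eq_mul_coboundary (P' : S.PartialLift (n + 2))
    (h : ∀ {m : ℕ} (τ : Fin (m + 1) ⥤ C), ∀ x ∈ skeleton (n + 1) m, P'.e τ x = P.e τ x)
    (t : NerveCochain (fun c => HomotopyGroup (Fin (n + 1)) (A c) (S.base c)) (n + 1))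
    (ht : ∀ τ, (S.fibration _).diff (P.cube τ) (P'.cube τ) = t τ) (τ : Fin (n + 3) ⥤ C) :
    P'.obstCochain τ = P.obstCochain τ * hφ.coeff.coboundary t τ := by
  have hcube : ∀ τ, (P.cube τ, P'.cube τ) ∈ fibrePairs (S.q _) (n + 1) := fun τ =>
    ⟨fun s => (P.q_e τ _ (mem_skeleton_of_lt (Nat.lt_succ_self _) _)).trans
      (P'.q_e τ _ (mem_skeleton_of_lt (Nat.lt_succ_self _) _)).symm,
      fun s hs => (h τ _ (cubeToSimplex_boundary hs)).symm⟩
  have hsh : ∀ j δ, (P.shell τ j δ, P'.shell τ j δ) ∈ fibrePairs (S.q _) (n + 1) := fun j δ =>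
    ⟨fun s => ((P.isShell_shell τ).proj j δ s).trans ((P'.isShell_shell τ).proj j δ s).symm,
      fun s hs => (h τ _ (cubeToSimplex_codimTwo (faceMap_mem_codimTwo hs))).symm⟩
  refine ((S.fibration _).obst_change (P.isShell_shell τ) hsh).trans ?_
  refine congrArg (fun x => P.obstCochain τ * x) ?_
  refine faceProd_eq_altProd _ _ (fun j => ?_) ?_ (fun j hj => ?_)
  · rw [P.shell_true, P'.shell_true, ← hφ.coeff_map_diff _ (hcube _), ht]
    rfl
  · rw [P.shell_last, P'.shell_last, ← hφ.coeff_map_diff _ (hcube _), ht]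
    rfl
  · have hj' : (j : ℕ) < n + 1 := Fin.val_lt_last hj
    have : P'.shell τ j false = P.shell τ j false := ContinuousMap.ext fun s =>
      h τ _ (cubeToSimplex_mem_skeleton (faceMap_same j false s) hj')
    rw [this, (S.fibration _).diff_self]

/-- A lift over the `n + 1`-skeleton with trivial obstruction cochain extends. -/
theorem exists_of_obstCochain_eq_one (h : ∀ τ, P.obstCochain τ = 1) :
    ∃ P' : S.PartialLift (n + 3), ∀ {m : ℕ} (τ : Fin (m + 1) ⥤ C), ∀ x ∈ skeleton (n + 2) m,
      P'.e τ x = P.e τ x := by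
  obtain ⟨P', h1, -⟩ := P.exists_extend (fun _ _ => True) fun τ _ => by
    obtain ⟨e, he, hf⟩ := (S.fibration _).exists_filling_of_obst_eq_one (P.isShell_shell τ) (h τ)
    obtain ⟨κ, h1, h2, -⟩ := P.exists_of_cube_filling τ e he fun w hw => by
      obtain ⟨j, δ, hj⟩ := mem_boundary_iff.1 hw
      rw [← faceMap_removeNth hj]
      exact DFunLike.congr_fun (hf j δ) _
    exact ⟨κ, h1, h2, trivial⟩
  exact ⟨P', h1⟩

/-- The lifts of the `n + 1`-simplices can be changed by any normalized cochain. -/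
theorem exists_change
    (t : NerveCochain (fun c => HomotopyGroup (Fin (n + 1)) (A c) (S.base c)) (n + 1))
    (ht : ∀ τ, IsDegenerate τ → t τ = 1) :
    ∃ P' : S.PartialLift (n + 2),
      (∀ {m : ℕ} (τ : Fin (m + 1) ⥤ C), ∀ x ∈ skeleton (n + 1) m, P'.e τ x = P.e τ x) ∧
      ∀ τ, (S.fibration _).diff (P.cube τ) (P'.cube τ) = t τ := by
  obtain ⟨P', h1, h2⟩ := (P.restrict (Nat.le_succ (n + 1))).exists_extend
    (fun τ κ => (S.fibration _).diff (P.cube τ) (κ.comp (cubeToSimplex (n + 1))) = t τ)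
    fun τ _ => by
      obtain ⟨v, hv, hd⟩ := (S.fibration _).exists_diff_eq (P.cube τ) (t τ)
      obtain ⟨κ, h1, h2, h3⟩ := (P.restrict (Nat.le_succ (n + 1))).exists_of_cube_filling τ v
        (fun w => (hv.1 w).symm.trans (P.q_e τ _ (mem_skeleton_of_lt (Nat.lt_succ_self _) _)))
        (fun w hw => (hv.2 w hw).symm)
      exact ⟨κ, h1, h2, by rw [h3, hd]⟩
  refine ⟨P', h1, fun τ => ?_⟩
  by_cases hτ : IsDegenerate τ
  · rw [ht τ hτ]
    obtain ⟨i, hi⟩ := hτ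
    have : P'.cube τ = P.cube τ := ContinuousMap.ext fun s => by
      have hm := mem_skeleton_of_lt (Nat.lt_succ_self (n + 1)) (cubeToSimplex (n + 1) s)
      refine (P'.e_collapse i τ hi hm).symm.trans (Eq.trans ?_ (P.e_collapse i τ hi hm))
      exact h1 τ _ (collapse_mem_skeleton i _)
    rw [this, (S.fibration _).diff_self]
  · obtain ⟨κ, h3, h4⟩ := h2 τ hτ
    have : P'.cube τ = κ.comp (cubeToSimplex (n + 1)) := ContinuousMap.ext fun s => h4 _
    rw [this, h3]

include hφ in
/-- If the cohomology vanishes, a lift over the `n + 1`-skeleton extends to the next skeleton after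
a change of the lifts of the `n + 1`-simplices. -/
theorem exists_next (hcoh : NerveCohomologyVanishes
      (A := fun c => HomotopyGroup (Fin (n + 1)) (A c) (S.base c)) φ (n + 1)) :
    ∃ P' : S.PartialLift (n + 3), ∀ {m : ℕ} (τ : Fin (m + 1) ⥤ C), ∀ x ∈ skeleton (n + 1) m,
      P'.e τ x = P.e τ x := by
  obtain ⟨t, ht⟩ := hcoh P.obstCochain fun τ =>
    (congrFun (hφ.coeff.nerveCoboundary_eq P.obstCochain) τ).trans (P.coboundary_obstCochain hφ τ)
  replace ht : hφ.coeff.coboundary t = P.obstCochain :=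
    (hφ.coeff.nerveCoboundary_eq t).symm.trans ht
  obtain ⟨t', h1, h2⟩ := hφ.coeff.exists_normalized t fun k l τ θ hθ => by
    rw [ht]
    exact P.obstCochain_of_isDegenerate _ ⟨k, nervePull_collapse θ τ k hθ⟩
  obtain ⟨P₁, h3, h4⟩ := P.exists_change (fun τ => (t' τ)⁻¹) fun τ ⟨i, hi⟩ => by
    have := h2 i _ τ (collapse i) (by
      rw [Fin.ext_iff, val_collapse, val_collapse]; simp)
    rw [inv_eq_one]
    rwa [hi] at this
  obtain ⟨P₂, h5⟩ := P₁.exists_of_obstCochain_eq_one fun τ => by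
    rw [P.obstCochain_eq_mul_coboundary hφ P₁ h3 _ h4, hφ.coeff.coboundary_inv, h1, ht]
    exact mul_inv_cancel _
  exact ⟨P₂, fun τ x hx => (h5 τ x (skeleton_mono (Nat.le_succ _) hx)).trans (h3 τ x hx)⟩

end Obstruction

end PartialLift

end LiftSystem

/-! ### Lifts over the whole nerve -/

/-- Paths in the base lift to paths with given end points. -/
theorem IsSimpleFibration.exists_path_lift {E B A : Type*} [TopologicalSpace E]
    [TopologicalSpace B] [TopologicalSpace A] {q : C(E, B)} {ι : C(A, E)} {x₀ : A}
    (hF : IsSimpleFibration q ι x₀) (b : C(Fin 1 → I, B)) (e : Bool → E)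
    (he : ∀ δ, q (e δ) = b fun _ => bit δ) :
    ∃ e' : C(Fin 1 → I, E), (∀ w, q (e' w) = b w) ∧ ∀ δ, e' (fun _ => bit δ) = e δ := by
  have := hF.pathConnected
  have := hF.simplyConnected
  obtain ⟨γ⟩ := PathConnectedSpace.joined (e false) (e true)
  let p : Path (q (e false)) (q (e true)) :=
    ⟨⟨fun t => b fun _ => t, by fun_prop⟩, (he false).symm, (he true).symm⟩
  obtain ⟨H⟩ := SimplyConnectedSpace.paths_homotopic (γ.map q.continuous) p
  obtain ⟨e', h1, -, h2⟩ := homotopy_horn hF.lift (m := 1)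
    ⟨fun x => H (x.1, x.2 0), by fun_prop⟩ ⟨fun s => γ (s 0), by fun_prop⟩
    (fun _ δ _ => e δ) (fun s => (H.apply_zero (s 0)).symm) (fun _ _ => continuousOn_const)
    (fun j δ t s hs => by
      obtain rfl : j = 0 := Subsingleton.elim _ _
      change _ = H (t, s 0)
      rw [hs]
      cases δ
      · exact (H.source t).symm
      · exact (H.target t).symm)
    (fun j δ s hs => by
      obtain rfl : j = 0 := Subsingleton.elim _ _
      change _ = γ (s 0)
      rw [hs]
      cases δ
      · exact γ.source.symm
      · exact γ.target.symm)
    (fun j δ k δ' t s hj hk => by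
      obtain rfl : j = k := Subsingleton.elim _ _
      rw [bit_injective (hj.symm.trans hk)])
  refine ⟨e'.comp ⟨fun s => (1, s), by fun_prop⟩, fun w => (h1 (1, w)).trans ?_,
    fun δ => h2 0 δ 1 _ rfl⟩
  refine (H.apply_one (w 0)).trans ?_
  change b _ = b w
  congr 1
  funext j
  rw [Subsingleton.elim j 0]

namespace LiftSystem

variable {C : Type w} [Category.{v} C] {E : C → Type u} {B : C → Type y}
    {A : C → Type z} [∀ c, TopologicalSpace (E c)] [∀ c, TopologicalSpace (B c)]
    [∀ c, TopologicalSpace (A c)] (S : LiftSystem E B A)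

theorem skeleton_zero (m : ℕ) : skeleton 0 m = ∅ := by
  refine Set.eq_empty_of_forall_notMem fun x hx => ?_
  have h1 : (simplexSupport x).card ≤ 0 := hx
  have h2 := (simplexSupport_nonempty x).card_pos
  omega

/-- The lift over the empty skeleton. -/
def emptyLift : S.PartialLift 0 where
  e τ _ := S.g (τ.obj 0)
  continuousOn _ := continuousOn_const
  q_e _ x hx := by simp [skeleton_zero] at hx
  e_map _ _ x hx := by simp [skeleton_zero] at hx

/-- There is a lift over the `1`-skeleton that extends the given lifts of the vertices. -/
theorem exists_partialLift_two : ∃ P : S.PartialLift 2, ∀ (τ : Fin (0 + 1) ⥤ C) x,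
    P.e τ x = S.g (τ.obj 0) := by
  obtain ⟨P, -, h1⟩ := S.emptyLift.exists_extend (fun τ κ => ∀ x, κ x = S.g (τ.obj 0))
    fun τ _ => ⟨ContinuousMap.const _ (S.g (τ.obj 0)), fun x => S.q_g τ x,
      by rw [skeleton_zero]; exact Set.eqOn_empty _ _, fun _ => rfl⟩
  obtain ⟨P', h2, -⟩ := P.exists_extend (fun _ _ => True) fun τ _ => by
    have hb : ∀ δ, (fun _ : Fin (0 + 1) => bit δ) ∈ Cube.boundary (Fin (0 + 1)) := fun δ =>
      mem_boundary_iff.2 ⟨0, δ, rfl⟩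
    obtain ⟨e, he, he'⟩ := (S.fibration _).exists_path_lift ((S.b τ).comp (cubeToSimplex 1))
      (fun δ => P.e τ (cubeToSimplex 1 fun _ => bit δ))
      (fun δ => P.q_e τ _ (cubeToSimplex_boundary (hb δ)))
    obtain ⟨κ, h1, h2, -⟩ := P.exists_of_cube_filling τ e he fun w hw => by
      obtain ⟨j, δ, hj⟩ := mem_boundary_iff.1 hw
      have hw' : w = fun _ => bit δ := funext fun k => by
        rw [← hj, show k = j from Fin.ext (by omega)]
      rw [hw', he']
    exact ⟨κ, h1, h2, trivial⟩
  refine ⟨P', fun τ x => ?_⟩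
  obtain ⟨κ, h3, h4⟩ := h1 τ fun ⟨i, _⟩ => i.elim0
  rw [h2 τ x (mem_skeleton_of_lt (Nat.lt_succ_self 0) x), h4, h3]

/-- If the obstruction groups vanish, there are compatible lifts of all simplices that extend the
given lifts of the vertices. -/
theorem exists_lift {φ : ∀ (n : ℕ) {c c' : C}, (c ⟶ c') →
      HomotopyGroup (Fin (n + 1)) (A c') (S.base c') → HomotopyGroup (Fin (n + 1)) (A c) (S.base c)}
    (hφ : ∀ n, S.IsInduced (φ n))
    (hcoh : ∀ n, NerveCohomologyVanishes
      (A := fun c => HomotopyGroup (Fin (n + 1)) (A c) (S.base c)) (φ n) (n + 1)) :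
    ∃ e : ∀ {m : ℕ} (τ : Fin (m + 1) ⥤ C), C(stdSimplex ℝ (Fin (m + 1)), E (τ.obj 0)),
      (∀ {m : ℕ} (τ : Fin (m + 1) ⥤ C) x, S.q _ (e τ x) = S.b τ x) ∧
      (∀ {m l : ℕ} (θ : Fin (m + 1) →o Fin (l + 1)) (τ : Fin (l + 1) ⥤ C) x,
        e τ (stdSimplex.map θ x) = S.pullE (nerveEdge θ τ) (e (nervePull θ τ) x)) ∧
      ∀ (τ : Fin (0 + 1) ⥤ C) x, e τ x = S.g (τ.obj 0) := by
  obtain ⟨P₀, h0⟩ := S.exists_partialLift_two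
  choose next hnext using fun n (P : S.PartialLift (n + 2)) => P.exists_next (hφ n) (hcoh n)
  let P : ∀ k, S.PartialLift (k + 2) := fun k => Nat.rec P₀ (fun k P => next k P) k
  -- the lifts of an `m`-simplex do not change after the stage `m`
  have hP : ∀ {m k : ℕ} (_ : m ≤ k) (τ : Fin (m + 1) ⥤ C) x, (P k).e τ x = (P m).e τ x := by
    intro m k hk τ x
    induction k, hk using Nat.le_induction with
    | base => rfl
    | succ k hk ih =>
      rw [← ih]
      exact hnext k (P k) τ x (mem_skeleton_of_lt (by omega) x)
  refine ⟨fun {m} τ => ⟨(P m).e τ, ?_⟩, fun {m} τ x => ?_, fun {m l} θ τ x => ?_, fun τ x => ?_⟩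
  · rw [← continuousOn_univ]
    exact ((P m).continuousOn τ).mono fun x _ => mem_skeleton_of_lt (by omega) x
  · exact (P m).q_e τ x (mem_skeleton_of_lt (by omega) x)
  · have h1 := (P (max m l)).e_map θ τ x (mem_skeleton_of_lt (by omega) x)
    rw [hP (le_max_right m l), hP (le_max_left m l)] at h1
    exact h1
  · exact h0 τ x

end LiftSystem

/-! ### Mapping spaces of compactly generated spaces -/

/-- The exponential law: a family of maps on a compactly generated space that depends continuously
on a parameter in a locally compact space is jointly continuous. -/
theorem continuous_eval_of_compactlyGenerated {X : Type u} {L : Type v} {Z : Type w}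
    [TopologicalSpace X] [CompactlyGeneratedSpace X] [TopologicalSpace L] [LocallyCompactSpace L]
    [TopologicalSpace Z] {h : L → C(X, Z)} (hh : Continuous h) :
    Continuous fun p : L × X => h p.1 p.2 := by
  let f : X → C(L, Z) := fun x => ⟨fun l => h l x, (continuous_eval_const x).comp hh⟩
  have hf : Continuous f := by
    refine continuous_from_compactlyGeneratedSpace f fun K _ _ _ k hk => ?_
    have h1 : Continuous fun l => (h l).comp (⟨k, hk⟩ : C(K, X)) :=
      (ContinuousMap.continuous_precomp _).comp hh
    have h2 : Continuous fun p : L × K => h p.1 (k p.2) :=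
      ContinuousMap.continuous_uncurry_of_continuous ⟨_, h1⟩
    exact ContinuousMap.continuous_of_continuous_uncurry _ (h2.comp continuous_swap)
  have h3 : Continuous fun p : X × L => h p.2 p.1 :=
    ContinuousMap.continuous_uncurry_of_continuous ⟨f, hf⟩
  exact h3.comp continuous_swap

theorem joined_of_homotopic {X : Type u} {Z : Type w} [TopologicalSpace X] [TopologicalSpace Z]
    {f g : C(X, Z)} (h : ContinuousMap.Homotopic f g) : Joined f g := by
  obtain ⟨H⟩ := h
  exact ⟨⟨H.curry, by ext; simp, by ext; simp⟩⟩

/-- The values of a path at `0` and at `t` are joined. -/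
theorem joined_of_continuous {Z : Type w} [TopologicalSpace Z] {f : I → Z} (hf : Continuous f)
    (t : I) : Joined (f 0) (f t) :=
  ⟨⟨⟨fun r => f (r * t), hf.comp (by fun_prop)⟩, by simp, by simp⟩⟩

/-! ### The lifting problem over the nerve -/

namespace HocolimLiftingProblem

variable {C : Type w} [Category.{v} C] {F : C ⥤ TopCat.{u}}
  {Y : Type y} {Z : Type z} [TopologicalSpace Y] [TopologicalSpace Z]
  (P : HocolimLiftingProblem F Y Z)

theorem comp_mem_baseComponent {c : C} {h : C(F.obj c, Y)} (hh : h ∈ P.totalComponent c) :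
    P.p.comp h ∈ P.baseComponent c := by
  rw [baseComponent, res, ← P.comm]
  exact Joined.map hh (ContinuousMap.continuous_postcomp P.p)

/-- Composition with `p`, as a map between components of mapping spaces. -/
def proj (c : C) : C(P.totalComponent c, P.baseComponent c) where
  toFun h := ⟨P.p.comp h.1, P.comp_mem_baseComponent h.2⟩
  continuous_toFun := ((ContinuousMap.continuous_postcomp P.p).comp
    continuous_subtype_val).subtype_mk _

/-- The inclusion of the fibre. -/
def fibIncl (c : C) : C(P.fib c, P.totalComponent c) where
  toFun h := ⟨h.1, h.2.1⟩
  continuous_toFun := continuous_subtype_val.subtype_mk _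

/-- Composition with `p` is a Serre fibration: by the exponential law, a homotopy of `n`-cubes in
the mapping space is a homotopy on `F c × I ^ n`. The lift does not leave the path component. -/
theorem proj_lifting [∀ c, CompactlyGeneratedSpace (F.obj c)]
    (hp : ∀ (c : C) (n : ℕ), HasHomotopyLifting P.p (F.obj c × (Fin n → I))) (c : C) (n : ℕ) :
    HasHomotopyLifting (P.proj c) (Fin n → I) := by
  intro H h hH
  have h1 := continuous_eval_of_compactlyGenerated (continuous_subtype_val.comp H.continuous)
  have h2 := continuous_eval_of_compactlyGenerated (continuous_subtype_val.comp h.continuous)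
  obtain ⟨K, hK0, hK⟩ := hp c n ⟨fun x => (H (x.1.2, x.2)).1 x.1.1,
      h1.comp (f := fun x : (F.obj c × (Fin n → I)) × I => ((x.1.2, x.2), x.1.1)) (by fun_prop)⟩
    ⟨fun x => (h x.2).1 x.1, h2.comp continuous_swap⟩
    fun x => DFunLike.congr_fun (congrArg Subtype.val (hH x.2)) x.1
  let K' : (Fin n → I) × I → C(F.obj c, Y) := fun x =>
    ⟨fun a => K ((a, x.1), x.2), by fun_prop⟩
  have hK' : Continuous K' := ContinuousMap.continuous_of_continuous_uncurry _ (by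
    change Continuous fun x : ((Fin n → I) × I) × F.obj c => K ((x.2, x.1.1), x.1.2)
    fun_prop)
  have h0 : ∀ s, K' (s, 0) = (h s).1 := fun s => ContinuousMap.ext fun a => hK0 (a, s)
  have hmem : ∀ x, K' x ∈ P.totalComponent c := fun x => by
    have h3 : Joined (K' (x.1, 0)) (K' (x.1, x.2)) :=
      joined_of_continuous (f := fun t => K' (x.1, t)) (hK'.comp (by fun_prop)) x.2
    rw [h0] at h3
    exact Joined.mem_pathComponent h3 (h x.1).2
  exact ⟨⟨fun x => ⟨K' x, hmem x⟩, hK'.subtype_mk _⟩, fun s => Subtype.ext (h0 s),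
    fun x => Subtype.ext (ContinuousMap.ext fun a => hK ((a, x.1), x.2))⟩

/-- The assumptions of the lifting problem in terms of the components of the mapping spaces. -/
theorem isSimpleFibration [∀ c, CompactlyGeneratedSpace (F.obj c)]
    (hp : ∀ (c : C) (n : ℕ), HasHomotopyLifting P.p (F.obj c × (Fin n → I)))
    (hbase : ∀ c : C, SimplyConnectedSpace (P.baseComponent c))
    (hfib : ∀ c : C, IsSimpleSpace (P.fib c)) (c : C) :
    IsSimpleFibration (P.proj c) (P.fibIncl c) (P.basePt c) where
  lift := P.proj_lifting hp c
  pathConnected := isPathConnected_iff_pathConnectedSpace.1 isPathConnected_pathComponent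
  simplyConnected := hbase c
  isEmbedding := Topology.IsEmbedding.inclusion fun _ h => h.1
  proj a := Subtype.ext (a.2.2.trans (P.comm c).symm)
  mem_range e he := ⟨⟨e.1, e.2, (congrArg Subtype.val he).trans (P.comm c)⟩, rfl⟩
  simple := hfib c

section Functoriality

variable (hg : ∀ {c c' : C} (α : c ⟶ c'),
  ContinuousMap.Homotopic ((P.g c').comp (F.map α).hom) (P.g c))

include hg in
theorem comp_map_mem_totalComponent {c c' : C} (α : c ⟶ c') {h : C(F.obj c', Y)}
    (hh : h ∈ P.totalComponent c') : h.comp (F.map α).hom ∈ P.totalComponent c :=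
  have hh' : Joined (P.g c') h := hh
  (hh'.map (ContinuousMap.continuous_precomp (F.map α).hom)).mem_pathComponent
    (joined_of_homotopic (hg α)).symm

include hg in
theorem comp_map_mem_baseComponent {c c' : C} (α : c ⟶ c') {h : C(F.obj c', Z)}
    (hh : h ∈ P.baseComponent c') : h.comp (F.map α).hom ∈ P.baseComponent c := by
  have hh' : Joined (P.res c') h := hh
  refine (hh'.map (ContinuousMap.continuous_precomp (F.map α).hom)).mem_pathComponent ?_
  have h1 :=
    P.comp_mem_baseComponent (P.comp_map_mem_totalComponent hg α (mem_pathComponent_self _))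
  rwa [← ContinuousMap.comp_assoc, P.comm] at h1

/-- Restriction along `F α`, on the components of the mapping spaces to `Y`. -/
def pullTotal {c c' : C} (α : c ⟶ c') : C(P.totalComponent c', P.totalComponent c) where
  toFun h := ⟨h.1.comp (F.map α).hom, P.comp_map_mem_totalComponent hg α h.2⟩
  continuous_toFun := ((ContinuousMap.continuous_precomp _).comp
    continuous_subtype_val).subtype_mk _

/-- Restriction along `F α`, on the components of the mapping spaces to `Z`. -/
def pullBase {c c' : C} (α : c ⟶ c') : C(P.baseComponent c', P.baseComponent c) where
  toFun h := ⟨h.1.comp (F.map α).hom, P.comp_map_mem_baseComponent hg α h.2⟩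
  continuous_toFun := ((ContinuousMap.continuous_precomp _).comp
    continuous_subtype_val).subtype_mk _

/-- The part of the homotopy colimit over a `0`-simplex is the space at its vertex. A `0`-simplex of
the nerve is equal to a constant functor, though not by definition. -/
theorem mk_eq_incl (τ : Fin (0 + 1) ⥤ C) (t : stdSimplex ℝ (Fin (0 + 1))) (a : F.obj (τ.obj 0)) :
    (Quot.mk _ ⟨⟨0, τ⟩, t, a⟩ : Hocolim F) = Hocolim.incl F (τ.obj 0) a := by
  have h1 : ∀ (c : C) (τ' : Fin 1 ⥤ C) (_ : τ' = (Functor.const (Fin 1)).obj c)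
      (h : τ'.obj 0 = c) (a : F.obj (τ'.obj 0)),
      (Quot.mk _ ⟨⟨0, τ'⟩, stdSimplex.vertex 0, a⟩ : Hocolim F) =
        Hocolim.incl F c ((F.map (eqToHom h)).hom a) := by
    rintro c _ rfl h a
    change Hocolim.incl F c a = _
    simp
  have h2 : τ = (Functor.const (Fin 1)).obj (τ.obj 0) := by
    refine CategoryTheory.Functor.ext (fun k : Fin 1 => congrArg τ.obj (Subsingleton.elim k 0))
      fun (j k : Fin 1) f => ?_
    obtain rfl : j = 0 := Subsingleton.elim _ _
    obtain rfl : k = 0 := Subsingleton.elim _ _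
    obtain rfl : f = 𝟙 _ := Subsingleton.elim _ _
    simp
  have h3 : t = stdSimplex.vertex 0 := Subsingleton.elim _ _
  rw [h3]
  exact (h1 _ τ h2 rfl a).trans (by simp; rfl)

/-- The restriction of `f` to the part of the homotopy colimit over a simplex of the nerve. -/
def simplexMap {m : ℕ} (τ : Fin (m + 1) ⥤ C) :
    C(stdSimplex ℝ (Fin (m + 1)) × F.obj (τ.obj 0), Z) where
  toFun x := P.f (Quot.mk _ ⟨⟨m, τ⟩, x⟩)
  continuous_toFun := P.f.continuous.comp (continuous_quot_mk.comp continuous_sigmaMk)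

/-- The restrictions of `f` to the simplices are compatible, by the identifications in the homotopy
colimit. -/
theorem simplexMap_map {m l : ℕ} (θ : Fin (m + 1) →o Fin (l + 1)) (τ : Fin (l + 1) ⥤ C)
    (t : stdSimplex ℝ (Fin (m + 1))) :
    (P.simplexMap τ).curry (stdSimplex.map θ t) =
      ((P.simplexMap (nervePull θ τ)).curry t).comp (F.map (nerveEdge θ τ)).hom :=
  ContinuousMap.ext fun a => congrArg P.f (Quot.sound (HocolimRel.glue θ τ t a))

theorem simplexMap_zero (τ : Fin (0 + 1) ⥤ C) (t : stdSimplex ℝ (Fin (0 + 1))) :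
    (P.simplexMap τ).curry t = P.res (τ.obj 0) :=
  ContinuousMap.ext fun a => congrArg P.f (mk_eq_incl τ t a)

include hg in
/-- The restrictions of `f` to the simplices take values in the components of the `f_c`, since the
first vertex of the simplex is mapped to `f_c`. -/
theorem simplexMap_mem {m : ℕ} (τ : Fin (m + 1) ⥤ C) (t : stdSimplex ℝ (Fin (m + 1))) :
    (P.simplexMap τ).curry t ∈ P.baseComponent (τ.obj 0) := by
  let θ : Fin (0 + 1) →o Fin (m + 1) := ⟨fun _ => 0, fun _ _ _ => le_rfl⟩
  have h1 : (P.simplexMap τ).curry (stdSimplex.map θ (stdSimplex.vertex 0)) ∈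
      P.baseComponent (τ.obj 0) := by
    rw [simplexMap_map, simplexMap_zero]
    exact P.comp_map_mem_baseComponent hg _ (mem_pathComponent_self _)
  refine Joined.mem_pathComponent ?_ h1
  have : PathConnectedSpace (stdSimplex ℝ (Fin (m + 1))) :=
    isPathConnected_iff_pathConnectedSpace.1 ((convex_stdSimplex ℝ _).isPathConnected
      ⟨_, (stdSimplex.vertex (S := ℝ) (0 : Fin (m + 1))).2⟩)
  exact Joined.map (PathConnectedSpace.joined _ t) (P.simplexMap τ).curry.continuous

variable [∀ c, CompactlyGeneratedSpace (F.obj c)]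
  (hp : ∀ (c : C) (n : ℕ), HasHomotopyLifting P.p (F.obj c × (Fin n → I)))
  (hbase : ∀ c : C, SimplyConnectedSpace (P.baseComponent c))
  (hfib : ∀ c : C, IsSimpleSpace (P.fib c))

/-- The components of the mapping spaces, with the restrictions of `f` to the simplices. -/
def liftSystem : LiftSystem (fun c => P.totalComponent c) (fun c => P.baseComponent c)
    (fun c => P.fib c) where
  q := P.proj
  pullE α := P.pullTotal hg α
  pullB α := P.pullBase hg α
  pullE_id c e := Subtype.ext (ContinuousMap.ext fun a => by simp [pullTotal])
  pullE_comp α β e := Subtype.ext (ContinuousMap.ext fun a => by simp [pullTotal])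
  pullB_id c e := Subtype.ext (ContinuousMap.ext fun a => by simp [pullBase])
  q_pullE α e := rfl
  ι := P.fibIncl
  base := P.basePt
  fibration := P.isSimpleFibration hp hbase hfib
  b τ := ⟨fun t => ⟨(P.simplexMap τ).curry t, P.simplexMap_mem hg τ t⟩,
    (P.simplexMap τ).curry.continuous.subtype_mk _⟩
  b_map θ τ t := Subtype.ext (P.simplexMap_map θ τ t)
  g c := ⟨P.g c, mem_pathComponent_self _⟩
  q_g τ t := Subtype.ext ((P.comm _).trans (P.simplexMap_zero τ t).symm)

/-- Transport of a spheroid to the fibre over `f_c` computes the difference class of the restricted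
spheroid. -/
theorem diff_eq_of_isFibTransport {n : ℕ} {c c' : C} (α : c ⟶ c')
    {a : GenLoop (Fin (n + 1)) (P.fib c') (P.basePt c')}
    {b : GenLoop (Fin (n + 1)) (P.fib c) (P.basePt c)} (h : P.IsFibTransport α a b) :
    (P.isSimpleFibration hp hbase hfib c).diff
      ((P.pullTotal hg α).comp (ContinuousMap.const _ (P.fibIncl c' (P.basePt c'))))
      ((P.pullTotal hg α).comp ((P.fibIncl c').comp a.1)) = spheroidClass b := by
  obtain ⟨ω, γ, H, h0, h1, hω, hγ⟩ := h
  have hbd : (0 : Fin (n + 1) → I) ∈ Cube.boundary (Fin (n + 1)) := ⟨0, Or.inl rfl⟩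
  have hH : ∀ x, H x ∈ P.totalComponent c := fun x => by
    have h2 : Joined (H (0, x.2)) (H (x.1, x.2)) :=
      joined_of_continuous (f := fun t => H (t, x.2)) (by fun_prop) x.1
    rw [h0] at h2
    exact Joined.mem_pathComponent h2 (P.comp_map_mem_totalComponent hg α (a x.2).2.1)
  let K : C(I × (Fin (n + 1) → I), P.totalComponent c) := ⟨fun x => ⟨H x, hH x⟩, by fun_prop⟩
  refine (P.isSimpleFibration hp hbase hfib c).diff_eq (joinedIn_fibrePairs_iff.2
    ⟨K.comp ⟨fun x => (x.1, 0), by fun_prop⟩, K, fun s => Subtype.ext ?_, fun s => Subtype.ext ?_,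
      fun s => Subtype.ext (h0 s), fun s => Subtype.ext (h1 s), fun x => Subtype.ext ?_,
      fun t s hs => Subtype.ext ?_⟩)
  · refine (h0 0).trans ?_
    have := a.2 0 hbd
    exact congrArg (fun x : P.fib c' => x.1.comp (F.map α).hom) this
  · exact (h1 0).trans (congrArg Subtype.val (b.2 0 hbd))
  · exact (hω x.1 0).trans (hω x.1 x.2).symm
  · exact (hγ t 0 hbd).trans (hγ t s hs).symm

include hg hp hbase hfib in
/-- A spheroid in the fibre can be carried along a path from `g_{c'} ∘ F(α)` to `g_c`. -/
theorem exists_isFibTransport {n : ℕ} {c c' : C} (α : c ⟶ c')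
    (a : GenLoop (Fin (n + 1)) (P.fib c') (P.basePt c')) :
    ∃ b : GenLoop (Fin (n + 1)) (P.fib c) (P.basePt c), P.IsFibTransport α a b := by
  have hF := P.isSimpleFibration hp hbase hfib c
  have hF' := P.isSimpleFibration hp hbase hfib c'
  have := hF.pathConnected
  obtain ⟨δ⟩ := PathConnectedSpace.joined (P.pullTotal hg α (P.fibIncl c' (P.basePt c')))
    (P.fibIncl c (P.basePt c))
  have hpair : (ContinuousMap.const (Fin (n + 1) → I)
        (P.pullTotal hg α (P.fibIncl c' (P.basePt c'))),
      (P.pullTotal hg α).comp ((P.fibIncl c').comp a.1)) ∈ fibrePairs (P.proj c) (n + 1) :=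
    (P.liftSystem hg hp hbase hfib).pullE_mem_fibrePairs α (const_mem_fibrePairs hF' a)
  let δ' : Path (ContinuousMap.const (Fin (n + 1) → I)
      (P.pullTotal hg α (P.fibIncl c' (P.basePt c'))))
      (ContinuousMap.const (Fin (n + 1) → I) (P.fibIncl c (P.basePt c))) :=
    δ.map ContinuousMap.continuous_const'
  obtain ⟨v, γ, hγ⟩ := exists_path_fibrePairs hF.lift δ' hpair
  have h1 := hγ 1
  rw [δ'.target, γ.target] at h1
  obtain ⟨b, rfl⟩ := exists_genLoop hF h1
  refine ⟨b, ⟨fun t => P.p.comp (δ t).1, ?_⟩, ⟨fun t => (δ t).1, by fun_prop⟩,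
    ⟨fun x => (γ x.1 x.2).1, ?_⟩, fun s => ?_, fun s => ?_, fun t s => ?_, fun t s hs => ?_⟩
  · exact (ContinuousMap.continuous_postcomp P.p).comp (by fun_prop)
  · have hc := ContinuousMap.continuous_uncurry_of_continuous γ.toContinuousMap
    exact continuous_subtype_val.comp hc
  · change (γ 0 s).1 = _
    rw [γ.source]; rfl
  · change (γ 1 s).1 = _
    rw [γ.target]; rfl
  · exact (congrArg Subtype.val ((hγ t).1 s)).symm
  · exact (congrArg Subtype.val ((hγ t).2 s hs)).symm

/-- The maps `fibMap` are induced by the restrictions along `F α`. Since difference classes are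
well-defined, the class chosen in the definition of `fibMap` does not matter. -/
theorem isInduced_fibMap (n : ℕ) :
    (P.liftSystem hg hp hbase hfib).IsInduced (n := n) (fun α => P.fibMap n α) := by
  intro c c' α u v huv
  have hF := P.isSimpleFibration hp hbase hfib c
  have hF' := P.isSimpleFibration hp hbase hfib c'
  let x : P.fibGroup n c' := hF'.diff u v
  have hex : ∃ x' : P.fibGroup n c, ∃ (a : GenLoop (Fin (n + 1)) (P.fib c') (P.basePt c'))
      (b : GenLoop (Fin (n + 1)) (P.fib c) (P.basePt c)),
      x = Quotient.mk (GenLoop.Homotopic.setoid _ _) a ∧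
      x' = Quotient.mk (GenLoop.Homotopic.setoid _ _) b ∧ P.IsFibTransport α a b := by
    obtain ⟨a, ha⟩ := spheroidClass_surjective x
    obtain ⟨b, hb⟩ := P.exists_isFibTransport hg hp hbase hfib α a
    exact ⟨_, a, b, ha.symm, rfl, hb⟩
  obtain ⟨a, b, ha, hb, hab⟩ := Classical.epsilon_spec hex
  refine hb.trans ((P.diff_eq_of_isFibTransport hg hp hbase hfib α hab).symm.trans ?_)
  obtain ⟨a', ha'⟩ := hF'.exists_spheroid huv
  have h1 : spheroidClass a' = spheroidClass a := (hF'.diff_eq ha').symm.trans ha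
  have h2 := ha'.trans (genLoop_homotopic_joinedIn hF' (spheroidClass_eq_iff.1 h1) _
    (const_mem_fibrePairs hF' a'))
  exact (hF.diff_congr (h2.fibrePairs_map (P.pullTotal hg α) (P.pullBase hg α)
    fun _ => rfl)).symm

include hg hp hbase hfib in
/-- A compatible family of lifts of the simplices of the nerve is the same as a lift on the homotopy
colimit; joint continuity is the exponential law for compactly generated spaces. -/
theorem exists_lift
    (hcoh : ∀ n : ℕ, NerveCohomologyVanishes (A := P.fibGroup n) (P.fibMap n) (n + 1)) :
    ∃ G : C(Hocolim F, Y), P.p.comp G = P.f ∧ ∀ c, G.comp (Hocolim.incl F c) = P.g c := by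
  obtain ⟨e, h1, h2, h3⟩ := (P.liftSystem hg hp hbase hfib).exists_lift
    (P.isInduced_fibMap hg hp hbase hfib) hcoh
  let G : PreHocolim F → Y := fun x => (e x.1.2 x.2.1).1 x.2.2
  have hG : ∀ x x', HocolimRel F x x' → G x = G x' := by
    rintro _ _ ⟨θ, τ, t, a⟩
    exact DFunLike.congr_fun (congrArg Subtype.val (h2 θ τ t)) a
  have hGc : Continuous G := continuous_sigma fun τ =>
    continuous_eval_of_compactlyGenerated (continuous_subtype_val.comp (e τ.2).continuous)
  refine ⟨⟨Quot.lift G hG, continuous_quot_lift hG hGc⟩, ContinuousMap.ext fun x => ?_,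
    fun c => ContinuousMap.ext fun a => ?_⟩
  · induction x using Quot.ind with
    | mk x => exact DFunLike.congr_fun (congrArg Subtype.val (h1 x.1.2 x.2.1)) x.2.2
  · exact DFunLike.congr_fun
      (congrArg Subtype.val (h3 ((Functor.const (Fin 1)).obj c) (stdSimplex.vertex 0))) a

end Functoriality

end HocolimLiftingProblem

end

theorem theoremt {C : Type w} [Category.{v} C] (F : C ⥤ TopCat.{u})
    [∀ c, CompactlyGeneratedSpace (F.obj c)]
    {Y : Type y} {Z : Type z} [TopologicalSpace Y] [TopologicalSpace Z]
    (P : HocolimLiftingProblem F Y Z)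
    (hp : ∀ (c : C) (n : ℕ), HasHomotopyLifting P.p (F.obj c × (Fin n → unitInterval)))
    (hg : ∀ {c c' : C} (α : c ⟶ c'),
      ContinuousMap.Homotopic ((P.g c').comp (F.map α).hom) (P.g c))
    (hbase : ∀ c : C, SimplyConnectedSpace (P.baseComponent c))
    (hfib : ∀ c : C, IsSimpleSpace (P.fib c))
    (hcoh : ∀ n : ℕ, NerveCohomologyVanishes (A := P.fibGroup n) (P.fibMap n) (n + 1)) :
    ∃ G : C(Hocolim F, Y), P.p.comp G = P.f ∧ ∀ c, G.comp (Hocolim.incl F c) = P.g c := by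
  exact P.exists_lift hg hp hbase hfib hcoh
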